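/- Let $M$ be a smooth real supermanifold of dimension $n|m$, with local coordinates $x^a$ (even and odd), $\tilde a$ the parity of $x^a$, $\partial_a$ the left partial derivatives, and $Dx$ the coordinate volume form. For $w\in\mathbb R$ let $\mathfrak V_w(M)$ be the space of densities of weight $w$, written $\psi=f\,(Dx)^w$ in coordinates, where $(Dx')^w=\left|\mathrm{Ber}\,\frac{\partial x'}{\partial x}\right|^w (Dx)^w$; let $\mathfrak V(M)=\bigoplus_{w\in\mathbb R}\mathfrak V_w(M)$ be the algebra of densities. The canonical scalar product $\langle\Psi,\Phi\rangle$ is the integral over $M$ of the weight-one component of $\Psi\Phi$ (Berezin integral in coordinates; one argument compactly supported in a coordinate domain). A second-order operator of parity $\varepsilon\in\mathbb Z_2$ is a linear map $\Delta:\mathfrak V(M)\to\mathfrak V(M)$ of parity $\varepsilon$ all of whose triple supercommutators $[[[\Delta,f],g],h]$ with multiplication operators vanish. A bracket of parity $\varepsilon$ is a bilinear operation on $\mathfrak V(M)$ of parity $\varepsilon$ with $\{f,g\}=(-1)^{\tilde f\tilde g}\{g,f\}$ and $\{f,gh\}=\{f,g\}h+(-1)^{(\varepsilon+\tilde f)\tilde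 g}g\{f,h\}$. The operator $\Delta$ generates the bracket if $$\{f,g\}=\Delta(fg)-(\Delta f)g-(-1)^{\varepsilon\tilde f}f(\Delta g)+\Delta(1)fg .$$ The operator (bracket) has weight $\lambda\in\mathbb R$ if it raises the (total) weight by $\lambda$ and its coordinate expression on $f\,(Dx)^w$, $f$ fixed, depends continuously on $w$. The operator $\Delta$ is self-adjoint if $\langle\Delta\Psi,\Phi\rangle=(-1)^{\varepsilon\tilde\Psi}\langle\Psi,\Delta\Phi\rangle$ whenever $\Psi$ is compactly supported in a coordinate domain. Theorem. (1) Every second-order operator $\Delta$ generates a bracket, which is unique, and which has weight $\lambda$ if $\Delta$ has weight $\lambda$. (2) For every bracket of weight $\lambda$ there is one and only one second-order operator $\Delta$ that generates it and satisfies $\Delta 1=0$ and is self-adjoint; this operator has weight $\lambda$. Thus such operators and brackets are in one-to-one correspondence. (3) A bracket of weight zero is given in every coordinate system by unique data $(S^{ab},\gamma^a,\theta)$, with $S^{ab}=(-1)^{\tilde a\tilde b}S^{ba}$, of parities $\varepsilon+\tilde a+\tilde b$, $\varepsilon+\tilde a$, $\varepsilon$: for $\psi=f(Dx)^{w}$ and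 $\chi=g(Dx)^{w'}$, $$\{\psi,\chi\}=\Bigl(S^{ab}\partial_bf\,\partial_ag\,(-1)^{\tilde a\tilde f}+w\,\gamma^af\,\partial_ag\,(-1)^{\tilde a\tilde f}+w'\gamma^a\partial_af\,g+ww'\theta fg\Bigr)(Dx)^{w+w'} .$$ The operator of (2) then acts on densities of weight $w$ as the canonical pencil $$\Delta_w=\tfrac12\Bigl(S^{ab}\partial_b\partial_a+\bigl(\partial_bS^{ba}(-1)^{\tilde b(\varepsilon+1)}+(2w-1)\gamma^a\bigr)\partial_a+w\,\partial_a\gamma^a(-1)^{\tilde a(\varepsilon+1)}+w(w-1)\theta\Bigr).$$ -/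

import Mathlib

open TopologicalSpace MeasureTheory
open scoped ContDiff DirectSum

/-! ## The Grassmann algebra with `m` generators -/

/-- The real Grassmann algebra on `ξ₁, …, ξₘ`: an element is its table of coefficients in the basis
`ξ^I = ξ_{i₁} ⋯ ξ_{iₖ}`, `I = {i₁ < ⋯ < iₖ}`. -/
def Grassmann (m : ℕ) : Type := Finset (Fin m) → ℝ

namespace Grassmann

noncomputable instance (m : ℕ) : NormedAddCommGroup (Grassmann m) :=
  inferInstanceAs (NormedAddCommGroup (Finset (Fin m) → ℝ))

noncomputable instance (m : ℕ) : NormedSpace ℝ (Grassmann m) :=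
  inferInstanceAs (NormedSpace ℝ (Finset (Fin m) → ℝ))

variable {m : ℕ}

/-- The sign `(-1)^{#{(i, j) ∈ I × J : j < i}}` in `ξ^I ξ^J = ± ξ^{I ∪ J}` (`I`, `J` disjoint). -/
def shuffleSign (I J : Finset (Fin m)) : ℝ :=
  (-1) ^ (∑ i ∈ I, ∑ j ∈ J, if j < i then 1 else 0 : ℕ)

noncomputable instance : Mul (Grassmann m) :=
  ⟨fun f g K => ∑ I ∈ K.powerset, shuffleSign I (K \ I) * f I * g (K \ I)⟩

noncomputable instance : One (Grassmann m) := ⟨fun K => if K = ∅ then 1 else 0⟩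

@[ext] theorem ext {f g : Grassmann m} (h : ∀ K, f K = g K) : f = g := funext h

theorem add_apply (f g : Grassmann m) (K : Finset (Fin m)) : (f + g) K = f K + g K := rfl

theorem zero_apply (K : Finset (Fin m)) : (0 : Grassmann m) K = 0 := rfl

theorem smul_apply (r : ℝ) (f : Grassmann m) (K : Finset (Fin m)) : (r • f) K = r * f K := rfl

theorem mul_apply (f g : Grassmann m) (K : Finset (Fin m)) :
    (f * g) K = ∑ I ∈ K.powerset, shuffleSign I (K \ I) * f I * g (K \ I) := rfl

theorem one_apply (K : Finset (Fin m)) : (1 : Grassmann m) K = if K = ∅ then 1 else 0 := rfl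

theorem shuffleSign_union_left {I J : Finset (Fin m)} (h : Disjoint I J) (K : Finset (Fin m)) :
    shuffleSign (I ∪ J) K = shuffleSign I K * shuffleSign J K := by
  simp only [shuffleSign]
  rw [Finset.sum_union h, pow_add]

theorem shuffleSign_union_right (I : Finset (Fin m)) {J K : Finset (Fin m)} (h : Disjoint J K) :
    shuffleSign I (J ∪ K) = shuffleSign I J * shuffleSign I K := by
  simp only [shuffleSign]
  rw [← pow_add, ← Finset.sum_add_distrib]
  congr 1
  exact Finset.sum_congr rfl fun i _ => Finset.sum_union h

theorem shuffleSign_swap {I J : Finset (Fin m)} (h : Disjoint I J) :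
    shuffleSign I J = (-1) ^ (I.card * J.card) * shuffleSign J I := by
  have key : (∑ i ∈ I, ∑ j ∈ J, if j < i then 1 else 0 : ℕ)
      + (∑ j ∈ J, ∑ i ∈ I, if i < j then 1 else 0 : ℕ) = I.card * J.card := by
    rw [Finset.sum_comm (s := J), ← Finset.sum_add_distrib]
    have : ∀ i ∈ I, ((∑ j ∈ J, if j < i then 1 else 0 : ℕ)
        + ∑ j ∈ J, if i < j then 1 else 0 : ℕ) = J.card := by
      intro i hi
      rw [← Finset.sum_add_distrib, Finset.card_eq_sum_ones]
      refine Finset.sum_congr rfl fun j hj => ?_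
      have : i ≠ j := fun e => Finset.disjoint_left.1 h hi (e ▸ hj)
      rcases lt_or_gt_of_ne this with h1 | h1
      · simp [h1, h1.le]
      · simp [h1, h1.le]
    rw [Finset.sum_congr rfl this]
    simp
  simp only [shuffleSign]
  rw [← key, pow_add, mul_assoc, ← pow_add, ← two_mul, pow_mul]
  simp

theorem mul_assoc' (f g h : Grassmann m) : f * g * h = f * (g * h) := by
  ext K
  simp only [mul_apply, Finset.sum_mul, Finset.mul_sum]
  rw [Finset.sum_sigma', Finset.sum_sigma']
  refine Finset.sum_bij' (fun x _ => ⟨x.2, x.1 \ x.2⟩) (fun x _ => ⟨x.1 ∪ x.2, x.1⟩) ?_ ?_ ?_ ?_ ?_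
  · rintro ⟨L, I⟩ hx
    simp only [Finset.mem_sigma, Finset.mem_powerset] at hx ⊢
    exact ⟨hx.2.trans hx.1, Finset.sdiff_subset_sdiff hx.1 le_rfl⟩
  · rintro ⟨I, J⟩ hx
    simp only [Finset.mem_sigma, Finset.mem_powerset] at hx ⊢
    exact ⟨Finset.union_subset hx.1 (hx.2.trans Finset.sdiff_subset), Finset.subset_union_left⟩
  · rintro ⟨L, I⟩ hx
    simp only [Finset.mem_sigma, Finset.mem_powerset] at hx
    simp [Finset.union_sdiff_of_subset hx.2]
  · rintro ⟨I, J⟩ hx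
    simp only [Finset.mem_sigma, Finset.mem_powerset] at hx
    have hd : Disjoint I J := (Finset.subset_sdiff.1 hx.2).2.symm
    simp [Finset.union_sdiff_cancel_left hd]
  · rintro ⟨L, I⟩ hx
    simp only [Finset.mem_sigma, Finset.mem_powerset] at hx
    obtain ⟨hL, hI⟩ := hx
    have e1 : (K \ I) \ (L \ I) = K \ L := by
      ext a
      simp only [Finset.mem_sdiff]
      constructor
      · rintro ⟨⟨h1, h2⟩, h3⟩
        exact ⟨h1, fun h4 => h3 ⟨h4, h2⟩⟩
      · rintro ⟨h1, h2⟩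
        exact ⟨⟨h1, fun h3 => h2 (hI h3)⟩, fun h3 => h2 h3.1⟩
    have e2 : L = I ∪ (L \ I) := (Finset.union_sdiff_of_subset hI).symm
    have e3 : K \ I = (L \ I) ∪ (K \ L) := by
      ext a
      simp only [Finset.mem_sdiff, Finset.mem_union]
      constructor
      · rintro ⟨h1, h2⟩
        by_cases h3 : a ∈ L
        · exact Or.inl ⟨h3, h2⟩
        · exact Or.inr ⟨h1, h3⟩
      · rintro (⟨h1, h2⟩ | ⟨h1, h2⟩)
        · exact ⟨hL h1, h2⟩
        · exact ⟨h1, fun h3 => h2 (hI h3)⟩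
    have d1 : Disjoint I (L \ I) := Finset.disjoint_sdiff
    have d2 : Disjoint (L \ I) (K \ L) :=
      Finset.disjoint_of_subset_left Finset.sdiff_subset Finset.disjoint_sdiff
    have s1 : shuffleSign L (K \ L) = shuffleSign I (K \ L) * shuffleSign (L \ I) (K \ L) := by
      conv_lhs => rw [e2, Finset.union_sdiff_of_subset hI]
      rw [← shuffleSign_union_left d1, Finset.union_sdiff_of_subset hI]
    have s2 : shuffleSign I (K \ I) = shuffleSign I (L \ I) * shuffleSign I (K \ L) := by
      rw [← shuffleSign_union_right I d2, ← e3]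
    simp only [e1]
    rw [s1, s2]
    ring

theorem one_mul' (f : Grassmann m) : 1 * f = f := by
  ext K
  rw [mul_apply, Finset.sum_eq_single ∅]
  · simp [shuffleSign, one_apply]
  · intro I _ hI
    simp [one_apply, hI]
  · simp

theorem mul_one' (f : Grassmann m) : f * 1 = f := by
  ext K
  rw [mul_apply, Finset.sum_eq_single K]
  · simp [shuffleSign, one_apply]
  · intro I hI hne
    have : K \ I ≠ ∅ := fun h => hne (Finset.Subset.antisymm (Finset.mem_powerset.1 hI)
      (Finset.sdiff_eq_empty_iff_subset.1 h))
    simp [one_apply, this]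
  · simp

noncomputable instance : Ring (Grassmann m) :=
  { (inferInstance : AddCommGroup (Grassmann m)), (inferInstance : Mul (Grassmann m)),
    (inferInstance : One (Grassmann m)) with
    mul_assoc := mul_assoc'
    one_mul := one_mul'
    mul_one := mul_one'
    zero_mul := fun f => by ext K; simp [mul_apply, zero_apply]
    mul_zero := fun f => by ext K; simp [mul_apply, zero_apply]
    left_distrib := fun f g h => by
      ext K; simp [mul_apply, add_apply, mul_add, Finset.sum_add_distrib]
    right_distrib := fun f g h => by
      ext K; simp [mul_apply, add_apply, mul_add, add_mul, Finset.sum_add_distrib] }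

noncomputable instance : Algebra ℝ (Grassmann m) :=
  Algebra.ofModule
    (fun r f g => by
      ext K
      simp only [mul_apply, smul_apply, Finset.mul_sum]
      exact Finset.sum_congr rfl fun _ _ => by ring)
    (fun r f g => by
      ext K
      simp only [mul_apply, smul_apply, Finset.mul_sum]
      exact Finset.sum_congr rfl fun _ _ => by ring)

/-- The body (the part free of the generators). -/
def body (f : Grassmann m) : ℝ := f ∅

/-- The odd generator `ξ_μ`. -/
noncomputable def xi (μ : Fin m) : Grassmann m := fun I => if I = {μ} then 1 else 0

/-- Elements of parity `p`. -/
def parity (m : ℕ) (p : ZMod 2) : Submodule ℝ (Grassmann m) where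
  carrier := {f | ∀ I : Finset (Fin m), (I.card : ZMod 2) ≠ p → f I = 0}
  add_mem' hf hg I hI := by rw [add_apply, hf I hI, hg I hI, add_zero]
  zero_mem' _ _ := rfl
  smul_mem' r f hf I hI := by rw [smul_apply, hf I hI, mul_zero]

/-- The left derivative `∂/∂ξ_μ`. -/
noncomputable def oddDeriv (μ : Fin m) (f : Grassmann m) : Grassmann m := fun I =>
  if μ ∈ I then 0 else (-1) ^ (I.filter (· < μ)).card * f (insert μ I)

theorem parity_mul {p q : ZMod 2} {f g : Grassmann m} (hf : f ∈ parity m p)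
    (hg : g ∈ parity m q) : f * g ∈ parity m (p + q) := by
  intro K hK
  rw [mul_apply]
  refine Finset.sum_eq_zero fun I hI => ?_
  by_cases h1 : (I.card : ZMod 2) = p
  · by_cases h2 : ((K \ I).card : ZMod 2) = q
    · exfalso
      apply hK
      rw [← h1, ← h2, ← Nat.cast_add, add_comm I.card,
        Finset.card_sdiff_add_card_eq_card (Finset.mem_powerset.1 hI)]
    · rw [hg _ h2, mul_zero]
  · rw [hf _ h1, mul_zero, zero_mul]

theorem even_comm {f : Grassmann m} (hf : f ∈ parity m 0) (g : Grassmann m) :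
    f * g = g * f := by
  ext K
  rw [mul_apply, mul_apply]
  refine Finset.sum_bij' (fun I _ => K \ I) (fun I _ => K \ I) ?_ ?_ ?_ ?_ ?_
  · intro I _
    simp
  · intro I _
    simp
  · intro I hI
    simpa using Finset.inter_eq_right.2 (Finset.mem_powerset.1 hI)
  · intro I hI
    simpa using Finset.inter_eq_right.2 (Finset.mem_powerset.1 hI)
  · intro I hI
    have e : K \ (K \ I) = I := by
      simpa using Finset.inter_eq_right.2 (Finset.mem_powerset.1 hI)
    rw [e]
    by_cases h : (I.card : ZMod 2) = 0
    · have he : Even I.card := (ZMod.natCast_eq_zero_iff_even).1 h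
      rw [shuffleSign_swap (Finset.disjoint_sdiff), Even.neg_one_pow (he.mul_right _)]
      ring
    · rw [hf I h]
      ring

/-- The even part, a commutative subalgebra. -/
def even (m : ℕ) : Subalgebra ℝ (Grassmann m) where
  carrier := parity m 0
  mul_mem' hf hg := by simpa using parity_mul hf hg
  add_mem' hf hg := (parity m 0).add_mem hf hg
  algebraMap_mem' r := by
    intro I hI
    have : I ≠ ∅ := by rintro rfl; simp at hI
    rw [Algebra.algebraMap_eq_smul_one, smul_apply, one_apply, if_neg this, mul_zero]

noncomputable instance : CommRing (even m) :=
  { (inferInstance : Ring (even m)) with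
    mul_comm := fun f _ => Subtype.ext (even_comm f.2 _) }

/-- The even component of an element. -/
noncomputable def toEven (f : Grassmann m) : even m :=
  ⟨fun I => if (I.card : ZMod 2) = 0 then f I else 0, fun _ hI => if_neg hI⟩

/-- The Berezinian (superdeterminant) of an even invertible supermatrix
`(A B; C D)`: `Ber = det (A - B D⁻¹ C) / det D`. The entries of `A`, `D` and `A - B D⁻¹ C` are
even, so `toEven` only changes the type in which the determinants are taken. -/
noncomputable def ber {n : ℕ} (J : Matrix (Fin n ⊕ Fin m) (Fin n ⊕ Fin m) (Grassmann m)) :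
    even m :=
  ((J.toBlocks₁₁ - J.toBlocks₁₂ * ((J.toBlocks₂₂.map toEven)⁻¹).map Subtype.val *
      J.toBlocks₂₁).map toEven).det *
    Ring.inverse (J.toBlocks₂₂.map toEven).det

/-- The power `|J|^w` of an even element with body `b ≠ 0`: writing `J = b (1 + ν)` with `ν`
nilpotent (`ν^{m+1} = 0`), it is `|b|^w (1 + ν)^w`, where `|b|^w = exp (w log |b|)` and `(1 + ν)^w`
is given by its (terminating) binomial expansion. -/
noncomputable def absPow (J : even m) (w : ℝ) : even m :=
  Real.exp (w * Real.log |body J.1|) • ∑ k ∈ Finset.range (m + 1),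
    Ring.choose w k • ((body J.1)⁻¹ • (J - algebraMap ℝ (even m) (body J.1))) ^ k

theorem pow_apply_of_card_lt {f : Grassmann m} (hf : body f = 0) (k : ℕ) :
    ∀ I : Finset (Fin m), I.card < k → (f ^ k) I = 0 := by
  induction k with
  | zero => intro I hI; omega
  | succ k ih =>
    intro K hK
    rw [pow_succ, mul_apply]
    refine Finset.sum_eq_zero fun I hI => ?_
    by_cases h : I = K
    · subst h
      have : f (I \ I) = 0 := by rw [Finset.sdiff_self]; exact hf
      rw [this, mul_zero]
    · have h1 : I.card < K.card :=
        Finset.card_lt_card (lt_of_le_of_ne (Finset.mem_powerset.1 hI) h)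
      rw [ih I (by omega), mul_zero, zero_mul]

theorem pow_eq_zero_of_body {f : even m} (hf : body f.1 = 0) {k : ℕ} (hk : m < k) : f ^ k = 0 := by
  apply Subtype.ext
  rw [SubmonoidClass.coe_pow]
  ext I
  refine pow_apply_of_card_lt hf k I (lt_of_le_of_lt ?_ hk)
  simpa using Finset.card_le_univ I

theorem absPow_zero (J : even m) : absPow J 0 = 1 := by
  unfold absPow
  rw [Finset.sum_range_succ', Finset.sum_eq_zero]
  · simp
  · intro k _
    rw [Ring.choose_zero_succ, zero_smul]

theorem absPow_add (J : even m) (u v : ℝ) : absPow J (u + v) = absPow J u * absPow J v := by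
  unfold absPow
  set ν := (body J.1)⁻¹ • (J - algebraMap ℝ (even m) (body J.1)) with hν
  have hb : body ν.1 = 0 := by
    have : ν.1 = (body J.1)⁻¹ • (J.1 - body J.1 • (1 : Grassmann m)) := by
      rw [hν, Algebra.algebraMap_eq_smul_one]; rfl
    rw [this, sub_eq_add_neg]
    simp only [body, smul_apply, add_apply]
    have h2 : (-(J.1 ∅ • (1 : Grassmann m))) ∅ = -(J.1 ∅ * 1) := rfl
    rw [h2]; simp
  rw [smul_mul_smul_comm, ← Real.exp_add, ← add_mul]
  congr 1
  rw [Finset.sum_mul_sum]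
  have h1 : ∀ k ∈ Finset.range (m + 1), Ring.choose (u + v) k • ν ^ k
      = ∑ p ∈ Finset.HasAntidiagonal.antidiagonal k, (Ring.choose u p.1 • ν ^ p.1) * (Ring.choose v p.2 • ν ^ p.2) := by
    intro k _
    rw [Ring.add_choose_eq k (Commute.all u v), Finset.sum_smul]
    refine Finset.sum_congr rfl fun p hp => ?_
    rw [smul_mul_smul_comm, ← pow_add, Finset.HasAntidiagonal.mem_antidiagonal.1 hp]
  rw [Finset.sum_congr rfl h1, Finset.sum_sigma', ← Finset.sum_product']
  refine Finset.sum_of_injOn (fun x => x.2) ?_ ?_ ?_ ?_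
  · rintro ⟨k, p⟩ hx ⟨k', p'⟩ hx' h
    simp only [Finset.coe_sigma, Set.mem_sigma_iff, Finset.mem_coe, Finset.HasAntidiagonal.mem_antidiagonal] at hx hx' h
    obtain rfl : p = p' := h
    obtain rfl : k = k' := hx.2.symm.trans hx'.2
    rfl
  · rintro ⟨k, p⟩ hx
    simp only [Finset.coe_sigma, Set.mem_sigma_iff, Finset.mem_coe, Finset.HasAntidiagonal.mem_antidiagonal,
      Finset.mem_range, Finset.mem_product] at hx ⊢
    omega
  · rintro ⟨i, j⟩ _ hx
    have : m < i + j := by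
      by_contra hlt
      apply hx
      refine ⟨⟨i + j, (i, j)⟩, ?_, rfl⟩
      simp only [Finset.coe_sigma, Set.mem_sigma_iff, Finset.mem_coe, Finset.HasAntidiagonal.mem_antidiagonal,
        Finset.mem_range, and_true]
      omega
    rw [smul_mul_smul_comm, ← pow_add, pow_eq_zero_of_body hb this, smul_zero]
  · intro x _
    rfl

end Grassmann

/-! ## Superdomains: `n` even and `m` odd coordinates -/

section Superdomain

variable {n m : ℕ}

open Grassmann

/-- Extension of a function on an open set by zero. -/
noncomputable def extendZero {V : Opens (Fin n → ℝ)} (f : V → Grassmann m) :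
    (Fin n → ℝ) → Grassmann m :=
  Function.extend Subtype.val f 0

theorem extendZero_apply {V : Opens (Fin n → ℝ)} (f : V → Grassmann m) (x : V) :
    extendZero f x.1 = f x :=
  Subtype.val_injective.extend_apply f 0 x

/-- The algebra `C^∞(V) ⊗ Λ(ξ₁, …, ξₘ)` of superfunctions over an open set `V` of `ℝⁿ`, as the smooth
functions with values in the Grassmann algebra. -/
def superFun (m : ℕ) (V : Opens (Fin n → ℝ)) : Subalgebra ℝ (V → Grassmann m) where
  carrier := {f | ContDiffOn ℝ ∞ (extendZero f) V}
  add_mem' {f g} hf hg := by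
    refine (ContDiffOn.add hf hg).congr fun x hx => ?_
    change _ = extendZero f x + extendZero g x
    rw [extendZero_apply _ ⟨x, hx⟩, extendZero_apply f ⟨x, hx⟩, extendZero_apply g ⟨x, hx⟩]
    rfl
  mul_mem' {f g} hf hg := by
    have hf' : ∀ K, ContDiffOn ℝ ∞ (fun x => extendZero f x K) V :=
      fun K => (contDiffOn_pi (𝕜 := ℝ) (n := ∞)
        (Φ := fun x => (extendZero f x : Finset (Fin m) → ℝ))).1 hf K
    have hg' : ∀ K, ContDiffOn ℝ ∞ (fun x => extendZero g x K) V :=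
      fun K => (contDiffOn_pi (𝕜 := ℝ) (n := ∞)
        (Φ := fun x => (extendZero g x : Finset (Fin m) → ℝ))).1 hg K
    refine (contDiffOn_pi (𝕜 := ℝ) (n := ∞)
      (Φ := fun x => (extendZero (f * g) x : Finset (Fin m) → ℝ))).2 fun K => ?_
    have : ContDiffOn ℝ ∞ (fun x => ∑ I ∈ K.powerset,
        shuffleSign I (K \ I) * extendZero f x I * extendZero g x (K \ I)) V :=
      ContDiffOn.sum fun I _ => (contDiffOn_const.mul (hf' I)).mul (hg' _)
    refine this.congr fun x hx => ?_
    rw [extendZero_apply _ ⟨x, hx⟩, extendZero_apply f ⟨x, hx⟩, extendZero_apply g ⟨x, hx⟩]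
    exact mul_apply _ _ _
  algebraMap_mem' r := by
    refine (contDiffOn_const (c := algebraMap ℝ (Grassmann m) r)).congr fun x hx => ?_
    rw [extendZero_apply _ ⟨x, hx⟩]
    rfl

/-- Superfunctions of parity `p`. -/
def superFunParity (p : ZMod 2) {V : Opens (Fin n → ℝ)} (f : superFun m V) : Prop :=
  ∀ x, f.1 x ∈ parity m p

/-- Restriction of superfunctions to a smaller open set. -/
def restrictFun {V V' : Opens (Fin n → ℝ)} (h : V' ≤ V) : superFun m V →ₐ[ℝ] superFun m V' where
  toFun f := ⟨fun x => f.1 ⟨x.1, h x.2⟩, by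
    refine ContDiffOn.congr (f := extendZero f.1) (ContDiffOn.mono f.2 h) fun x hx => ?_
    rw [extendZero_apply _ ⟨x, hx⟩]
    exact (extendZero_apply f.1 ⟨x, h hx⟩).symm⟩
  map_one' := rfl
  map_mul' _ _ := rfl
  map_zero' := rfl
  map_add' _ _ := rfl
  commutes' _ := rfl

/-- Labels of the coordinates: `Sum.inl k` for the even coordinate `x_k`, `Sum.inr μ` for the odd
coordinate `ξ_μ`. -/
abbrev CoordIndex (n m : ℕ) : Type := Fin n ⊕ Fin m

/-- Parity `ã` of a coordinate. -/
def coordParity : CoordIndex n m → ZMod 2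
  | Sum.inl _ => 0
  | Sum.inr _ => 1

/-- The coordinates as superfunctions. -/
noncomputable def coordFun (V : Opens (Fin n → ℝ)) : CoordIndex n m → superFun m V
  | Sum.inl k => ⟨fun x => x.1 k • (1 : Grassmann m), by
      refine ContDiffOn.congr (f := fun x : Fin n → ℝ => x k • (1 : Grassmann m)) ?_ fun x hx => ?_
      · exact ((contDiff_apply ℝ ℝ k).smul contDiff_const).contDiffOn
      · rw [extendZero_apply _ ⟨x, hx⟩]⟩
  | Sum.inr μ => ⟨fun _ => xi μ, by
      refine (contDiffOn_const (c := (xi μ : Grassmann m))).congr fun x hx => ?_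
      rw [extendZero_apply _ ⟨x, hx⟩]⟩

/-- The (left) partial derivatives `∂_a`. -/
noncomputable def pd {V : Opens (Fin n → ℝ)} (a : CoordIndex n m) (f : V → Grassmann m) :
    V → Grassmann m :=
  match a with
  | Sum.inl k => fun x => fderiv ℝ (extendZero f) x.1 (Pi.single k 1)
  | Sum.inr μ => fun x => oddDeriv μ (f x)

/-- The Berezin integral `∫_V f Dx`, the Lebesgue integral of the coefficient of `ξ₁ ⋯ ξₘ`. -/
noncomputable def berezinIntegral {V : Opens (Fin n → ℝ)} (f : V → Grassmann m) : ℝ :=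
  ∫ x in (V : Set (Fin n → ℝ)), extendZero f x Finset.univ

/-- The sign `(-1)^{pq}`. -/
def koszul (p q : ZMod 2) : ℝ := (-1) ^ (p.val * q.val)

end Superdomain

/-! ## Supermanifolds -/

/-- The image of an open set under a chart. -/
def chartImage {n : ℕ} {X : Type*} [TopologicalSpace X]
    (e : OpenPartialHomeomorph X (Fin n → ℝ)) (W : Opens X) : Opens (Fin n → ℝ) :=
  ⟨e.target ∩ e.symm ⁻¹' W, e.isOpen_inter_preimage_symm W.isOpen⟩

/-- The domain of a chart. -/
def chartDom {n : ℕ} {X : Type*} [TopologicalSpace X]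
    (e : OpenPartialHomeomorph X (Fin n → ℝ)) : Opens X :=
  ⟨e.source, e.open_source⟩

theorem chartImage_mono {n : ℕ} {X : Type*} [TopologicalSpace X]
    (e : OpenPartialHomeomorph X (Fin n → ℝ)) {W' W : Opens X} (h : W' ≤ W) :
    chartImage e W' ≤ chartImage e W :=
  fun _ hx => ⟨hx.1, h hx.2⟩

universe u v

/-- A (smooth, real) supermanifold of dimension `n|m`, given by an atlas: a Hausdorff second
countable space covered by charts with values in `ℝⁿ`, and for any two charts an isomorphism, over
their overlap, of the sheaves of superalgebras `C^∞ ⊗ Λ(ξ₁, …, ξₘ)` of the two charts, subject to the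
cocycle condition. `trans i j W` expresses superfunctions of the coordinates of the chart `j` through
the coordinates of the chart `i`. -/
structure Supermanifold (n m : ℕ) where
  /-- the underlying topological space -/
  X : Type u
  [top : TopologicalSpace X]
  [t2 : T2Space X]
  [secondCountable : SecondCountableTopology X]
  /-- labels of the charts -/
  ι : Type v
  chart : ι → OpenPartialHomeomorph X (Fin n → ℝ)
  covers : ∀ p : X, ∃ i, p ∈ (chart i).source
  trans : ∀ (i j : ι) (W : Opens X), W ≤ chartDom (chart i) ⊓ chartDom (chart j) →
    superFun m (chartImage (chart j) W) →ₐ[ℝ] superFun m (chartImage (chart i) W)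
  trans_parity : ∀ i j W hW p f, superFunParity p f → superFunParity p (trans i j W hW f)
  trans_body : ∀ i j W hW f (x : chartImage (chart i) W) (y : chartImage (chart j) W),
    (chart i).symm x.1 = (chart j).symm y.1 →
      Grassmann.body ((trans i j W hW f).1 x) = Grassmann.body (f.1 y)
  trans_restrict : ∀ i j W hW W' (h : W' ≤ W) f,
    restrictFun (chartImage_mono (chart i) h) (trans i j W hW f) =
      trans i j W' (h.trans hW) (restrictFun (chartImage_mono (chart j) h) f)
  trans_self : ∀ i W hW f, trans i i W hW f = f
  trans_trans : ∀ i j k W hij hjk hik f,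
    trans i j W hij (trans j k W hjk f) = trans i k W hik f

namespace Supermanifold

attribute [instance] Supermanifold.top Supermanifold.t2 Supermanifold.secondCountable

variable {n m : ℕ} (M : Supermanifold.{u, v} n m)

/-- The open set of `ℝⁿ` on which the coordinates of the chart `i` take their values. -/
def domain (i : M.ι) : Opens (Fin n → ℝ) := ⟨(M.chart i).target, (M.chart i).open_target⟩

/-- The overlap of two charts. -/
def overlap (i j : M.ι) : Opens M.X := chartDom (M.chart i) ⊓ chartDom (M.chart j)

theorem chartImage_le_domain (i : M.ι) (W : Opens M.X) : chartImage (M.chart i) W ≤ M.domain i :=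
  fun _ hx => hx.1

/-- A superfunction of the coordinates of the chart `j`, expressed over the overlap through the
coordinates of the chart `i`. -/
noncomputable def change (i j : M.ι) (f : superFun m (M.domain j)) :
    superFun m (chartImage (M.chart i) (M.overlap i j)) :=
  M.trans i j (M.overlap i j) le_rfl (restrictFun (M.chartImage_le_domain j _) f)

/-- The Jacobi matrix `(∂_a x_j^b)` of the coordinates of the chart `j` with respect to the
coordinates of the chart `i`. -/
noncomputable def jacobian (i j : M.ι) (x : chartImage (M.chart i) (M.overlap i j)) :
    Matrix (CoordIndex n m) (CoordIndex n m) (Grassmann m) :=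
  fun a b => pd a (M.change i j (coordFun (M.domain j) b)).1 x

/-! ## The algebra of densities -/

/-- Families of superfunctions, one for every chart (not necessarily compatible). -/
def Family : Type _ := ∀ i : M.ι, superFun m (M.domain i)

/-- The ring structure of the product. -/
noncomputable def familyRing : Ring M.Family :=
  Pi.ring (f := fun i : M.ι => superFun m (M.domain i))

noncomputable instance : Ring M.Family := M.familyRing

/-- The algebra structure of the product. -/
noncomputable def familyAlgebra : Algebra ℝ M.Family :=
  Pi.algebra M.ι (fun i : M.ι => superFun m (M.domain i))

noncomputable instance : Algebra ℝ M.Family := M.familyAlgebra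

/-- Densities of weight `w`: for every chart `i` a superfunction `ψ_i` (standing for
`ψ_i (Dx_i)^w`), such that `ψ_i = |Dx_j / Dx_i|^w ψ_j` on overlaps, where `Dx_j / Dx_i` is the Berezinian
of the Jacobi matrix. -/
noncomputable def densities (w : ℝ) : Submodule ℝ M.Family where
  carrier := {ψ | ∀ (i j : M.ι) (x : chartImage (M.chart i) (M.overlap i j)),
    (ψ i).1 ⟨x.1, x.2.1⟩ =
      (Grassmann.absPow (Grassmann.ber (M.jacobian i j x)) w).1 * (M.change i j (ψ j)).1 x}
  add_mem' {ψ χ} hψ hχ i j x := by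
    have h : M.change i j ((ψ + χ) j) = M.change i j (ψ j) + M.change i j (χ j) := by
      change M.change i j (ψ j + χ j) = _
      simp only [change, map_add]
    rw [h]
    change (ψ i).1 _ + (χ i).1 _ = _ * ((M.change i j (ψ j)).1 x + (M.change i j (χ j)).1 x)
    rw [hψ i j x, hχ i j x, mul_add]
  zero_mem' i j x := by
    have h : M.change i j ((0 : M.Family) j) = 0 := by
      change M.change i j 0 = _
      simp only [change, map_zero]
    rw [h]
    exact (mul_zero _).symm
  smul_mem' r ψ hψ i j x := by
    have h : M.change i j ((r • ψ) j) = r • M.change i j (ψ j) := by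
      change M.change i j (r • ψ j) = _
      simp only [change, map_smul]
    rw [h]
    change r • (ψ i).1 _ = _ * (r • (M.change i j (ψ j)).1 x)
    rw [hψ i j x, mul_smul_comm]

instance densities_gradedMonoid : SetLike.GradedMonoid M.densities where
  one_mem i j x := by
    have h : M.change i j ((1 : M.Family) j) = 1 := by
      change M.change i j 1 = _
      simp only [change, map_one]
    rw [h, Grassmann.absPow_zero]
    exact (mul_one _).symm
  mul_mem {u v ψ χ} hψ hχ i j x := by
    have h : M.change i j ((ψ * χ) j) = M.change i j (ψ j) * M.change i j (χ j) := by
      change M.change i j (ψ j * χ j) = _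
      simp only [change, map_mul]
    rw [h, Grassmann.absPow_add]
    change (ψ i).1 _ * (χ i).1 _ = (_ * _) * ((M.change i j (ψ j)).1 x * (M.change i j (χ j)).1 x)
    rw [hψ i j x, hχ i j x]
    have hc := Grassmann.even_comm (Grassmann.absPow (Grassmann.ber (M.jacobian i j x)) v).2
      ((M.change i j (ψ j)).1 x)
    rw [mul_assoc, ← mul_assoc ((M.change i j (ψ j)).1 x), ← hc, mul_assoc, ← mul_assoc]

/-- The algebra of densities `𝔙(M)`: finite formal sums of densities of arbitrary real weights. -/
def DensityAlgebra : Type _ := ⨁ w : ℝ, M.densities w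

/-- The ring structure of the direct sum. -/
noncomputable def densityRing : Ring M.DensityAlgebra :=
  { DirectSum.semiring (fun w : ℝ => M.densities w),
    (Module.addCommMonoidToAddCommGroup ℝ : AddCommGroup (⨁ w : ℝ, M.densities w)) with }

noncomputable instance : Ring M.DensityAlgebra := M.densityRing

/-- The algebra structure of the direct sum. -/
noncomputable def densityAlgebraStructure : Algebra ℝ M.DensityAlgebra :=
  DirectSum.instAlgebra (R := ℝ) (A := fun w : ℝ => M.densities w)

noncomputable instance : Algebra ℝ M.DensityAlgebra := M.densityAlgebraStructure

variable {M}

/-- A density of weight `w` as a homogeneous element. -/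
noncomputable def ofWeight (w : ℝ) : M.densities w →ₗ[ℝ] M.DensityAlgebra :=
  DirectSum.lof ℝ ℝ (fun w => M.densities w) w

/-- The component of weight `w`. -/
noncomputable def component (w : ℝ) : M.DensityAlgebra →ₗ[ℝ] M.densities w :=
  DirectSum.component ℝ ℝ (fun w => M.densities w) w

/-- The coordinate expression in the chart `i`: a formal sum of `f_w (Dx_i)^w` is sent to `∑ f_w`. It
is the generating function `∑ f_w t^w` of the element at `t = 1`. -/
noncomputable def coord (i : M.ι) (Ψ : M.DensityAlgebra) : domain M i → Grassmann m :=
  (DirectSum.coeLinearMap M.densities Ψ i).1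

/-- `Ψ` is homogeneous of parity `p`. (The generator `Dx` of the densities over a chart is even.) -/
def HasParity (p : ZMod 2) (Ψ : M.DensityAlgebra) : Prop :=
  ∀ (w : ℝ) (i : M.ι), superFunParity p ((component w Ψ).1 i)

/-- `Ψ` is supported in a compact subset of the domain of the chart `i`. -/
def CompactlySupportedIn (i : M.ι) (Ψ : M.DensityAlgebra) : Prop :=
  ∃ K : Set M.X, IsCompact K ∧ K ⊆ (M.chart i).source ∧
    ∀ (w : ℝ) (j : M.ι) (x : domain M j), (M.chart j).symm x.1 ∉ K → ((component w Ψ).1 j).1 x = 0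

/-- The canonical scalar product `⟨Ψ, Φ⟩ = ∫ Res (t⁻² Ψ Φ) Dx` of two elements of `𝔙(M)` one of which is
supported in the chart `i`: the Berezin integral of the component of weight `1` of the product. -/
noncomputable def scalarProduct (i : M.ι) (Ψ Φ : M.DensityAlgebra) : ℝ :=
  berezinIntegral ((component 1 (Ψ * Φ)).1 i).1

/-! ## Operators and brackets -/

variable (M) in
/-- Linear operators in the algebra of densities. -/
abbrev Operator : Type _ := Module.End ℝ M.DensityAlgebra

variable (M) in
/-- Bilinear operations in the algebra of densities. -/
abbrev BilinearOperation : Type _ :=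
  M.DensityAlgebra →ₗ[ℝ] M.DensityAlgebra →ₗ[ℝ] M.DensityAlgebra

/-- The supercommutator `[T, f] = T f - (-1)^{T̃ f̃} f T` of an operator of parity `ε` with the
multiplication by an element `f` of parity `p`. -/
noncomputable def superComm (ε p : ZMod 2) (T : Operator M)
    (f : M.DensityAlgebra) : Operator M :=
  T * LinearMap.mulLeft ℝ f - koszul ε p • (LinearMap.mulLeft ℝ f * T)

/-- `Δ` is a differential operator of parity `ε` and of order at most two in the algebra `𝔙(M)`:
all triple commutators `[[[Δ, f], g], h]` vanish. -/
def IsSecondOrder (ε : ZMod 2) (Δ : Operator M) : Prop :=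
  (∀ p f, HasParity p f → HasParity (ε + p) (Δ f)) ∧
  ∀ p q r f g h, HasParity p f → HasParity q g → HasParity r h →
    superComm (ε + p + q) r (superComm (ε + p) q (superComm ε p Δ f) g) h = 0

/-- A bracket of parity `ε` in `𝔙(M)`: a symmetric bi-derivation. -/
def IsBracket (ε : ZMod 2)
    (B : BilinearOperation M) : Prop :=
  (∀ p q f g, HasParity p f → HasParity q g → HasParity (ε + p + q) (B f g)) ∧
  (∀ p q f g, HasParity p f → HasParity q g → B f g = koszul p q • B g f) ∧
  ∀ p q f g h, HasParity p f → HasParity q g →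
    B f (g * h) = B f g * h + koszul (ε + p) q • (g * B f h)

/-- `Δ` generates `B`: `{f, g} = Δ(fg) - (Δf) g - (-1)^{ε f̃} f (Δg) + Δ(1) f g`. -/
def Generates (ε : ZMod 2) (Δ : Operator M)
    (B : BilinearOperation M) : Prop :=
  ∀ p f g, HasParity p f →
    B f g = Δ (f * g) - Δ f * g - koszul ε p • (f * Δ g) + Δ 1 * f * g

/-- `Δ` has weight `l`: it maps densities of weight `w` to densities of weight `w + l`. Moreover it is
an operator on generating functions: its coordinate expression depends continuously on `w`. That is, if
`ψ_w = f (Dx_i)^w` over the chart `i` with one and the same `f`, then `Δ ψ_w` depends continuously on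
`w` in the chart `i`. (This excludes operators such as `ψ ↦ h(w) ψ`, where `h : ℝ → ℝ` is a
discontinuous additive function.) -/
def OperatorHasWeight (l : ℝ) (Δ : Operator M) : Prop :=
  (∀ w (ψ : M.densities w), ∃ φ : M.densities (w + l), Δ (ofWeight w ψ) = ofWeight (w + l) φ) ∧
  ∀ (i : M.ι) (f : superFun m (domain M i)) (ψ : ∀ w, M.densities w), (∀ w, (ψ w).1 i = f) →
    ∀ x, Continuous fun w => coord i (Δ (ofWeight w (ψ w))) x

/-- `B` has weight `l`: it maps densities of weights `w`, `w'` to densities of weight `w + w' + l`, with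
coordinate expression depending continuously on the weights, as for operators. -/
def BracketHasWeight (l : ℝ)
    (B : BilinearOperation M) : Prop :=
  (∀ w w' (ψ : M.densities w) (χ : M.densities w'), ∃ φ : M.densities (w + w' + l),
    B (ofWeight w ψ) (ofWeight w' χ) = ofWeight (w + w' + l) φ) ∧
  ∀ (i : M.ι) (f : superFun m (domain M i)) (ψ : ∀ w, M.densities w), (∀ w, (ψ w).1 i = f) →
    ∀ Φ x, Continuous fun w => coord i (B (ofWeight w (ψ w)) Φ) x

/-- `Δ` is self-adjoint: `⟨ΔΨ, Φ⟩ = (-1)^{ε Ψ̃} ⟨Ψ, ΔΦ⟩` whenever `Ψ` is compactly supported in the domain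
of some chart. -/
def IsSelfAdjoint (ε : ZMod 2) (Δ : Operator M) : Prop :=
  ∀ (i : M.ι) (p : ZMod 2) (Ψ Φ : M.DensityAlgebra), HasParity p Ψ → CompactlySupportedIn i Ψ →
    scalarProduct i (Δ Ψ) Φ = koszul ε p * scalarProduct i Ψ (Δ Φ)

/-- `Δ` is a canonical generating operator for `B`: a second-order operator that generates `B`, is
normalized by `Δ 1 = 0`, and is self-adjoint. -/
def IsCanonicalFor (ε : ZMod 2) (Δ : Operator M)
    (B : BilinearOperation M) : Prop :=
  IsSecondOrder ε Δ ∧ Generates ε Δ B ∧ Δ 1 = 0 ∧ IsSelfAdjoint ε Δ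

/-! ## Coordinate formulas -/

/-- The components over a chart of a tensor with blocks `S^{ab}`, `t γ^a`, `t² θ`. -/
structure BracketData {n : ℕ} (m : ℕ) (V : Opens (Fin n → ℝ)) where
  S : CoordIndex n m → CoordIndex n m → superFun m V
  γ : CoordIndex n m → superFun m V
  θ : superFun m V

/-- The tensor is symmetric and has parity `ε`. -/
def BracketData.IsSymmetric {V : Opens (Fin n → ℝ)} (ε : ZMod 2) (D : BracketData m V) : Prop :=
  (∀ a b, superFunParity (ε + coordParity a + coordParity b) (D.S a b)) ∧
  (∀ a b, D.S a b = koszul (coordParity a) (coordParity b) • D.S b a) ∧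
  (∀ a, superFunParity (ε + coordParity a) (D.γ a)) ∧
  superFunParity ε D.θ

/-- The bracket `S^{ab} ∂_b f ∂_a g (-1)^{ã f̃} + w γ^a f ∂_a g (-1)^{ã f̃} + w' γ^a ∂_a f g + w w' θ f g`
of the densities `f (Dx)^w` and `g (Dx)^{w'}`, where `f` has parity `p`. -/
noncomputable def BracketData.bracket {V : Opens (Fin n → ℝ)} (D : BracketData m V) (p : ZMod 2)
    (w w' : ℝ) (f g : V → Grassmann m) (x : V) : Grassmann m :=
  (∑ a, ∑ b, koszul (coordParity a) p • ((D.S a b).1 x * pd b f x * pd a g x)) +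
  w • (∑ a, koszul (coordParity a) p • ((D.γ a).1 x * f x * pd a g x)) +
  w' • (∑ a, (D.γ a).1 x * pd a f x * g x) +
  (w * w') • (D.θ.1 x * f x * g x)

/-- The tensor `D` gives the bracket `B` in the chart `i`. -/
def BracketData.Represents {i : M.ι} (D : BracketData m (domain M i))
    (B : BilinearOperation M) : Prop :=
  ∀ (p : ZMod 2) (w w' : ℝ) (ψ : M.densities w) (χ : M.densities w'),
    superFunParity p (ψ.1 i) → ∀ x,
    coord i (B (ofWeight w ψ) (ofWeight w' χ)) x = D.bracket p w w' (ψ.1 i).1 (χ.1 i).1 x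

/-- The quadratic pencil
`Δ_w = ½ (S^{ab} ∂_b ∂_a + (∂_b S^{ba} (-1)^{b̃(ε+1)} + (2w - 1) γ^a) ∂_a
  + w ∂_a γ^a (-1)^{ã(ε+1)} + w (w - 1) θ)`. -/
noncomputable def BracketData.pencil {V : Opens (Fin n → ℝ)} (ε : ZMod 2) (D : BracketData m V)
    (w : ℝ) (f : V → Grassmann m) (x : V) : Grassmann m :=
  (1 / 2 : ℝ) • (
    (∑ a, ∑ b, (D.S a b).1 x * pd b (pd a f) x) +
    (∑ a, ((∑ b, koszul (coordParity b) (ε + 1) • pd b (D.S b a).1 x) +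
      (2 * w - 1) • (D.γ a).1 x) * pd a f x) +
    w • (∑ a, koszul (coordParity a) (ε + 1) • pd a (D.γ a).1 x) * f x +
    (w * (w - 1)) • (D.θ.1 x * f x))

end Supermanifold

/-!
# Second-order operators and brackets on the algebra of densities

*From operators to brackets.* For a second-order operator `Δ` the double commutator `[[Δ, f], g]`
commutes with all multiplications, hence is the multiplication by its value at `1`, which is
`{f, g}`. The symmetry and the Leibniz rule of `{f, g}` are the symmetry and the derivation property
of iterated commutators (`isBracket_generatedBracket`). The bracket is assembled from products and
from values of `Δ`, so that it inherits the weight of `Δ` (`bracketHasWeight_generatedBracket`).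

*Brackets in coordinates.* A bracket of weight `l` is local (`bracket_eq_zero_of_germ`), so in a
chart it is a twisted biderivation. By Hadamard's lemma a twisted derivation of superfunctions is
determined by its values on the coordinates (`twistedDerivation_eq_sum`). The only other argument is
the power `(Dx)^w`, on which the Leibniz rule makes the bracket additive in `w`; being continuous
in `w`, it is linear. Thus a bracket has coordinate data `(S, γ, θ)` (`exists_bracketData`), which it
determines (`BracketData.Represents.unique`).

*From brackets to operators.* In a chart, let `Δ` act on `f (Dx)^w` as half the difference of the
divergence of the flux `S ∂f + w γ f` and of `(1 - w - l)` times the drift `γ ∂f + w θ f`. The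
Leibniz rule for the divergence (`BracketData.IsSymmetric.op_mul`) writes `Δ(f) g` as a divergence
minus `½ {f, g}`, whenever the weights of `f` and `g` add up to `1 - l`. Integrating, one gets the
duality
  `⟨Δ Ψ, Φ⟩ = -½ ∫ {Ψ, Φ}`    (`isDual_canonicalOperator`),
and everything else rests on it, since the scalar product is nondegenerate
(`eq_zero_of_integralIn`). Self-adjointness is the symmetry of the right-hand side
(`IsDual.isSelfAdjoint`), and the generating identity is its Leibniz rule (`IsDual.generates`).
Conversely, if a self-adjoint operator with `Δ 1 = 0` generates the bracket, then
`∫ {Ψ, Φ} = ∫ Δ(Ψ Φ) - ⟨Δ Ψ, Φ⟩ ∓ ⟨Ψ, Δ Φ⟩ = -2 ⟨Δ Ψ, Φ⟩`, as `∫ Δ(Ψ Φ) = ± ⟨Ψ Φ, Δ 1⟩ = 0`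
(`IsCanonicalFor.integralIn_mul`), which makes the operator unique
(`IsCanonicalFor.eq_canonicalOperator`). For `l = 0`, expanding the divergence gives the canonical
pencil (`op_eq_pencil`).

*Independence of the chart.* The local operators have to agree on overlaps (`op_mem_densities`).
The divergence of the flux is that of a density of weight one with values in vector fields, and its
invariance is the Piola identity: the divergence of the inverse Jacobian matrix multiplied by the
Berezinian vanishes (`piola`). It follows from the formula for the logarithmic derivative of the
Berezinian (`IsSuperderivation.ber`), and from the cocycle property of its powers
(`berPow_mul_trans`). All integrals are taken within a single chart, so that no formula for the
change of variables in a Berezin integral is needed.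
-/

/-! ### Signs -/

theorem zmod_two_cases (p : ZMod 2) : p = 0 ∨ p = 1 := by revert p; decide

theorem koszul_comm (p q : ZMod 2) : koszul p q = koszul q p := by
  simp only [koszul, mul_comm]

theorem koszul_zero_left (q : ZMod 2) : koszul 0 q = 1 := by simp [koszul]

theorem koszul_zero_right (p : ZMod 2) : koszul p 0 = 1 := by simp [koszul]

theorem koszul_one_one : koszul 1 1 = -1 := by
  simp [koszul, ZMod.val_one]

theorem koszul_add_left (p q r : ZMod 2) : koszul (p + q) r = koszul p r * koszul q r := by
  have h : (1 + 1 : ZMod 2) = 0 := rfl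
  rcases zmod_two_cases p with rfl | rfl <;> rcases zmod_two_cases q with rfl | rfl <;>
    rcases zmod_two_cases r with rfl | rfl <;>
    simp [koszul_zero_left, koszul_zero_right, koszul_one_one, h]

theorem koszul_add_right (p q r : ZMod 2) : koszul p (q + r) = koszul p q * koszul p r := by
  rw [koszul_comm, koszul_add_left, koszul_comm q, koszul_comm r]

theorem koszul_mul_self (p q : ZMod 2) : koszul p q * koszul p q = 1 := by
  rcases zmod_two_cases p with rfl | rfl <;> rcases zmod_two_cases q with rfl | rfl <;>
    simp [koszul_zero_left, koszul_zero_right, koszul_one_one]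

theorem koszul_natCast (a b : ℕ) : koszul (a : ZMod 2) b = (-1) ^ (a * b) := by
  have key : ∀ a : ℕ, ((a : ZMod 2) = 0 ∧ Even a) ∨ ((a : ZMod 2) = 1 ∧ Odd a) := by
    intro a
    rcases Nat.even_or_odd a with h | h
    · exact Or.inl ⟨(ZMod.natCast_eq_zero_iff_even).2 h, h⟩
    · exact Or.inr ⟨(ZMod.natCast_eq_one_iff_odd).2 h, h⟩
  rcases key a with ⟨ha, ha'⟩ | ⟨ha, ha'⟩
  · rw [ha, koszul_zero_left, (ha'.mul_right b).neg_one_pow]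
  · rcases key b with ⟨hb, hb'⟩ | ⟨hb, hb'⟩
    · rw [hb, koszul_zero_right, (hb'.mul_left a).neg_one_pow]
    · rw [ha, hb, koszul_one_one, (ha'.mul hb').neg_one_pow]

/-! ### The Grassmann algebra -/

namespace Grassmann

variable {m : ℕ}

instance : FiniteDimensional ℝ (Grassmann m) :=
  inferInstanceAs (FiniteDimensional ℝ (Finset (Fin m) → ℝ))

instance : CompleteSpace (Grassmann m) :=
  inferInstanceAs (CompleteSpace (Finset (Fin m) → ℝ))

theorem sub_apply (f g : Grassmann m) (K : Finset (Fin m)) : (f - g) K = f K - g K := rfl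

theorem sum_apply {ι : Type*} (s : Finset ι) (f : ι → Grassmann m) (K : Finset (Fin m)) :
    (∑ i ∈ s, f i) K = ∑ i ∈ s, f i K :=
  Finset.sum_apply K s (fun i => (f i : Finset (Fin m) → ℝ))

/-- The coefficient of `ξ^I` as a linear map. -/
def coeff (I : Finset (Fin m)) : Grassmann m →ₗ[ℝ] ℝ where
  toFun f := f I
  map_add' _ _ := rfl
  map_smul' _ _ := rfl

theorem coeff_apply (I : Finset (Fin m)) (f : Grassmann m) : coeff I f = f I := rfl

/-- The multiplication as a continuous bilinear map. -/
noncomputable def mulCLM (m : ℕ) : Grassmann m →L[ℝ] Grassmann m →L[ℝ] Grassmann m :=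
  (LinearMap.mul ℝ (Grassmann m)).toContinuousBilinearMap

/-- The automorphism `f ↦ (-1)^{p f̃} f`: the identity for `p = 0`, the parity automorphism for
`p = 1`. -/
noncomputable def twist (p : ZMod 2) : Grassmann m →ₐ[ℝ] Grassmann m where
  toFun f I := koszul p I.card * f I
  map_one' := by
    ext I
    simp only [one_apply]
    split_ifs with h
    · subst h; simp [koszul_zero_right]
    · simp
  map_mul' f g := by
    ext K
    simp only [mul_apply, Finset.mul_sum]
    refine Finset.sum_congr rfl fun I hI => ?_
    rw [← Finset.card_sdiff_add_card_eq_card (Finset.mem_powerset.1 hI), Nat.cast_add,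
      koszul_add_right]
    ring
  map_zero' := by ext I; simp [zero_apply]
  map_add' f g := by
    ext I
    change koszul p I.card * (f I + g I) = koszul p I.card * f I + koszul p I.card * g I
    ring
  commutes' r := by
    ext I
    simp only [Algebra.algebraMap_eq_smul_one, smul_apply, one_apply]
    split_ifs with h
    · subst h; simp [koszul_zero_right]
    · simp

theorem twist_apply (p : ZMod 2) (f : Grassmann m) (I : Finset (Fin m)) :
    twist p f I = koszul p I.card * f I := rfl

theorem twist_of_parity {p q : ZMod 2} {f : Grassmann m} (hf : f ∈ parity m q) :
    twist p f = koszul p q • f := by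
  ext I
  rw [twist_apply, smul_apply]
  by_cases h : (I.card : ZMod 2) = q
  · rw [h]
  · rw [hf I h]; simp

theorem twist_zero (f : Grassmann m) : twist 0 f = f := by
  ext I; rw [twist_apply, koszul_zero_left, one_mul]

theorem twist_twist (p q : ZMod 2) (f : Grassmann m) : twist p (twist q f) = twist (p + q) f := by
  ext I; simp only [twist_apply, koszul_add_left]; ring

theorem mul_eq_twist_mul {p : ZMod 2} {f : Grassmann m} (hf : f ∈ parity m p) (g : Grassmann m) :
    f * g = twist p g * f := by
  ext K
  rw [mul_apply, mul_apply]
  refine Finset.sum_bij' (fun I _ => K \ I) (fun I _ => K \ I) (by simp) (by simp) ?_ ?_ ?_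
  · intro I hI
    simpa using Finset.inter_eq_right.2 (Finset.mem_powerset.1 hI)
  · intro I hI
    simpa using Finset.inter_eq_right.2 (Finset.mem_powerset.1 hI)
  · intro I hI
    have e : K \ (K \ I) = I := by
      simpa using Finset.inter_eq_right.2 (Finset.mem_powerset.1 hI)
    rw [e, twist_apply]
    by_cases h : (I.card : ZMod 2) = p
    · rw [shuffleSign_swap (Finset.disjoint_sdiff), ← koszul_natCast, h]
      ring
    · rw [hf I h]
      ring

/-- Supercommutativity. -/
theorem mul_eq_koszul_smul {p q : ZMod 2} {f g : Grassmann m} (hf : f ∈ parity m p)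
    (hg : g ∈ parity m q) : f * g = koszul p q • (g * f) := by
  rw [mul_eq_twist_mul hf, twist_of_parity hg, smul_mul_assoc]

theorem one_mem_parity : (1 : Grassmann m) ∈ parity m 0 := fun I hI => by
  rw [one_apply, if_neg]
  rintro rfl
  simp at hI

/-- The body as a homomorphism. -/
noncomputable def bodyHom (m : ℕ) : Grassmann m →ₐ[ℝ] ℝ where
  toFun f := body f
  map_one' := by simp [body, one_apply]
  map_mul' f g := by simp [body, mul_apply, shuffleSign]
  map_zero' := rfl
  map_add' _ _ := rfl
  commutes' r := by simp [body, Algebra.algebraMap_eq_smul_one, smul_apply, one_apply]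

theorem bodyHom_apply (f : Grassmann m) : bodyHom m f = body f := rfl

theorem body_of_odd {f : Grassmann m} (hf : f ∈ parity m 1) : body f = 0 :=
  hf ∅ (by simp)

/-- The elements of filtration degree `k`: the span of the monomials `ξ^I` with `k ≤ |I|`. -/
def filt (m k : ℕ) : Submodule ℝ (Grassmann m) where
  carrier := {f | ∀ I : Finset (Fin m), I.card < k → f I = 0}
  add_mem' hf hg I hI := by rw [add_apply, hf I hI, hg I hI, add_zero]
  zero_mem' _ _ := rfl
  smul_mem' r f hf I hI := by rw [smul_apply, hf I hI, mul_zero]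

theorem mul_mem_filt {j k : ℕ} {f g : Grassmann m} (hf : f ∈ filt m j) (hg : g ∈ filt m k) :
    f * g ∈ filt m (j + k) := by
  intro K hK
  rw [mul_apply]
  refine Finset.sum_eq_zero fun I hI => ?_
  have := Finset.card_sdiff_add_card_eq_card (Finset.mem_powerset.1 hI)
  by_cases h : I.card < j
  · rw [hf I h]; ring
  · rw [hg (K \ I) (by omega)]; ring

theorem mem_filt_one {f : Grassmann m} (hf : body f = 0) : f ∈ filt m 1 := by
  intro I hI
  have : I = ∅ := by simpa using hI
  rw [this]; exact hf

theorem eq_zero_of_mem_filt {k : ℕ} (hk : m < k) {f : Grassmann m} (hf : f ∈ filt m k) :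
    f = 0 := by
  ext I
  refine hf I (lt_of_le_of_lt ?_ hk)
  simpa using Finset.card_le_univ I

/-! ### Monomials -/

/-- The monomial `ξ^I`. -/
noncomputable def mono (I : Finset (Fin m)) : Grassmann m := fun K => if K = I then 1 else 0

theorem mono_apply (I K : Finset (Fin m)) : mono I K = if K = I then 1 else 0 := rfl

theorem sum_smul_mono (f : Grassmann m) : ∑ I, f I • mono I = f := by
  ext K
  rw [sum_apply, Finset.sum_eq_single K]
  · simp [smul_apply, mono_apply]
  · intro I _ hI
    simp [smul_apply, mono_apply, hI.symm]
  · simp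

theorem mono_mem_parity (I : Finset (Fin m)) : mono I ∈ parity m I.card := fun K hK => by
  rw [mono_apply, if_neg]; rintro rfl; exact hK rfl

theorem xi_mem_parity (μ : Fin m) : xi μ ∈ parity m 1 := fun K hK => by
  simp only [xi]
  rw [if_neg]; rintro rfl; simp at hK

theorem xi_mul_apply (μ : Fin m) (f : Grassmann m) (K : Finset (Fin m)) :
    (xi μ * f) K =
      if μ ∈ K then (-1) ^ (K.filter (· < μ)).card * f (K.erase μ) else 0 := by
  rw [mul_apply]
  split_ifs with h
  · rw [Finset.sum_eq_single {μ}]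
    · have e : K \ {μ} = K.erase μ := Finset.sdiff_singleton_eq_erase μ K
      have e2 : (K.erase μ).filter (· < μ) = K.filter (· < μ) := by
        ext j
        simp only [Finset.mem_filter, Finset.mem_erase]
        constructor
        · rintro ⟨⟨_, h1⟩, h2⟩; exact ⟨h1, h2⟩
        · rintro ⟨h1, h2⟩; exact ⟨⟨h2.ne, h1⟩, h2⟩
      rw [e, shuffleSign, Finset.sum_singleton, ← Finset.card_filter, e2]
      simp [xi]
    · intro I _ hI; simp [xi, hI]
    · intro h'; simp [h] at h'
  · refine Finset.sum_eq_zero fun I hI => ?_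
    have : I ≠ {μ} := by
      rintro rfl
      exact h (Finset.mem_powerset.1 hI (Finset.mem_singleton_self μ))
    simp [xi, this]

theorem xi_mul_mono {μ : Fin m} {I : Finset (Fin m)} (h : μ ∉ I) :
    xi μ * mono I = (-1 : ℝ) ^ ((insert μ I).filter (· < μ)).card • mono (insert μ I) := by
  ext K
  rw [xi_mul_apply, smul_apply, mono_apply, mono_apply]
  by_cases hK : K = insert μ I
  · subst hK; simp [h]
  · rw [if_neg hK]
    split_ifs with h1 h2
    · exact absurd (by rw [← h2, Finset.insert_erase h1]) hK
    · simp
    · simp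

/-- The generators `ξ_μ` generate the Grassmann algebra. -/
theorem induction_xi {P : Grassmann m → Prop} (h0 : P 1) (hadd : ∀ f g, P f → P g → P (f + g))
    (hsmul : ∀ (r : ℝ) f, P f → P (r • f)) (hxi : ∀ μ f, P f → P (xi μ * f)) (f : Grassmann m) :
    P f := by
  have hmono : ∀ I : Finset (Fin m), P (mono I) := by
    intro I
    induction I using Finset.induction_on with
    | empty => exact h0
    | insert a s ha ih =>
      have := hsmul ((-1 : ℝ) ^ ((insert a s).filter (· < a)).card) _ (hxi a _ ih)
      rwa [xi_mul_mono ha, smul_smul, ← mul_pow, neg_one_mul, neg_neg, one_pow, one_smul] at this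
  have hz : P 0 := by simpa using hsmul 0 _ h0
  rw [← sum_smul_mono f]
  generalize (Finset.univ : Finset (Finset (Fin m))) = s
  induction s using Finset.induction_on with
  | empty => simpa using hz
  | insert a s ha ih => rw [Finset.sum_insert ha]; exact hadd _ _ (hsmul _ _ (hmono a)) ih

/-! ### The odd derivatives -/

/-- The odd derivative as a linear map. -/
noncomputable def oddDerivLin (μ : Fin m) : Grassmann m →ₗ[ℝ] Grassmann m where
  toFun := oddDeriv μ
  map_add' f g := by
    ext I; simp only [oddDeriv, add_apply]; split_ifs <;> ring
  map_smul' r f := by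
    ext I; simp only [oddDeriv, smul_apply, RingHom.id_apply]; split_ifs <;> ring

theorem oddDerivLin_apply (μ : Fin m) (f : Grassmann m) : oddDerivLin μ f = oddDeriv μ f := rfl

theorem oddDeriv_add (μ : Fin m) (f g : Grassmann m) :
    oddDeriv μ (f + g) = oddDeriv μ f + oddDeriv μ g := (oddDerivLin μ).map_add f g

theorem oddDeriv_smul (μ : Fin m) (r : ℝ) (f : Grassmann m) :
    oddDeriv μ (r • f) = r • oddDeriv μ f := (oddDerivLin μ).map_smul r f

theorem oddDeriv_one (μ : Fin m) : oddDeriv μ (1 : Grassmann m) = 0 := by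
  ext I
  simp only [oddDeriv, one_apply, zero_apply]
  split_ifs with h1 h2
  · rfl
  · exact absurd h2 (Finset.insert_ne_empty μ I)
  · simp

theorem oddDeriv_mem_parity (μ : Fin m) {p : ZMod 2} {f : Grassmann m} (hf : f ∈ parity m p) :
    oddDeriv μ f ∈ parity m (1 + p) := by
  intro I hI
  simp only [oddDeriv]
  split_ifs with h
  · rfl
  · rw [hf, mul_zero]
    rw [Finset.card_insert_of_notMem h]
    intro h'
    apply hI
    have h2 : (1 + 1 : ZMod 2) = 0 := rfl
    rw [← h', Nat.cast_add, Nat.cast_one, add_left_comm, h2, add_zero]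

theorem oddDeriv_xi_mul (μ ν : Fin m) (f : Grassmann m) :
    oddDeriv μ (xi ν * f) = (if μ = ν then f else 0) - xi ν * oddDeriv μ f := by
  ext I
  rw [sub_apply, xi_mul_apply]
  simp only [oddDeriv, xi_mul_apply, Finset.mem_insert]
  by_cases h : μ = ν
  · subst h
    by_cases hI : μ ∈ I
    · simp only [hI, if_true, Finset.mem_erase, ne_eq, not_true_eq_false, false_and, if_false]
      have e2 : (I.erase μ).filter (· < μ) = I.filter (· < μ) := by
        ext j
        simp only [Finset.mem_filter, Finset.mem_erase]
        constructor
        · rintro ⟨⟨_, h1⟩, h2⟩; exact ⟨h1, h2⟩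
        · rintro ⟨h1, h2⟩; exact ⟨⟨h2.ne, h1⟩, h2⟩
      rw [e2, Finset.insert_erase hI, ← mul_assoc, ← mul_pow]
      simp
    · simp only [hI, if_false, true_or, if_true]
      rw [Finset.filter_insert, if_neg (lt_irrefl μ), Finset.erase_insert hI, ← mul_assoc,
        ← mul_pow]
      simp
  · have h' : ¬ ν = μ := fun e => h e.symm
    simp only [h, h', false_or, if_false, zero_apply]
    by_cases hI : μ ∈ I
    · simp [hI, h]
    · by_cases hn : ν ∈ I
      · have hc : (insert μ I).erase ν = insert μ (I.erase ν) := Finset.erase_insert_of_ne h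
        simp only [hI, hn, if_true, if_false, Finset.mem_erase, and_false, hc]
        have e1 : ((insert μ I).filter (· < ν)).card
            = (I.filter (· < ν)).card + if μ < ν then 1 else 0 := by
          rw [Finset.filter_insert]
          split_ifs with h3
          · rw [Finset.card_insert_of_notMem (by simp [hI])]
          · rfl
        have e2 : (I.filter (· < μ)).card
            = ((I.erase ν).filter (· < μ)).card + if ν < μ then 1 else 0 := by
          conv_lhs => rw [← Finset.insert_erase hn, Finset.filter_insert]
          split_ifs with h3
          · rw [Finset.card_insert_of_notMem (by simp)]
          · rfl
        rw [e1, e2]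
        rcases lt_or_gt_of_ne h with h3 | h3
        · rw [if_pos h3, if_neg h3.not_gt]; ring
        · rw [if_neg h3.not_gt, if_pos h3]; ring
      · simp [hI, hn]

theorem twist_one_xi (μ : Fin m) : twist 1 (xi μ) = -xi μ := by
  rw [twist_of_parity (xi_mem_parity μ), koszul_one_one, neg_one_smul]

/-- The super Leibniz rule. -/
theorem oddDeriv_mul (μ : Fin m) (f g : Grassmann m) :
    oddDeriv μ (f * g) = oddDeriv μ f * g + twist 1 f * oddDeriv μ g := by
  induction f using induction_xi with
  | h0 => rw [one_mul, oddDeriv_one, zero_mul, map_one, one_mul, zero_add]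
  | hadd f f' h h' => rw [add_mul, oddDeriv_add, h, h', oddDeriv_add, map_add]; noncomm_ring
  | hsmul r f h =>
    rw [smul_mul_assoc, oddDeriv_smul, h, oddDeriv_smul, map_smul, smul_add, smul_mul_assoc,
      smul_mul_assoc]
  | hxi ν f h =>
    rw [mul_assoc, oddDeriv_xi_mul, h, oddDeriv_xi_mul, map_mul, twist_one_xi]
    split_ifs <;> noncomm_ring

theorem oddDeriv_xi (μ ν : Fin m) : oddDeriv μ (xi ν) = if μ = ν then 1 else 0 := by
  have := oddDeriv_xi_mul μ ν 1
  rwa [mul_one, oddDeriv_one, mul_zero, sub_zero] at this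

theorem oddDeriv_anticomm (μ ν : Fin m) (f : Grassmann m) :
    oddDeriv μ (oddDeriv ν f) = -oddDeriv ν (oddDeriv μ f) := by
  induction f using induction_xi with
  | h0 =>
    rw [oddDeriv_one, oddDeriv_one, ← oddDerivLin_apply, ← oddDerivLin_apply, map_zero, map_zero,
      neg_zero]
  | hadd f f' h h' => simp only [oddDeriv_add, h, h']; abel
  | hsmul r f h => simp only [oddDeriv_smul, h, smul_neg]
  | hxi κ f h =>
    have hs : ∀ (ρ : Fin m) (a b : Grassmann m), oddDeriv ρ (a - b) = oddDeriv ρ a - oddDeriv ρ b :=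
      fun ρ a b => (oddDerivLin ρ).map_sub a b
    have hz : ∀ ρ : Fin m, oddDeriv ρ (0 : Grassmann m) = 0 := fun ρ => (oddDerivLin ρ).map_zero
    simp only [oddDeriv_xi_mul, hs, h]
    split_ifs <;> (try simp only [hz]) <;> noncomm_ring

/-- An element killed by all odd derivatives is a real number. -/
theorem eq_body_of_oddDeriv_eq_zero {f : Grassmann m} (hf : ∀ μ, oddDeriv μ f = 0) :
    f = body f • 1 := by
  ext I
  rw [smul_apply, one_apply]
  split_ifs with h
  · subst h; simp [body]
  · obtain ⟨μ, hμ⟩ := Finset.nonempty_iff_ne_empty.2 h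
    have := congrArg (fun g : Grassmann m => g (I.erase μ)) (hf μ)
    simp only [oddDeriv, Finset.mem_erase, ne_eq, not_true_eq_false, false_and, if_false,
      Finset.insert_erase hμ, zero_apply, mul_eq_zero, pow_eq_zero_iff', neg_eq_zero,
      one_ne_zero] at this
    simpa using this

theorem oddDeriv_univ (μ : Fin m) (f : Grassmann m) : oddDeriv μ f Finset.univ = 0 := by
  simp [oddDeriv]

end Grassmann

/-! ### Superfunctions on a superdomain -/

section Superfunctions

open Grassmann Filter Topology

variable {n m : ℕ} {V V' : Opens (Fin n → ℝ)}

theorem superFun_ext {f g : superFun m V} (h : ∀ x, f.1 x = g.1 x) : f = g :=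
  Subtype.ext (funext h)

theorem extendZero_eventuallyEq {f : V → Grassmann m} {F : (Fin n → ℝ) → Grassmann m} (x : V)
    (h : ∀ᶠ y in 𝓝 x.1, ∀ hy : y ∈ V, f ⟨y, hy⟩ = F y) : extendZero f =ᶠ[𝓝 x.1] F := by
  filter_upwards [h, V.isOpen.mem_nhds x.2] with y hy hV
  rw [← hy hV]
  exact extendZero_apply f ⟨y, hV⟩

theorem contDiffAt_extendZero (f : superFun m V) (x : V) :
    ContDiffAt ℝ ∞ (extendZero f.1) x.1 :=
  ContDiffOn.contDiffAt f.2 (V.isOpen.mem_nhds x.2)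

theorem differentiableAt_extendZero (f : superFun m V) (x : V) :
    DifferentiableAt ℝ (extendZero f.1) x.1 :=
  (contDiffAt_extendZero f x).differentiableAt (by simp)

/-- Smoothness is a local property. -/
theorem mem_superFun_of_local {f : V → Grassmann m}
    (h : ∀ x : V, ∃ F : (Fin n → ℝ) → Grassmann m, ContDiffAt ℝ ∞ F x.1 ∧
      ∀ᶠ y in 𝓝 x.1, ∀ hy : y ∈ V, f ⟨y, hy⟩ = F y) : f ∈ superFun m V := by
  intro x hx
  obtain ⟨F, hF, hfF⟩ := h ⟨x, hx⟩
  exact (hF.congr_of_eventuallyEq (extendZero_eventuallyEq ⟨x, hx⟩ hfF)).contDiffWithinAt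

/-- The restriction to `V` of a function that is smooth on `V`. -/
def ofContDiffOn (F : (Fin n → ℝ) → Grassmann m) (hF : ContDiffOn ℝ ∞ F V) : superFun m V :=
  ⟨fun x => F x.1, hF.congr fun x hx => extendZero_apply _ ⟨x, hx⟩⟩

/-- Evaluation at a point of the underlying domain. -/
def evalFun (x : V) : superFun m V →ₐ[ℝ] Grassmann m where
  toFun f := f.1 x
  map_one' := rfl
  map_mul' _ _ := rfl
  map_zero' := rfl
  map_add' _ _ := rfl
  commutes' _ := rfl

theorem evalFun_apply (x : V) (f : superFun m V) : evalFun x f = f.1 x := rfl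

theorem superFun_sum_apply {ι : Type*} (s : Finset ι) (f : ι → superFun m V) (x : V) :
    (∑ i ∈ s, f i).1 x = ∑ i ∈ s, (f i).1 x := map_sum (evalFun x) f s

/-- Applying a linear map to the values of a superfunction. -/
noncomputable def postcomp (L : Grassmann m →ₗ[ℝ] Grassmann m) (f : superFun m V) :
    superFun m V :=
  ⟨fun x => L (f.1 x), by
    refine (L.toContinuousLinearMap.contDiff.comp_contDiffOn f.2).congr fun x hx => ?_
    rw [extendZero_apply _ ⟨x, hx⟩, Function.comp, extendZero_apply f.1 ⟨x, hx⟩]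
    rfl⟩

theorem extendZero_postcomp (L : Grassmann m →ₗ[ℝ] Grassmann m) (f : superFun m V) (x : V) :
    extendZero (postcomp L f).1 =ᶠ[𝓝 x.1] L.toContinuousLinearMap ∘ extendZero f.1 :=
  extendZero_eventuallyEq x (Eventually.of_forall fun y hy => by
    rw [Function.comp, extendZero_apply f.1 ⟨y, hy⟩]; rfl)

/-- The automorphism `f ↦ (-1)^{p f̃} f` of the algebra of superfunctions. -/
noncomputable def twistFun (p : ZMod 2) : superFun m V →ₐ[ℝ] superFun m V where
  toFun f := postcomp (twist p).toLinearMap f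
  map_one' := superFun_ext fun _ => map_one (twist p)
  map_mul' f g := superFun_ext fun x => map_mul (twist p) (f.1 x) (g.1 x)
  map_zero' := superFun_ext fun _ => map_zero (twist p)
  map_add' f g := superFun_ext fun x => map_add (twist p) (f.1 x) (g.1 x)
  commutes' r := superFun_ext fun _ => (twist p).commutes r

theorem twistFun_of_parity {p q : ZMod 2} {f : superFun m V} (hf : superFunParity q f) :
    twistFun p f = koszul p q • f := superFun_ext fun x => twist_of_parity (hf x)

theorem two_le_infty : (2 : WithTop ℕ∞) ≤ ∞ :=
  WithTop.coe_le_coe.2 (le_top : (2 : ℕ∞) ≤ ⊤)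

/-! ### Partial derivatives -/

/-- The partial derivatives as linear maps on superfunctions. -/
noncomputable def pdFun (a : CoordIndex n m) : superFun m V →ₗ[ℝ] superFun m V where
  toFun f := ⟨pd a f.1, by
    cases a with
    | inl k =>
      have h : ContDiffOn ℝ ∞ (fderiv ℝ (extendZero f.1)) V :=
        ContDiffOn.fderiv_of_isOpen f.2 V.isOpen (by simp)
      refine (h.clm_apply (contDiffOn_const (c := (Pi.single k 1 : Fin n → ℝ)))).congr
        fun x hx => ?_
      exact extendZero_apply _ ⟨x, hx⟩
    | inr μ => exact (postcomp (oddDerivLin μ) f).2⟩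
  map_add' f g := by
    refine superFun_ext fun x => ?_
    cases a with
    | inl k =>
      have h : extendZero (f + g).1 =ᶠ[𝓝 x.1] extendZero f.1 + extendZero g.1 :=
        extendZero_eventuallyEq x (Eventually.of_forall fun y hy => by
          rw [Pi.add_apply, extendZero_apply f.1 ⟨y, hy⟩, extendZero_apply g.1 ⟨y, hy⟩]; rfl)
      change fderiv ℝ (extendZero (f + g).1) x.1 _ = fderiv ℝ (extendZero f.1) x.1 _ +
        fderiv ℝ (extendZero g.1) x.1 _
      rw [h.fderiv_eq, fderiv_add (differentiableAt_extendZero f x)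
        (differentiableAt_extendZero g x)]
      rfl
    | inr μ => exact oddDeriv_add μ _ _
  map_smul' r f := by
    refine superFun_ext fun x => ?_
    cases a with
    | inl k =>
      have h : extendZero (r • f).1 =ᶠ[𝓝 x.1] r • extendZero f.1 :=
        extendZero_eventuallyEq x (Eventually.of_forall fun y hy => by
          rw [Pi.smul_apply, extendZero_apply f.1 ⟨y, hy⟩]; rfl)
      change fderiv ℝ (extendZero (r • f).1) x.1 _ = r • fderiv ℝ (extendZero f.1) x.1 _
      rw [h.fderiv_eq, fderiv_const_smul (differentiableAt_extendZero f x)]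
      rfl
    | inr μ => exact oddDeriv_smul μ r _

theorem pdFun_coe (a : CoordIndex n m) (f : superFun m V) : (pdFun a f).1 = pd a f.1 := rfl

theorem pd_inl (k : Fin n) (f : V → Grassmann m) (x : V) :
    pd (Sum.inl k) f x = fderiv ℝ (extendZero f) x.1 (Pi.single k 1) := rfl

theorem pd_inr (μ : Fin m) (f : V → Grassmann m) (x : V) :
    pd (Sum.inr μ) f x = oddDeriv μ (f x) := rfl

/-- The partial derivatives depend only on the germ of the function. -/
theorem pd_congr (a : CoordIndex n m) {f : V → Grassmann m} {g : V' → Grassmann m}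
    {x : Fin n → ℝ} (hx : x ∈ V) (hx' : x ∈ V')
    (h : ∀ᶠ y in 𝓝 x, ∀ (hy : y ∈ V) (hy' : y ∈ V'), f ⟨y, hy⟩ = g ⟨y, hy'⟩) :
    pd a f ⟨x, hx⟩ = pd a g ⟨x, hx'⟩ := by
  cases a with
  | inl k =>
    have : extendZero f =ᶠ[𝓝 x] extendZero g := by
      refine extendZero_eventuallyEq ⟨x, hx⟩ ?_
      filter_upwards [h, V'.isOpen.mem_nhds hx'] with y hy hV' hV
      rw [hy hV hV']
      exact (extendZero_apply g ⟨y, hV'⟩).symm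
    rw [pd_inl, pd_inl, this.fderiv_eq]
  | inr μ => rw [pd_inr, pd_inr, h.self_of_nhds hx hx']

theorem pdFun_restrictFun (a : CoordIndex n m) (h : V' ≤ V) (f : superFun m V) :
    pdFun a (restrictFun h f) = restrictFun h (pdFun a f) :=
  superFun_ext fun x => pd_congr a x.2 (h x.2) (Eventually.of_forall fun _ _ _ => rfl)

theorem clm_pd_inl {E : Type*} [NormedAddCommGroup E] [NormedSpace ℝ E] (L : Grassmann m →L[ℝ] E)
    (k : Fin n) (f : superFun m V) (x : V) :
    L (pd (Sum.inl k) f.1 x) = fderiv ℝ (L ∘ extendZero f.1) x.1 (Pi.single k 1) := by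
  rw [(L.hasFDerivAt.comp x.1 (differentiableAt_extendZero f x).hasFDerivAt).fderiv]
  rfl

theorem pdFun_inl_postcomp (L : Grassmann m →ₗ[ℝ] Grassmann m) (k : Fin n) (f : superFun m V) :
    pdFun (Sum.inl k) (postcomp L f) = postcomp L (pdFun (Sum.inl k) f) :=
  superFun_ext fun x => by
    have := clm_pd_inl L.toContinuousLinearMap k f x
    rw [← (extendZero_postcomp L f x).fderiv_eq] at this
    exact this.symm

theorem pdFun_parity (a : CoordIndex n m) {p : ZMod 2} {f : superFun m V}
    (hf : superFunParity p f) : superFunParity (coordParity a + p) (pdFun a f) := by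
  intro x
  cases a with
  | inl k =>
    intro I hI
    have h := clm_pd_inl (coeff I).toContinuousLinearMap k f x
    have hz : (coeff I).toContinuousLinearMap ∘ extendZero f.1 =ᶠ[𝓝 x.1] fun _ => (0 : ℝ) := by
      filter_upwards [V.isOpen.mem_nhds x.2] with y hy
      rw [Function.comp, extendZero_apply f.1 ⟨y, hy⟩]
      exact hf ⟨y, hy⟩ I (by simpa [coordParity] using hI)
    rw [hz.fderiv_eq, fderiv_fun_const] at h
    exact h
  | inr μ => exact oddDeriv_mem_parity μ (hf x)

/-- The super Leibniz rule. -/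
theorem pdFun_mul (a : CoordIndex n m) (f g : superFun m V) :
    pdFun a (f * g) = pdFun a f * g + twistFun (coordParity a) f * pdFun a g := by
  refine superFun_ext fun x => ?_
  cases a with
  | inl k =>
    have h : extendZero (f * g).1 =ᶠ[𝓝 x.1]
        fun y => mulCLM m (extendZero f.1 y) (extendZero g.1 y) :=
      extendZero_eventuallyEq x (Eventually.of_forall fun y hy => by
        rw [extendZero_apply f.1 ⟨y, hy⟩, extendZero_apply g.1 ⟨y, hy⟩]; rfl)
    change fderiv ℝ (extendZero (f * g).1) x.1 _ = pd (Sum.inl k) f.1 x * g.1 x +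
      twist 0 (f.1 x) * pd (Sum.inl k) g.1 x
    rw [h.fderiv_eq, twist_zero, pd_inl, pd_inl]
    have := (mulCLM m).isBoundedBilinearMap.hasFDerivAt (extendZero f.1 x.1, extendZero g.1 x.1)
    have h2 := this.comp x.1 ((differentiableAt_extendZero f x).hasFDerivAt.prodMk
      (differentiableAt_extendZero g x).hasFDerivAt)
    have h3 : HasFDerivAt (fun y => mulCLM m (extendZero f.1 y) (extendZero g.1 y)) _ x.1 := h2
    rw [h3.fderiv]
    simp only [ContinuousLinearMap.coe_comp, Function.comp, ContinuousLinearMap.prod_apply,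
      extendZero_apply]
    exact add_comm _ _
  | inr μ => exact oddDeriv_mul μ _ _

theorem pdFun_one (a : CoordIndex n m) : pdFun a (1 : superFun m V) = 0 := by
  have := pdFun_mul a (1 : superFun m V) 1
  rw [map_one (twistFun _), one_mul, one_mul, mul_one] at this
  simpa using this

theorem pdFun_mul_of_parity (a : CoordIndex n m) {p : ZMod 2} {f : superFun m V}
    (hf : superFunParity p f) (g : superFun m V) :
    pdFun a (f * g) = pdFun a f * g + koszul (coordParity a) p • (f * pdFun a g) := by
  rw [pdFun_mul, twistFun_of_parity hf, smul_mul_assoc]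

/-- Partial derivatives supercommute. -/
theorem pdFun_comm (a b : CoordIndex n m) (f : superFun m V) :
    pdFun a (pdFun b f) = koszul (coordParity a) (coordParity b) • pdFun b (pdFun a f) := by
  cases a with
  | inl k =>
    cases b with
    | inl l =>
      simp only [coordParity, koszul_zero_left, one_smul]
      refine superFun_ext fun x => ?_
      have h : ∀ l : Fin n, extendZero (pdFun (Sum.inl l) f).1 =ᶠ[𝓝 x.1]
          fun y => fderiv ℝ (extendZero f.1) y (Pi.single l 1) := fun l =>
        extendZero_eventuallyEq x (Eventually.of_forall fun y hy => rfl)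
      have hd : DifferentiableAt ℝ (fderiv ℝ (extendZero f.1)) x.1 :=
        ((contDiffAt_extendZero f x).fderiv_right (m := 1)
          (by rw [one_add_one_eq_two]; exact two_le_infty)).differentiableAt
          (by simp)
      have hs : IsSymmSndFDerivAt ℝ (extendZero f.1) x.1 :=
        (contDiffAt_extendZero f x).isSymmSndFDerivAt (by simpa using two_le_infty)
      change fderiv ℝ (extendZero (pdFun (Sum.inl l) f).1) x.1 (Pi.single k 1) =
        fderiv ℝ (extendZero (pdFun (Sum.inl k) f).1) x.1 (Pi.single l 1)
      rw [(h l).fderiv_eq, (h k).fderiv_eq,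
        (hd.hasFDerivAt.clm_apply (hasFDerivAt_const _ _)).fderiv,
        (hd.hasFDerivAt.clm_apply (hasFDerivAt_const _ _)).fderiv]
      simpa using hs.eq (Pi.single k 1) (Pi.single l 1)
    | inr μ =>
      simp only [coordParity, koszul_zero_left, one_smul]
      exact pdFun_inl_postcomp (oddDerivLin μ) k f
  | inr ν =>
    cases b with
    | inl l =>
      simp only [coordParity, koszul_zero_right, one_smul]
      exact (pdFun_inl_postcomp (oddDerivLin ν) l f).symm
    | inr μ =>
      simp only [coordParity, koszul_one_one, neg_one_smul]
      exact superFun_ext fun x => oddDeriv_anticomm ν μ (f.1 x)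

theorem pdFun_coordFun (a b : CoordIndex n m) :
    pdFun a (coordFun V b) = if a = b then 1 else 0 := by
  refine superFun_ext fun x => ?_
  cases a with
  | inl k =>
    cases b with
    | inl l =>
      have h : extendZero (coordFun V (Sum.inl l : CoordIndex n m)).1 =ᶠ[𝓝 x.1]
          fun y => y l • (1 : Grassmann m) :=
        extendZero_eventuallyEq x (Eventually.of_forall fun y hy => rfl)
      have h2 : HasFDerivAt (fun y : Fin n → ℝ => y l • (1 : Grassmann m))
          ((ContinuousLinearMap.proj (R := ℝ) (φ := fun _ : Fin n => ℝ) l).smulRight 1) x.1 :=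
        ((ContinuousLinearMap.proj (R := ℝ) (φ := fun _ : Fin n => ℝ) l).smulRight
          (1 : Grassmann m)).hasFDerivAt
      rw [pdFun_coe, pd_inl, h.fderiv_eq, h2.fderiv]
      by_cases hkl : k = l
      · subst hkl; simp
      · have : l ≠ k := fun e => hkl e.symm
        simp [hkl, this]
    | inr μ =>
      have h : extendZero (coordFun V (Sum.inr μ : CoordIndex n m)).1 =ᶠ[𝓝 x.1]
          fun y => (xi μ : Grassmann m) :=
        extendZero_eventuallyEq x (Eventually.of_forall fun y hy => rfl)
      rw [pdFun_coe, pd_inl, h.fderiv_eq, fderiv_fun_const]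
      simp
  | inr ν =>
    cases b with
    | inl l =>
      rw [pdFun_coe, pd_inr]
      change oddDeriv ν (x.1 l • (1 : Grassmann m)) = _
      rw [oddDeriv_smul, oddDeriv_one]
      simp
    | inr μ =>
      rw [pdFun_coe, pd_inr]
      change oddDeriv ν (xi μ) = _
      rw [oddDeriv_xi]
      by_cases h : ν = μ
      · subst h; simp
      · simp [h]

theorem coordFun_parity (b : CoordIndex n m) : superFunParity (coordParity b) (coordFun V b) := by
  intro x
  cases b with
  | inl k => exact (parity m 0).smul_mem _ one_mem_parity
  | inr μ => exact xi_mem_parity μ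

/-! ### Parity of superfunctions -/

theorem one_parity : superFunParity 0 (1 : superFun m V) := fun _ => one_mem_parity

theorem add_parity {p : ZMod 2} {f g : superFun m V} (hf : superFunParity p f)
    (hg : superFunParity p g) : superFunParity p (f + g) :=
  fun x => (parity m p).add_mem (hf x) (hg x)

theorem smul_parity {p : ZMod 2} (r : ℝ) {f : superFun m V} (hf : superFunParity p f) :
    superFunParity p (r • f) := fun x => (parity m p).smul_mem r (hf x)

theorem zero_parity (p : ZMod 2) : superFunParity p (0 : superFun m V) :=
  fun _ => (parity m p).zero_mem

theorem mul_parity {p q : ZMod 2} {f g : superFun m V} (hf : superFunParity p f)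
    (hg : superFunParity q g) : superFunParity (p + q) (f * g) :=
  fun x => parity_mul (hf x) (hg x)

theorem sum_parity {ι : Type*} (s : Finset ι) {p : ZMod 2} {f : ι → superFun m V}
    (hf : ∀ i ∈ s, superFunParity p (f i)) : superFunParity p (∑ i ∈ s, f i) := fun x => by
  rw [superFun_sum_apply]
  exact (parity m p).sum_mem fun i hi => hf i hi x

/-- Supercommutativity of superfunctions. -/
theorem mul_comm_of_parity {p q : ZMod 2} {f g : superFun m V} (hf : superFunParity p f)
    (hg : superFunParity q g) : f * g = koszul p q • (g * f) :=
  superFun_ext fun x => mul_eq_koszul_smul (hf x) (hg x)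

/-- The component of parity `p` of a superfunction. -/
noncomputable def partFun (p : ZMod 2) (f : superFun m V) : superFun m V :=
  (1 / 2 : ℝ) • (f + koszul 1 p • twistFun 1 f)

theorem partFun_parity (p : ZMod 2) (f : superFun m V) : superFunParity p (partFun p f) := by
  intro x I hI
  change 1 / 2 * (f.1 x I + koszul 1 p * (koszul 1 I.card * f.1 x I)) = 0
  have : koszul 1 p * koszul 1 (I.card : ZMod 2) = -1 := by
    rcases zmod_two_cases p with rfl | rfl <;> rcases zmod_two_cases (I.card : ZMod 2) with h | h <;>
      simp_all [koszul_zero_right, koszul_one_one]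
  rw [← mul_assoc (koszul 1 p), this]
  ring

theorem partFun_add_partFun (f : superFun m V) : partFun 0 f + partFun 1 f = f := by
  rw [partFun, partFun, koszul_zero_right, koszul_one_one]
  module

/-- A superfunction with vanishing odd derivatives at a point is equal there to its body. -/
theorem eq_one_of_pdFun_inr {f : superFun m V} {x : V}
    (hf : ∀ μ, (pdFun (Sum.inr μ) f).1 x = 0) (hb : body (f.1 x) = 1) : f.1 x = 1 := by
  rw [eq_body_of_oddDeriv_eq_zero hf, hb, one_smul]

/-! ### The body -/

/-- A smooth real function as a superfunction. -/
noncomputable def ofReal (F : (Fin n → ℝ) → ℝ) (hF : ContDiffOn ℝ ∞ F V) : superFun m V :=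
  ofContDiffOn (fun x => F x • (1 : Grassmann m)) (hF.smul contDiffOn_const)

theorem ofReal_apply (F : (Fin n → ℝ) → ℝ) (hF : ContDiffOn ℝ ∞ F V) (x : V) :
    (ofReal F hF : superFun m V).1 x = F x.1 • (1 : Grassmann m) := rfl

theorem ofReal_parity (F : (Fin n → ℝ) → ℝ) (hF : ContDiffOn ℝ ∞ F V) :
    superFunParity 0 (ofReal F hF : superFun m V) :=
  fun _ => (parity m 0).smul_mem _ one_mem_parity

theorem contDiffOn_body (f : superFun m V) :
    ContDiffOn ℝ ∞ (fun x => body (extendZero f.1 x)) V :=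
  ((bodyHom m).toLinearMap.toContinuousLinearMap.contDiff.comp_contDiffOn f.2)

/-- The body of a superfunction, as a superfunction. -/
noncomputable def bodyFun (f : superFun m V) : superFun m V :=
  ofReal (fun x => body (extendZero f.1 x)) (contDiffOn_body f)

theorem bodyFun_apply (f : superFun m V) (x : V) :
    (bodyFun f).1 x = body (f.1 x) • (1 : Grassmann m) := by
  rw [bodyFun, ofReal_apply, extendZero_apply]

theorem pdFun_inr_ofReal (μ : Fin m) (F : (Fin n → ℝ) → ℝ) (hF : ContDiffOn ℝ ∞ F V) :
    pdFun (Sum.inr μ) (ofReal F hF : superFun m V) = 0 := superFun_ext fun x => by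
  rw [pdFun_coe, pd_inr, ofReal_apply, oddDeriv_smul, oddDeriv_one, smul_zero]; rfl

theorem pd_inl_ofReal (k : Fin n) (F : (Fin n → ℝ) → ℝ) (hF : ContDiffOn ℝ ∞ F V) (x : V) :
    (pdFun (Sum.inl k) (ofReal F hF : superFun m V)).1 x =
      fderiv ℝ F x.1 (Pi.single k 1) • (1 : Grassmann m) := by
  have h : extendZero (ofReal F hF : superFun m V).1 =ᶠ[𝓝 x.1] fun y => F y • (1 : Grassmann m) :=
    extendZero_eventuallyEq x (Eventually.of_forall fun y hy => rfl)
  have hd : DifferentiableAt ℝ F x.1 :=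
    (hF.contDiffAt (V.isOpen.mem_nhds x.2)).differentiableAt (by simp)
  rw [pdFun_coe, pd_inl, h.fderiv_eq, (hd.hasFDerivAt.smul_const (1 : Grassmann m)).fderiv]
  rfl

/-- A superfunction whose body does not vanish is invertible. -/
theorem exists_mul_eq_one {f : superFun m V} (hf : ∀ x, body (f.1 x) ≠ 0) :
    ∃ g : superFun m V, f * g = 1 ∧ g * f = 1 := by
  have hb : ContDiffOn ℝ ∞ (fun x => (body (extendZero f.1 x))⁻¹) V :=
    (contDiffOn_body f).inv fun x hx => by
      rw [extendZero_apply f.1 ⟨x, hx⟩]; exact hf ⟨x, hx⟩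
  have hu : IsUnit (bodyFun f) := by
    refine ⟨⟨bodyFun f, ofReal _ hb, ?_, ?_⟩, rfl⟩ <;>
    · refine superFun_ext fun x => ?_
      change (_ • (1 : Grassmann m)) * (_ • (1 : Grassmann m)) = 1
      rw [smul_mul_smul_comm, mul_one]
      simp [extendZero_apply, hf x]
  have hn : IsNilpotent (f - bodyFun f) := by
    refine ⟨m + 1, superFun_ext fun x => ?_⟩
    have hb' : body ((f - bodyFun f).1 x) = 0 := by
      change bodyHom m (f.1 x - (bodyFun f).1 x) = 0
      rw [map_sub, bodyFun_apply, map_smul, map_one, bodyHom_apply]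
      simp
    exact eq_zero_of_mem_filt (Nat.lt_succ_self m) fun I hI => pow_apply_of_card_lt hb' _ I hI
  have hc : Commute (f - bodyFun f) (bodyFun f) := by
    refine superFun_ext fun x => ?_
    have h0 : (bodyFun f).1 x ∈ parity m 0 := ofReal_parity _ _ x
    exact (even_comm h0 _).symm
  have := hn.isUnit_add_right_of_commute hu hc
  rw [sub_add_cancel] at this
  obtain ⟨u, hu'⟩ := this
  exact ⟨u⁻¹.1, by rw [← hu']; exact u.mul_inv, by rw [← hu']; exact u.inv_mul⟩

end Superfunctions

/-! ### Hadamard's lemma and twisted derivations -/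

section Hadamard

open Filter Topology

variable {E G : Type*} [NormedAddCommGroup E] [NormedSpace ℝ E]
  [NormedAddCommGroup G] [NormedSpace ℝ G]

/-- A parametric integral over `[0, 1]` of a smooth function is smooth. It is a convolution with
the indicator function of `(0, 1]`, after a cut-off in the variable of integration. -/
theorem contDiff_integral_param {g : E → ℝ → G} (hg : ContDiff ℝ ∞ (Function.uncurry g)) :
    ContDiff ℝ ∞ fun p => ∫ t in (0 : ℝ)..1, g p t := by
  let χ : ContDiffBump (0 : ℝ) := ⟨1, 2, one_pos, one_lt_two⟩
  let u : ℝ → ℝ := Set.indicator (Set.Ioc 0 1) 1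
  let g' : E → ℝ → G := fun p s => χ (-s) • g p (-s)
  have h := contDiffOn_convolution_right_with_param (𝕜 := ℝ) (μ := (volume : Measure ℝ)) (f := u)
    (n := ⊤) (ContinuousLinearMap.lsmul ℝ ℝ : ℝ →L[ℝ] G →L[ℝ] G) (g := g')
    (s := Set.univ) (k := Metric.closedBall (0 : ℝ) 2) isOpen_univ (isCompact_closedBall 0 2)
    (by
      intro p x _ hx
      have : χ (-x) = 0 := χ.zero_of_le_dist (by
        rw [dist_zero_right, norm_neg]
        simpa using le_of_lt (by simpa using hx : 2 < |x|))
      simp only [g', this, zero_smul])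
    ((integrableOn_const (μ := (volume : Measure ℝ)) (C := (1 : ℝ)) (s := Set.Ioc 0 1)
      (by simp)).integrable_indicator measurableSet_Ioc).locallyIntegrable
    (by
      refine ContDiff.contDiffOn ?_
      have h1 : ContDiff ℝ ∞ fun q : E × ℝ => χ (-q.2) := χ.contDiff.comp contDiff_snd.neg
      have h2 : ContDiff ℝ ∞ fun q : E × ℝ => g q.1 (-q.2) :=
        hg.comp (contDiff_fst.prodMk contDiff_snd.neg)
      exact h1.smul h2)
  rw [Set.univ_prod_univ, contDiffOn_univ] at h
  have h3 := h.comp (contDiff_prodMk_left (𝕜 := ℝ) (n := ∞) (E := E) (0 : ℝ))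
  convert h3 using 1
  funext p
  change _ = ∫ t, u t • (χ (-(0 - t)) • g p (-(0 - t)))
  rw [intervalIntegral.integral_of_le zero_le_one, ← integral_indicator measurableSet_Ioc]
  refine integral_congr_ae (Eventually.of_forall fun t => ?_)
  by_cases ht : t ∈ Set.Ioc (0 : ℝ) 1
  · have h1 : χ t = 1 := χ.one_of_mem_closedBall (by
      rw [Metric.mem_closedBall, dist_zero_right, Real.norm_eq_abs, abs_of_pos ht.1]; exact ht.2)
    simp [u, ht, h1]
  · simp [u, ht]

/-- Hadamard's lemma on `ℝⁿ`. -/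
theorem exists_hadamard_of_contDiff [CompleteSpace G] {n : ℕ} {F : (Fin n → ℝ) → G} (hF : ContDiff ℝ ∞ F)
    (y : Fin n → ℝ) : ∃ g : Fin n → (Fin n → ℝ) → G, (∀ k, ContDiff ℝ ∞ (g k)) ∧
      ∀ x, F x = F y + ∑ k, (x k - y k) • g k x := by
  have hd : ContDiff ℝ ∞ (fderiv ℝ F) := hF.fderiv_right (by simp)
  have hl : ContDiff ℝ ∞ fun q : (Fin n → ℝ) × ℝ => y + q.2 • (q.1 - y) :=
    contDiff_const.add (contDiff_snd.smul (contDiff_fst.sub contDiff_const))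
  have hg : ∀ k : Fin n, ContDiff ℝ ∞ (Function.uncurry fun (x : Fin n → ℝ) (t : ℝ) =>
      fderiv ℝ F (y + t • (x - y)) (Pi.single k 1)) := fun k =>
    (hd.comp hl).clm_apply contDiff_const
  refine ⟨fun k x => ∫ t in (0 : ℝ)..1, fderiv ℝ F (y + t • (x - y)) (Pi.single k 1),
    fun k => contDiff_integral_param (hg k), fun x => ?_⟩
  have hx : ∀ k, Continuous fun t : ℝ => fderiv ℝ F (y + t • (x - y)) (Pi.single k 1) := fun k =>
    (hg k).continuous.comp (Continuous.prodMk_right x)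
  have hdec : x - y = ∑ k, (x k - y k) • (Pi.single k 1 : Fin n → ℝ) := by
    ext j
    rw [Finset.sum_apply, Finset.sum_eq_single j]
    · simp
    · intro k _ hk; simp [hk.symm]
    · simp
  have hder : ∀ t : ℝ, HasDerivAt (fun t : ℝ => F (y + t • (x - y)))
      (∑ k, (x k - y k) • fderiv ℝ F (y + t • (x - y)) (Pi.single k 1)) t := by
    intro t
    have h1 : HasDerivAt (fun t : ℝ => y + t • (x - y)) (x - y) t := by
      simpa using ((hasDerivAt_id t).smul_const (x - y)).const_add y
    have h2 := ((hF.differentiable (by simp)) (y + t • (x - y))).hasFDerivAt.comp_hasDerivAt t h1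
    have h3 : fderiv ℝ F (y + t • (x - y)) (x - y)
        = ∑ k, (x k - y k) • fderiv ℝ F (y + t • (x - y)) (Pi.single k 1) := by
      conv_lhs => rw [hdec]
      rw [map_sum]
      refine Finset.sum_congr rfl fun k _ => ?_
      rw [map_smul, ← hdec]
    rw [← h3]
    exact h2
  have hi := intervalIntegral.integral_eq_sub_of_hasDerivAt (a := 0) (b := 1)
    (fun t _ => hder t) ((continuous_finsetSum _ fun k _ =>
      (hx k).const_smul (x k - y k)).intervalIntegrable 0 1)
  have hi' := intervalIntegral.integral_finsetSum (μ := volume) (a := 0) (b := 1)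
    (s := Finset.univ)
    (f := fun k t => (x k - y k) • fderiv ℝ F (y + t • (x - y)) (Pi.single k 1)) fun k _ =>
    ((hx k).const_smul (x k - y k)).intervalIntegrable 0 1
  rw [hi'] at hi
  simp only [intervalIntegral.integral_smul, one_smul, zero_smul, add_zero,
    add_sub_cancel] at hi
  rw [hi]
  abel

end Hadamard

section TwistedDerivations

open Grassmann Filter Topology

variable {n m : ℕ} {V : Opens (Fin n → ℝ)}

theorem exists_contDiffBump (x : V) :
    ∃ b : ContDiffBump x.1, Metric.closedBall x.1 b.rOut ⊆ V := by
  obtain ⟨r, hr, h⟩ := Metric.nhds_basis_closedBall.mem_iff.1 (V.isOpen.mem_nhds x.2)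
  exact ⟨⟨r / 2, r, half_pos hr, half_lt_self hr⟩, h⟩

/-- The product of a smooth function supported in `V` and a superfunction over `V` is smooth on
the whole space. -/
theorem contDiff_smul_extendZero {F : (Fin n → ℝ) → ℝ} (hF : ContDiff ℝ ∞ F)
    (hs : tsupport F ⊆ V) (f : superFun m V) : ContDiff ℝ ∞ fun x => F x • extendZero f.1 x := by
  rw [contDiff_iff_contDiffAt]
  intro x
  by_cases hx : x ∈ V
  · exact hF.contDiffAt.smul (contDiffAt_extendZero f ⟨x, hx⟩)
  · have h0 : F =ᶠ[𝓝 x] 0 := notMem_tsupport_iff_eventuallyEq.1 fun h => hx (hs h)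
    refine (contDiffAt_const (c := (0 : Grassmann m))).congr_of_eventuallyEq ?_
    filter_upwards [h0] with y hy
    rw [hy, Pi.zero_apply, zero_smul]

/-- A constant superfunction. -/
noncomputable def constFun (V : Opens (Fin n → ℝ)) : Grassmann m →ₐ[ℝ] superFun m V where
  toFun c := ofContDiffOn (fun _ => c) contDiffOn_const
  map_one' := rfl
  map_mul' _ _ := rfl
  map_zero' := rfl
  map_add' _ _ := rfl
  commutes' _ := rfl

/-- Hadamard's lemma on an arbitrary open set. -/
theorem exists_hadamard (f : superFun m V) (y : V) : ∃ g : Fin n → superFun m V,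
    f = constFun V (f.1 y) +
      ∑ k, (coordFun V (Sum.inl k) - algebraMap ℝ _ (y.1 k)) * g k := by
  obtain ⟨b, hb⟩ := exists_contDiffBump y
  have hbs : tsupport (b : (Fin n → ℝ) → ℝ) ⊆ V := b.tsupport_eq ▸ hb
  obtain ⟨G, hG, hGF⟩ := exists_hadamard_of_contDiff (contDiff_smul_extendZero b.contDiff hbs f) y.1
  -- away from `y` the function is divisible by the square of the distance to `y`
  let q : (Fin n → ℝ) → ℝ := fun x => ∑ k, (x k - y.1 k) ^ 2
  have hq : ∀ x, q x = 0 → x = y.1 := by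
    intro x hx
    ext k
    have := (Finset.sum_eq_zero_iff_of_nonneg fun k _ => sq_nonneg (x k - y.1 k)).1 hx k
      (Finset.mem_univ k)
    exact sub_eq_zero.1 (pow_eq_zero_iff (two_ne_zero) |>.1 this)
  have hqs : ContDiff ℝ ∞ q :=
    ContDiff.sum fun k _ => ((contDiff_apply ℝ ℝ k).sub contDiff_const).pow 2
  have hr : ContDiff ℝ ∞ fun x => (1 - b x) / q x := by
    rw [contDiff_iff_contDiffAt]
    intro x
    by_cases hx : q x = 0
    · rw [hq x hx]
      refine (contDiffAt_const (c := (0 : ℝ))).congr_of_eventuallyEq ?_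
      filter_upwards [b.eventuallyEq_one] with z hz
      rw [hz, Pi.one_apply, sub_self, zero_div]
    · exact (contDiffAt_const.sub b.contDiff.contDiffAt).div hqs.contDiffAt hx
  refine ⟨fun k => ofContDiffOn (fun x => G k x +
    ((1 - b x) / q x * (x k - y.1 k)) • extendZero f.1 x) ?_, ?_⟩
  · exact (hG k).contDiffOn.add (((hr.mul ((contDiff_apply ℝ ℝ k).sub
      contDiff_const)).contDiffOn).smul f.2)
  · refine superFun_ext fun x => ?_
    have e : ∀ (k : Fin n) (g : superFun m V),
        ((coordFun V (Sum.inl k) - algebraMap ℝ (superFun m V) (y.1 k)) * g).1 x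
          = (x.1 k - y.1 k) • g.1 x := by
      intro k g
      change (x.1 k • (1 : Grassmann m) - y.1 k • (1 : Grassmann m)) * g.1 x = _
      rw [← sub_smul, smul_mul_assoc, one_mul]
    change _ = f.1 y + (∑ k, _ : superFun m V).1 x
    rw [superFun_sum_apply, Finset.sum_congr rfl fun k _ => e k _]
    change _ = f.1 y + ∑ k, (x.1 k - y.1 k) • (G k x.1 +
      ((1 - b x.1) / q x.1 * (x.1 k - y.1 k)) • extendZero f.1 x.1)
    have h1 := hGF x.1
    rw [b.eventuallyEq_one.self_of_nhds, Pi.one_apply, one_smul, extendZero_apply,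
      extendZero_apply] at h1
    simp only [smul_add, Finset.sum_add_distrib, extendZero_apply]
    rw [← add_assoc, ← h1]
    have h2 : ∑ k, (x.1 k - y.1 k) • ((1 - b x.1) / q x.1 * (x.1 k - y.1 k)) • f.1 x
        = (1 - b x.1) • f.1 x := by
      simp only [smul_smul]
      rw [← Finset.sum_smul]
      congr 1
      have : ∀ k, (x.1 k - y.1 k) * ((1 - b x.1) / q x.1 * (x.1 k - y.1 k))
          = (1 - b x.1) / q x.1 * (x.1 k - y.1 k) ^ 2 := fun k => by ring
      rw [Finset.sum_congr rfl fun k _ => this k, ← Finset.mul_sum]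
      by_cases hx : q x.1 = 0
      · have : b x.1 = 1 := by rw [hq _ hx]; exact b.eventuallyEq_one.self_of_nhds
        rw [this]; simp
      · exact div_mul_cancel₀ _ hx
    rw [h2]
    module

/-- A twisted derivation of the superfunctions with values in the Grassmann algebra vanishes if it
vanishes on the coordinates. The homomorphism `e` over which it is a derivation maps the
functions vanishing at `y` to nilpotent elements, so that iterating Hadamard's lemma `m + 1` times
leaves no remainder. -/
theorem twistedDerivation_eq_zero {y : V} (e : superFun m V →ₐ[ℝ] Grassmann m)
    (he : ∀ k, body (e (coordFun V (Sum.inl k))) = y.1 k) (p : ZMod 2)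
    (D : superFun m V →ₗ[ℝ] Grassmann m)
    (hD : ∀ f g, D (f * g) = D f * e g + twist p (e f) * D g)
    (h0 : ∀ a, D (coordFun V a) = 0) (f : superFun m V) : D f = 0 := by
  have h1 : D 1 = 0 := by
    have := hD 1 1
    rw [map_one e, map_one (twist p), mul_one, mul_one, one_mul] at this
    simpa using this
  have hc : ∀ c : Grassmann m, D (constFun V c) = 0 := by
    intro c
    induction c using induction_xi with
    | h0 => rw [map_one]; exact h1
    | hadd c c' h h' => rw [map_add, map_add, h, h', add_zero]
    | hsmul r c h => rw [map_smul, map_smul, h, smul_zero]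
    | hxi μ c h =>
      have : D (constFun V (xi μ)) = 0 := h0 (Sum.inr μ)
      rw [map_mul, hD, h, this, zero_mul, mul_zero, add_zero]
  have key : ∀ j N : ℕ, m < N + j → ∀ P, D P = 0 → e P ∈ filt m N → ∀ f, D (P * f) = 0 := by
    intro j
    induction j with
    | zero =>
      intro N hN P hP heP f
      rw [hD, hP, eq_zero_of_mem_filt hN heP, map_zero, zero_mul, zero_mul, add_zero]
    | succ j ih =>
      intro N hN P hP heP f
      obtain ⟨g, hg⟩ := exists_hadamard f y
      rw [hg, mul_add, Finset.mul_sum, map_add, map_sum, hD, hP, hc, zero_mul, mul_zero, add_zero,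
        zero_add]
      refine Finset.sum_eq_zero fun k _ => ?_
      rw [← mul_assoc]
      refine ih (N + 1) (by omega) _ ?_ ?_ _
      · rw [hD, hP, map_sub D, h0, Algebra.algebraMap_eq_smul_one, map_smul, h1]
        simp
      · rw [map_mul]
        refine mul_mem_filt heP (mem_filt_one ?_)
        rw [← bodyHom_apply, map_sub, map_sub, bodyHom_apply, he, AlgHom.commutes,
          AlgHom.commutes]
        exact sub_self _
  have := key (m + 1) 0 (by omega) 1 h1 (fun I hI => absurd hI (by omega)) f
  rwa [one_mul] at this

/-- A twisted derivation is determined by its values on the coordinates. -/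
theorem twistedDerivation_eq_sum {y : V} (e : superFun m V →ₐ[ℝ] Grassmann m)
    (he : ∀ k, body (e (coordFun V (Sum.inl k))) = y.1 k)
    (het : ∀ q f, e (twistFun q f) = twist q (e f)) (p : ZMod 2)
    (D : superFun m V →ₗ[ℝ] Grassmann m)
    (hD : ∀ f g, D (f * g) = D f * e g + twist p (e f) * D g)
    (hp : ∀ a, D (coordFun V a) ∈ parity m (p + coordParity a)) (f : superFun m V) :
    D f = ∑ a, D (coordFun V a) * e (pdFun a f) := by
  let D' : superFun m V →ₗ[ℝ] Grassmann m :=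
    D - ∑ a, (LinearMap.mulLeft ℝ (D (coordFun V a))).comp (e.toLinearMap.comp (pdFun a))
  have hD'a : ∀ f, D' f = D f - ∑ a, D (coordFun V a) * e (pdFun a f) := fun f => by
    simp [D', LinearMap.sum_apply]
  have : D' f = 0 := by
    refine twistedDerivation_eq_zero (y := y) e he p D' ?_ ?_ f
    · intro f g
      rw [hD'a, hD'a, hD'a, hD, sub_mul, mul_sub, Finset.sum_mul, Finset.mul_sum]
      have : ∀ a, D (coordFun V a) * e (pdFun a (f * g)) =
          D (coordFun V a) * e (pdFun a f) * e g +
            twist p (e f) * (D (coordFun V a) * e (pdFun a g)) := by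
        intro a
        rw [pdFun_mul, map_add, map_mul, map_mul, het, mul_add, ← mul_assoc, ← mul_assoc,
          mul_eq_twist_mul (hp a) (twist _ _), twist_twist, mul_assoc (twist _ _)]
        have h2 : p + coordParity a + coordParity a = p := by
          rcases zmod_two_cases (coordParity a) with h | h <;> rw [h]
          · simp
          · exact (add_assoc p 1 1).trans (add_zero p)
        rw [h2]
      rw [Finset.sum_congr rfl fun a _ => this a, Finset.sum_add_distrib]
      abel
    · intro b
      rw [hD'a, Finset.sum_eq_single b]
      · rw [pdFun_coordFun, if_pos rfl, map_one, mul_one, sub_self]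
      · intro a _ hab
        rw [pdFun_coordFun, if_neg hab, map_zero, mul_zero]
      · simp
  rwa [hD'a, sub_eq_zero] at this

/-! ### The Berezin integral -/

/-- The support is contained in a compact subset of the domain. -/
def HasCompactSupp (f : superFun m V) : Prop :=
  ∃ K : Set (Fin n → ℝ), IsCompact K ∧ K ⊆ V ∧ ∀ x : V, x.1 ∉ K → f.1 x = 0

theorem HasCompactSupp.mul_left {f : superFun m V} (hf : HasCompactSupp f) (g : superFun m V) :
    HasCompactSupp (g * f) := by
  obtain ⟨K, h1, h2, h3⟩ := hf
  refine ⟨K, h1, h2, fun x hx => ?_⟩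
  change g.1 x * f.1 x = 0
  rw [h3 x hx, mul_zero]

theorem HasCompactSupp.mul_right {f : superFun m V} (hf : HasCompactSupp f) (g : superFun m V) :
    HasCompactSupp (f * g) := by
  obtain ⟨K, h1, h2, h3⟩ := hf
  refine ⟨K, h1, h2, fun x hx => ?_⟩
  change f.1 x * g.1 x = 0
  rw [h3 x hx, zero_mul]

theorem HasCompactSupp.pdFun {f : superFun m V} (hf : HasCompactSupp f) (a : CoordIndex n m) :
    HasCompactSupp (pdFun a f) := by
  obtain ⟨K, h1, h2, h3⟩ := hf
  refine ⟨K, h1, h2, fun x hx => ?_⟩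
  have : pd a f.1 ⟨x.1, x.2⟩ = pd a (0 : superFun m V).1 ⟨x.1, x.2⟩ := by
    refine pd_congr a x.2 x.2 ?_
    filter_upwards [h1.isClosed.isOpen_compl.mem_nhds hx] with z hz hz1 _
    exact h3 ⟨z, hz1⟩ hz
  change pd a f.1 x = 0
  rw [this]
  exact congrArg (fun g : superFun m V => g.1 x) (map_zero (_root_.pdFun a))

theorem extendZero_eq_zero {f : V → Grassmann m} {x : Fin n → ℝ} (hx : x ∉ V) :
    extendZero f x = 0 :=
  Function.extend_apply' _ _ _ fun ⟨y, hy⟩ => hx (hy ▸ y.2)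

theorem HasCompactSupp.contDiff {f : superFun m V} (hf : HasCompactSupp f) :
    ContDiff ℝ ∞ (extendZero f.1) := by
  obtain ⟨K, h1, h2, h3⟩ := hf
  rw [contDiff_iff_contDiffAt]
  intro x
  by_cases hx : x ∈ V
  · exact contDiffAt_extendZero f ⟨x, hx⟩
  · refine (contDiffAt_const (c := (0 : Grassmann m))).congr_of_eventuallyEq ?_
    filter_upwards [h1.isClosed.isOpen_compl.mem_nhds fun h => hx (h2 h)] with z hz
    by_cases hzV : z ∈ V
    · rw [extendZero_apply f.1 ⟨z, hzV⟩]; exact h3 ⟨z, hzV⟩ hz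
    · exact extendZero_eq_zero hzV

theorem HasCompactSupp.hasCompactSupport {f : superFun m V} (hf : HasCompactSupp f) :
    HasCompactSupport (extendZero f.1) := by
  obtain ⟨K, h1, h2, h3⟩ := hf
  refine HasCompactSupport.intro h1 fun x hx => ?_
  by_cases hxV : x ∈ V
  · rw [extendZero_apply f.1 ⟨x, hxV⟩]; exact h3 ⟨x, hxV⟩ hx
  · exact extendZero_eq_zero hxV

/-- The Berezin integral of a compactly supported derivative vanishes. -/
theorem berezinIntegral_pdFun {f : superFun m V} (hf : HasCompactSupp f) (a : CoordIndex n m) :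
    berezinIntegral (pdFun a f).1 = 0 := by
  cases a with
  | inr μ =>
    rw [berezinIntegral, setIntegral_eq_zero_of_forall_eq_zero]
    intro x hx
    rw [extendZero_apply _ ⟨x, hx⟩]
    exact oddDeriv_univ μ _
  | inl k =>
    let L : Grassmann m →L[ℝ] ℝ := (coeff Finset.univ).toContinuousLinearMap
    let F : (Fin n → ℝ) → ℝ := fun x => L (extendZero f.1 x)
    have hF : ContDiff ℝ ∞ F := L.contDiff.comp hf.contDiff
    have hFs : HasCompactSupport F := hf.hasCompactSupport.comp_left (g := L) (map_zero L)
    have hint : berezinIntegral (pdFun (Sum.inl k) f).1 =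
        ∫ x in (V : Set (Fin n → ℝ)), fderiv ℝ F x (Pi.single k 1) := by
      refine setIntegral_congr_fun V.isOpen.measurableSet fun x hx => ?_
      rw [extendZero_apply _ ⟨x, hx⟩]
      exact clm_pd_inl L k f ⟨x, hx⟩
    rw [hint, setIntegral_eq_integral_of_forall_compl_eq_zero]
    · have hd : Continuous fun x => fderiv ℝ F x (Pi.single k 1) :=
        (hF.continuous_fderiv (by simp)).clm_apply continuous_const
      have h1 := integral_mul_fderiv_eq_neg_fderiv_mul_of_integrable (𝕜 := ℝ) (μ := volume)
        (f := fun _ : Fin n → ℝ => (1 : ℝ)) (g := F) (v := Pi.single k 1) (by simp)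
        (by
          simp only [one_mul]
          exact hd.integrable_of_hasCompactSupport (hFs.fderiv_apply ℝ _))
        (by
          simp only [one_mul]
          exact hF.continuous.integrable_of_hasCompactSupport hFs)
        (fun _ _ => differentiableAt_const _)
        (fun x _ => hF.differentiable (by simp) x)
      simpa using h1
    · intro x hx
      have : F =ᶠ[𝓝 x] fun _ => 0 := by
        obtain ⟨K, h1, h2, h3⟩ := hf
        filter_upwards [h1.isClosed.isOpen_compl.mem_nhds fun h => hx (h2 h)] with z hz
        by_cases hzV : z ∈ V
        · simp only [F]; rw [extendZero_apply f.1 ⟨z, hzV⟩, h3 ⟨z, hzV⟩ hz, map_zero]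
        · simp only [F]; rw [extendZero_eq_zero hzV, map_zero]
      rw [this.fderiv_eq, fderiv_fun_const]
      simp

theorem hasCompactSupp_ofReal {F : (Fin n → ℝ) → ℝ} (hF : ContDiff ℝ ∞ F)
    (hc : HasCompactSupport F) (hs : tsupport F ⊆ V) :
    HasCompactSupp (ofReal F hF.contDiffOn : superFun m V) :=
  ⟨tsupport F, hc, hs, fun x hx => by
    rw [ofReal_apply, image_eq_zero_of_notMem_tsupport hx, zero_smul]⟩

/-- The pairing given by the Berezin integral is nondegenerate. -/
theorem eq_zero_of_berezinIntegral {f : superFun m V}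
    (hf : ∀ (q : ZMod 2) (g : superFun m V), superFunParity q g → HasCompactSupp g →
      berezinIntegral (f * g).1 = 0) : f = 0 := by
  have key : ∀ I : Finset (Fin m), Set.EqOn (fun x => coeff I (extendZero f.1 x)) 0 V := by
    intro I
    have hcont : ContinuousOn (fun x => coeff I (extendZero f.1 x)) V :=
      (coeff I).toContinuousLinearMap.continuous.comp_continuousOn f.2.continuousOn
    refine Measure.eqOn_open_of_ae_eq (μ := volume) ?_ V.isOpen hcont continuousOn_const
    rw [Filter.EventuallyEq, ae_restrict_iff' V.isOpen.measurableSet]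
    refine V.isOpen.ae_eq_zero_of_integral_contDiff_smul_eq_zero
      (hcont.locallyIntegrableOn V.isOpen.measurableSet) fun F hF hc hs => ?_
    have h1 := hf _ (ofReal F hF.contDiffOn * constFun V (mono Iᶜ))
      (mul_parity (ofReal_parity F hF.contDiffOn) fun _ => mono_mem_parity Iᶜ)
      ((hasCompactSupp_ofReal hF hc hs).mul_right _)
    rw [berezinIntegral] at h1
    rw [← setIntegral_eq_integral_of_forall_compl_eq_zero (s := (V : Set (Fin n → ℝ)))
      (fun x hx => by rw [image_eq_zero_of_notMem_tsupport fun h => hx (hs h), zero_smul])]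
    have h2 : ∀ x ∈ (V : Set (Fin n → ℝ)),
        extendZero (f * (ofReal F hF.contDiffOn * constFun V (mono Iᶜ))).1 x Finset.univ =
          shuffleSign I Iᶜ * (F x • coeff I (extendZero f.1 x)) := by
      intro x hx
      rw [extendZero_apply _ ⟨x, hx⟩, extendZero_apply f.1 ⟨x, hx⟩]
      change (f.1 ⟨x, hx⟩ * ((F x • (1 : Grassmann m)) * mono Iᶜ)) Finset.univ = _
      rw [smul_mul_assoc, one_mul, mul_smul_comm, Grassmann.smul_apply, mul_apply,
        Finset.sum_eq_single I]
      · rw [← Finset.compl_eq_univ_sdiff, mono_apply, if_pos rfl, coeff_apply, smul_eq_mul]; ring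
      · intro J _ hJ
        rw [← Finset.compl_eq_univ_sdiff, mono_apply, if_neg fun h => hJ (compl_injective h),
          mul_zero]
      · simp
    rw [setIntegral_congr_fun V.isOpen.measurableSet h2, integral_const_mul] at h1
    refine (mul_eq_zero.1 h1).resolve_left ?_
    rw [shuffleSign]
    exact pow_ne_zero _ (by norm_num)
  refine superFun_ext fun x => Grassmann.ext fun I => ?_
  have : coeff I (extendZero f.1 x.1) = 0 := key I x.2
  rw [extendZero_apply] at this
  exact this

end TwistedDerivations

/-! ### The logarithmic derivative of the Berezinian -/

section JacobiFormula

variable {k A E ι : Type*} [CommRing k] [CommRing A] [Algebra k A] [AddCommGroup E] [Module A E]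
  [Module k E] [Fintype ι] [DecidableEq ι]

/-- Jacobi's formula for a derivation with values in a module. -/
theorem Derivation.det_eq_sum (δ : Derivation k A E) (S : Matrix ι ι A) :
    δ S.det = ∑ i, ∑ j, S.adjugate j i • δ (S i j) := by
  have h1 : ∀ σ : Equiv.Perm ι, δ (∏ i, S (σ i) i) =
      ∑ i, (∏ j ∈ Finset.univ.erase i, S (σ j) j) • δ (S (σ i) i) := by
    intro σ
    generalize (Finset.univ : Finset ι) = s
    induction s using Finset.induction_on with
    | empty => simp
    | insert a s ha ih =>
      rw [Finset.prod_insert ha, δ.leibniz, ih, Finset.sum_insert ha, Finset.erase_insert ha,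
        Finset.smul_sum, add_comm]
      congr 1
      refine Finset.sum_congr rfl fun i hi => ?_
      have hne : a ≠ i := fun h => ha (h ▸ hi)
      rw [smul_smul, Finset.erase_insert_of_ne hne, Finset.prod_insert (by simp [ha])]
  have h2 : ∀ i j, S.adjugate j i =
      ∑ σ : Equiv.Perm ι, if σ j = i then (Equiv.Perm.sign σ : ℤ) •
        ∏ l ∈ Finset.univ.erase j, S (σ l) l else 0 := by
    intro i j
    rw [Matrix.adjugate_apply, Matrix.det_apply]
    refine Finset.sum_congr rfl fun σ _ => ?_
    rw [Units.smul_def, ← Finset.mul_prod_erase _ _ (Finset.mem_univ j)]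
    split_ifs with h
    · congr 1
      rw [h, Matrix.updateRow_self, Pi.single_eq_same, one_mul]
      refine Finset.prod_congr rfl fun l hl => ?_
      rw [Matrix.updateRow_ne]
      rw [← h]
      exact fun h' => (Finset.ne_of_mem_erase hl) (σ.injective h')
    · have hmem : σ.symm i ∈ Finset.univ.erase j := by
        rw [Finset.mem_erase]
        exact ⟨fun h' => h (by rw [← h', Equiv.apply_symm_apply]), Finset.mem_univ _⟩
      have hz : (S.updateRow i (Pi.single j 1)) (σ (σ.symm i)) (σ.symm i) = 0 := by
        rw [Equiv.apply_symm_apply, Matrix.updateRow_self,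
          Pi.single_eq_of_ne (Finset.ne_of_mem_erase hmem)]
      have := Finset.prod_eq_zero (f := fun l => (S.updateRow i (Pi.single j 1)) (σ l) l) hmem hz
      rw [this, mul_zero, smul_zero]
  rw [Matrix.det_apply, map_sum]
  have h3 : ∀ σ : Equiv.Perm ι, δ (Equiv.Perm.sign σ • ∏ i, S (σ i) i) =
      ∑ i, ∑ j, (if σ j = i then (Equiv.Perm.sign σ : ℤ) •
        ∏ l ∈ Finset.univ.erase j, S (σ l) l else 0) • δ (S i j) := by
    intro σ
    rw [Units.smul_def, map_zsmul, h1, Finset.sum_comm, Finset.smul_sum]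
    refine Finset.sum_congr rfl fun j _ => ?_
    rw [Finset.sum_eq_single (σ j)]
    · rw [if_pos rfl, smul_assoc]
    · intro i _ hi
      rw [if_neg hi.symm, zero_smul]
    · simp
  rw [Finset.sum_congr rfl fun σ _ => h3 σ, Finset.sum_comm]
  refine Finset.sum_congr rfl fun i _ => ?_
  rw [Finset.sum_comm]
  refine Finset.sum_congr rfl fun j _ => ?_
  rw [h2, Finset.sum_smul]

/-- The logarithmic derivative of a determinant. -/
theorem Derivation.det_eq_smul (δ : Derivation k A E) {S : Matrix ι ι A} (hS : IsUnit S.det) :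
    δ S.det = S.det • ∑ i, ∑ j, S⁻¹ j i • δ (S i j) := by
  rw [δ.det_eq_sum, Finset.smul_sum]
  refine Finset.sum_congr rfl fun i _ => ?_
  rw [Finset.smul_sum]
  refine Finset.sum_congr rfl fun j _ => ?_
  rw [smul_smul, Matrix.inv_def, Matrix.smul_apply, smul_eq_mul, ← mul_assoc,
    Ring.mul_inverse_cancel _ hS, one_mul]

end JacobiFormula

section SuperMatrix

variable {R : Type*} [Ring R] [Algebra ℝ R]

/-- `P p` are the elements of parity `p` of a supercommutative algebra. -/
structure IsSupercommutative (P : ZMod 2 → Submodule ℝ R) : Prop where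
  one_mem : 1 ∈ P 0
  mul_mem : ∀ {p q a b}, a ∈ P p → b ∈ P q → a * b ∈ P (p + q)
  comm : ∀ {p q a b}, a ∈ P p → b ∈ P q → a * b = koszul p q • (b * a)

/-- `D` is a derivation of parity `d`. -/
structure IsSuperderivation (P : ZMod 2 → Submodule ℝ R) (d : ZMod 2) (D : R →ₗ[ℝ] R) : Prop where
  mem : ∀ {p a}, a ∈ P p → D a ∈ P (d + p)
  leibniz : ∀ {p a}, a ∈ P p → ∀ b, D (a * b) = D a * b + koszul d p • (a * D b)

variable {P : ZMod 2 → Submodule ℝ R} {d : ZMod 2} {D : R →ₗ[ℝ] R}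

theorem IsSuperderivation.map_one (hP : IsSupercommutative P) (hD : IsSuperderivation P d D) :
    D 1 = 0 := by
  have := hD.leibniz hP.one_mem 1
  rw [koszul_zero_right, one_smul, mul_one, mul_one, one_mul] at this
  simpa using this

theorem IsSupercommutative.one_apply_mem (hP : IsSupercommutative P) {ι : Type*} [DecidableEq ι]
    (i j : ι) : (1 : Matrix ι ι R) i j ∈ P 0 := by
  rw [Matrix.one_apply]
  split_ifs
  · exact hP.one_mem
  · exact (P 0).zero_mem

section LogDeriv

variable {ι : Type*} [Fintype ι] [DecidableEq ι] (s : ι → ZMod 2)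

/-- An even supermatrix, its rows and columns having the parities `s`. -/
def IsEvenMatrix (P : ZMod 2 → Submodule ℝ R) (M : Matrix ι ι R) : Prop :=
  ∀ i j, M i j ∈ P (s i + s j)

/-- The supertrace of `(D M) M⁻¹`, where `N` stands for `M⁻¹`. -/
noncomputable def superLogDeriv (D : R →ₗ[ℝ] R) (M N : Matrix ι ι R) : R :=
  ∑ i, koszul (s i) 1 • ∑ j, D (M i j) * N j i

theorem koszul_logDeriv_sign (d i k l : ZMod 2) :
    koszul i 1 * (koszul d (i + k) * koszul (i + k + (d + (k + l))) (l + i)) =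
      koszul l 1 * koszul d (k + l) := by
  have h : (1 + 1 : ZMod 2) = 0 := rfl
  rcases zmod_two_cases d with rfl | rfl <;> rcases zmod_two_cases i with rfl | rfl <;>
    rcases zmod_two_cases k with rfl | rfl <;> rcases zmod_two_cases l with rfl | rfl <;>
    simp [koszul_zero_left, koszul_zero_right, koszul_one_one, h]

/-- The logarithmic derivative is additive, by the cyclic invariance of the supertrace. -/
theorem superLogDeriv_mul (hP : IsSupercommutative P) (hD : IsSuperderivation P d D)
    {M₁ N₁ M₂ N₂ : Matrix ι ι R} (hM₁ : IsEvenMatrix s P M₁) (hN₁ : IsEvenMatrix s P N₁)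
    (hM₂ : IsEvenMatrix s P M₂) (hN₂ : IsEvenMatrix s P N₂) (h₁ : N₁ * M₁ = 1) (h₂ : M₂ * N₂ = 1) :
    superLogDeriv s D (M₁ * M₂) (N₂ * N₁) =
      superLogDeriv s D M₁ N₁ + superLogDeriv s D M₂ N₂ := by
  let X : Matrix ι ι R := Matrix.of fun k j => D (M₂ k j)
  let Y : Matrix ι ι R := Matrix.of fun k j => D (M₁ k j)
  have hX : ∀ k l, (X * N₂) k l ∈ P (d + (s k + s l)) := by
    intro k l
    rw [Matrix.mul_apply]
    refine Submodule.sum_mem _ fun j _ => ?_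
    have := hP.mul_mem (hD.mem (hM₂ k j)) (hN₂ j l)
    have e : d + (s k + s j) + (s j + s l) = d + (s k + s l) := by
      have : s j + s j = 0 := CharTwo.add_self_eq_zero _
      linear_combination this
    rwa [e] at this
  have hterm : ∀ i, ∑ j, D ((M₁ * M₂) i j) * (N₂ * N₁) j i =
      (Y * N₁) i i + ∑ k, ∑ l, koszul d (s i + s k) • (M₁ i k * ((X * N₂) k l * N₁ l i)) := by
    intro i
    have e1 : ∀ j, D ((M₁ * M₂) i j) =
        (Y * M₂) i j + ∑ k, koszul d (s i + s k) • (M₁ i k * X k j) := by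
      intro j
      rw [Matrix.mul_apply, map_sum, Matrix.mul_apply, ← Finset.sum_add_distrib]
      exact Finset.sum_congr rfl fun k _ => hD.leibniz (hM₁ i k) _
    have e2 : ∀ j, D ((M₁ * M₂) i j) * (N₂ * N₁) j i = (Y * M₂) i j * (N₂ * N₁) j i +
        ∑ k, koszul d (s i + s k) • (M₁ i k * (X k j * (N₂ * N₁) j i)) := by
      intro j
      rw [e1, add_mul, Finset.sum_mul]
      congr 1
      exact Finset.sum_congr rfl fun k _ => by rw [smul_mul_assoc, mul_assoc]
    rw [Finset.sum_congr rfl fun j _ => e2 j, Finset.sum_add_distrib, ← Matrix.mul_apply,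
      Matrix.mul_assoc, ← Matrix.mul_assoc M₂, h₂, Matrix.one_mul, Finset.sum_comm]
    congr 1
    refine Finset.sum_congr rfl fun k _ => ?_
    rw [← Finset.smul_sum, ← Finset.mul_sum, ← Matrix.mul_apply, ← Matrix.mul_assoc,
      Matrix.mul_apply, Finset.mul_sum, Finset.smul_sum]
  have hmove : ∀ i k l, koszul (s i) 1 • koszul d (s i + s k) •
      (M₁ i k * ((X * N₂) k l * N₁ l i)) =
        (koszul (s l) 1 * koszul d (s k + s l)) • (N₁ l i * M₁ i k * (X * N₂) k l) := by
    intro i k l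
    rw [← mul_assoc, hP.comm (hP.mul_mem (hM₁ i k) (hX k l)) (hN₁ l i), smul_smul, smul_smul,
      mul_assoc (N₁ l i), ← koszul_logDeriv_sign d (s i) (s k) (s l), mul_assoc]
  rw [superLogDeriv, Finset.sum_congr rfl fun i _ => by rw [hterm i, smul_add],
    Finset.sum_add_distrib]
  congr 1
  simp only [Finset.smul_sum]
  rw [Finset.sum_congr rfl fun i _ => Finset.sum_congr rfl fun k _ =>
    Finset.sum_congr rfl fun l _ => hmove i k l, Finset.sum_comm,
    Finset.sum_congr rfl fun k _ => Finset.sum_comm]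
  have hsum : ∀ k l, ∑ i, (koszul (s l) 1 * koszul d (s k + s l)) •
      (N₁ l i * M₁ i k * (X * N₂) k l) =
        if l = k then koszul (s l) 1 • (X * N₂) k l else 0 := by
    intro k l
    rw [← Finset.smul_sum, ← Finset.sum_mul, ← Matrix.mul_apply, h₁, Matrix.one_apply]
    split_ifs with h
    · have : s k + s l = 0 := by rw [h]; exact CharTwo.add_self_eq_zero _
      rw [this, koszul_zero_right, mul_one, one_mul]
    · rw [zero_mul, smul_zero]
  rw [Finset.sum_congr rfl fun k _ => Finset.sum_congr rfl fun l _ => hsum k l]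
  simp only [Finset.sum_ite_eq', Finset.mem_univ, if_true]
  rw [superLogDeriv]
  exact Finset.sum_congr rfl fun k _ => by rw [Matrix.mul_apply]; rfl

end LogDeriv

/-- The even part of a supercommutative algebra. -/
def evenPart (hP : IsSupercommutative P) : Subalgebra ℝ R where
  carrier := P 0
  mul_mem' ha hb := by simpa using hP.mul_mem ha hb
  add_mem' ha hb := (P 0).add_mem ha hb
  algebraMap_mem' r := by
    rw [Algebra.algebraMap_eq_smul_one]
    exact (P 0).smul_mem r hP.one_mem

instance evenPartCommRing (hP : IsSupercommutative P) : CommRing (evenPart hP) :=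
  { (inferInstance : Ring (evenPart hP)) with
    mul_comm := fun a b => Subtype.ext <| by
      have := hP.comm a.2 b.2
      rwa [koszul_zero_left, one_smul] at this }

/-- A superderivation is a derivation on the even part. -/
noncomputable def IsSuperderivation.toDerivation (hP : IsSupercommutative P)
    (hD : IsSuperderivation P d D) : Derivation ℝ (evenPart hP) R :=
  Derivation.mk' (D.comp (evenPart hP).val.toLinearMap) fun a b => by
    change D (a.1 * b.1) = a.1 * D b.1 + b.1 * D a.1
    rw [hD.leibniz a.2, koszul_zero_right, one_smul, add_comm, hP.comm b.2 (hD.mem a.2),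
      koszul_zero_left, one_smul]

section Blocks

variable {n m : Type*} [Fintype n] [DecidableEq n] [Fintype m] [DecidableEq m]

/-- The parities of the rows and columns of a supermatrix with blocks. -/
def blockParity : n ⊕ m → ZMod 2 := Sum.elim (fun _ => 0) (fun _ => 1)

omit [Fintype n] [DecidableEq n] [Fintype m] [DecidableEq m] in
theorem isEvenMatrix_fromBlocks {A : Matrix n n R} {B : Matrix n m R} {C : Matrix m n R}
    {E : Matrix m m R} (hA : ∀ i j, A i j ∈ P 0) (hB : ∀ i j, B i j ∈ P 1)
    (hC : ∀ i j, C i j ∈ P 1) (hE : ∀ i j, E i j ∈ P 0) :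
    IsEvenMatrix blockParity P (Matrix.fromBlocks A B C E) := by
  have h2 : (1 + 1 : ZMod 2) = 0 := rfl
  rintro (i | i) (j | j)
  · simpa [blockParity] using hA i j
  · simpa [blockParity] using hB i j
  · simpa [blockParity] using hC i j
  · simpa [blockParity, h2] using hE i j

/-- The logarithmic derivative of the Berezinian is the supertrace of the logarithmic derivative
of the matrix. The matrix is the product of a block upper unitriangular, a block diagonal, and a
block lower unitriangular matrix, of which only the second contributes. -/
theorem IsSuperderivation.ber (hP : IsSupercommutative P) (hD : IsSuperderivation P d D)
    {M N : Matrix (n ⊕ m) (n ⊕ m) R} (hM : IsEvenMatrix blockParity P M) (hMN : N * M = 1)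
    {E : Matrix m m (evenPart hP)} (hE : E.map Subtype.val = M.toBlocks₂₂) (hEu : IsUnit E.det)
    {S : Matrix n n (evenPart hP)}
    (hS : S.map Subtype.val = M.toBlocks₁₁ - M.toBlocks₁₂ * E⁻¹.map Subtype.val * M.toBlocks₂₁)
    (hSu : IsUnit S.det) :
    D (S.det * Ring.inverse E.det).1 =
      (S.det * Ring.inverse E.det).1 * superLogDeriv blockParity D M N := by
  have hEE : E.map Subtype.val * E⁻¹.map Subtype.val = (1 : Matrix m m R) := by
    have := Matrix.map_mul (L := E) (M := E⁻¹) (f := (evenPart hP).val)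
    rw [Matrix.mul_nonsing_inv _ hEu, Matrix.map_one _ (map_zero _) (_root_.map_one _)] at this
    exact this.symm
  have hEE' : E⁻¹.map Subtype.val * E.map Subtype.val = (1 : Matrix m m R) := by
    have := Matrix.map_mul (L := E⁻¹) (M := E) (f := (evenPart hP).val)
    rw [Matrix.nonsing_inv_mul _ hEu, Matrix.map_one _ (map_zero _) (_root_.map_one _)] at this
    exact this.symm
  have hSS : S.map Subtype.val * S⁻¹.map Subtype.val = (1 : Matrix n n R) := by
    have := Matrix.map_mul (L := S) (M := S⁻¹) (f := (evenPart hP).val)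
    rw [Matrix.mul_nonsing_inv _ hSu, Matrix.map_one _ (map_zero _) (_root_.map_one _)] at this
    exact this.symm
  have hSS' : S⁻¹.map Subtype.val * S.map Subtype.val = (1 : Matrix n n R) := by
    have := Matrix.map_mul (L := S⁻¹) (M := S) (f := (evenPart hP).val)
    rw [Matrix.nonsing_inv_mul _ hSu, Matrix.map_one _ (map_zero _) (_root_.map_one _)] at this
    exact this.symm
  let X : Matrix n m R := M.toBlocks₁₂ * E⁻¹.map Subtype.val
  let Y : Matrix m n R := E⁻¹.map Subtype.val * M.toBlocks₂₁
  let U : Matrix (n ⊕ m) (n ⊕ m) R := Matrix.fromBlocks 1 X 0 1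
  let U' : Matrix (n ⊕ m) (n ⊕ m) R := Matrix.fromBlocks 1 (-X) 0 1
  let G : Matrix (n ⊕ m) (n ⊕ m) R :=
    Matrix.fromBlocks (S.map Subtype.val) 0 0 (E.map Subtype.val)
  let G' : Matrix (n ⊕ m) (n ⊕ m) R :=
    Matrix.fromBlocks (S⁻¹.map Subtype.val) 0 0 (E⁻¹.map Subtype.val)
  let T : Matrix (n ⊕ m) (n ⊕ m) R := Matrix.fromBlocks 1 0 Y 1
  let T' : Matrix (n ⊕ m) (n ⊕ m) R := Matrix.fromBlocks 1 0 (-Y) 1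
  have hone : ∀ i j, (1 : Matrix n n R) i j ∈ P 0 := hP.one_apply_mem
  have hone' : ∀ i j, (1 : Matrix m m R) i j ∈ P 0 := hP.one_apply_mem
  have hX : ∀ i j, X i j ∈ P 1 := by
    intro i j
    refine Submodule.sum_mem _ fun k _ => ?_
    have := hP.mul_mem (hM (Sum.inl i) (Sum.inr k)) (E⁻¹ k j).2
    simpa [blockParity, Matrix.toBlocks₁₂] using this
  have hY : ∀ i j, Y i j ∈ P 1 := by
    intro i j
    refine Submodule.sum_mem _ fun k _ => ?_
    have := hP.mul_mem (E⁻¹ i k).2 (hM (Sum.inr k) (Sum.inl j))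
    simpa [blockParity, Matrix.toBlocks₂₁] using this
  have hU : IsEvenMatrix blockParity P U :=
    isEvenMatrix_fromBlocks hone hX (fun _ _ => (P 1).zero_mem) hone'
  have hU' : IsEvenMatrix blockParity P U' :=
    isEvenMatrix_fromBlocks hone (fun i j => (P 1).neg_mem (hX i j)) (fun _ _ => (P 1).zero_mem)
      hone'
  have hG : IsEvenMatrix blockParity P G :=
    isEvenMatrix_fromBlocks (fun i j => (S i j).2) (fun _ _ => (P 1).zero_mem)
      (fun _ _ => (P 1).zero_mem) (fun i j => (E i j).2)
  have hG' : IsEvenMatrix blockParity P G' :=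
    isEvenMatrix_fromBlocks (fun i j => (S⁻¹ i j).2) (fun _ _ => (P 1).zero_mem)
      (fun _ _ => (P 1).zero_mem) (fun i j => (E⁻¹ i j).2)
  have hT : IsEvenMatrix blockParity P T :=
    isEvenMatrix_fromBlocks hone (fun _ _ => (P 1).zero_mem) hY hone'
  have hT' : IsEvenMatrix blockParity P T' :=
    isEvenMatrix_fromBlocks hone (fun _ _ => (P 1).zero_mem) (fun i j => (P 1).neg_mem (hY i j))
      hone'
  have hUU : U * U' = 1 := by simp [U, U', Matrix.fromBlocks_multiply]
  have hUU' : U' * U = 1 := by simp [U, U', Matrix.fromBlocks_multiply]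
  have hGG : G * G' = 1 := by simp [G, G', Matrix.fromBlocks_multiply, hSS, hEE]
  have hGG' : G' * G = 1 := by simp [G, G', Matrix.fromBlocks_multiply, hSS', hEE']
  have hTT : T * T' = 1 := by simp [T, T', Matrix.fromBlocks_multiply]
  have hfac : M = U * (G * T) := by
    conv_lhs => rw [← Matrix.fromBlocks_toBlocks M]
    simp only [U, G, T, Matrix.fromBlocks_multiply, Matrix.mul_one, Matrix.mul_zero,
      Matrix.zero_mul, Matrix.one_mul, add_zero, zero_add, X, Y]
    have e1 : E.map Subtype.val * (E⁻¹.map Subtype.val * M.toBlocks₂₁) = M.toBlocks₂₁ := by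
      rw [← Matrix.mul_assoc, hEE, Matrix.one_mul]
    rw [e1, Matrix.mul_assoc M.toBlocks₁₂ _ (E.map _), hEE', Matrix.mul_one, hS, hE]
    simp
  have hN : N = (T' * G') * U' := by
    have h1 : M * ((T' * G') * U') = 1 := by
      rw [hfac, Matrix.mul_assoc, Matrix.mul_assoc, Matrix.mul_assoc, ← Matrix.mul_assoc T, hTT,
        Matrix.one_mul, ← Matrix.mul_assoc G, hGG, Matrix.one_mul, hUU]
    rw [← Matrix.mul_one N, ← h1, ← Matrix.mul_assoc, hMN, Matrix.one_mul]
  have hGT : IsEvenMatrix blockParity P (G * T) := by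
    intro i j
    rw [Matrix.mul_apply]
    refine Submodule.sum_mem _ fun k _ => ?_
    have := hP.mul_mem (hG i k) (hT k j)
    have e : blockParity i + blockParity k + (blockParity k + blockParity j) =
        (blockParity i + blockParity j : ZMod 2) := by
      have : (blockParity k + blockParity k : ZMod 2) = 0 := CharTwo.add_self_eq_zero _
      linear_combination this
    rwa [e] at this
  have hTG : IsEvenMatrix blockParity P (T' * G') := by
    intro i j
    rw [Matrix.mul_apply]
    refine Submodule.sum_mem _ fun k _ => ?_
    have := hP.mul_mem (hT' i k) (hG' k j)
    have e : blockParity i + blockParity k + (blockParity k + blockParity j) =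
        (blockParity i + blockParity j : ZMod 2) := by
      have : (blockParity k + blockParity k : ZMod 2) = 0 := CharTwo.add_self_eq_zero _
      linear_combination this
    rwa [e] at this
  have hD1 := hD.map_one hP
  have hLU : superLogDeriv blockParity D U U' = 0 := by
    simp [superLogDeriv, U, U', Matrix.one_apply, apply_ite D, hD1]
  have hLT : superLogDeriv blockParity D T T' = 0 := by
    simp [superLogDeriv, T, T', Matrix.one_apply, apply_ite D, hD1]
  let δ := hD.toDerivation hP
  have hLG : superLogDeriv blockParity D G G' =
      ∑ i, ∑ j, S⁻¹ j i • δ (S i j) - ∑ i, ∑ j, E⁻¹ j i • δ (E i j) := by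
    have hc : ∀ a b : evenPart hP, D a.1 * b.1 = b • δ a := by
      intro a b
      rw [hP.comm (hD.mem a.2) b.2, koszul_zero_right, one_smul]
      rfl
    simp [superLogDeriv, G, G', blockParity, koszul_zero_left, koszul_one_one, hc,
      sub_eq_add_neg]
  have hL : superLogDeriv blockParity D M N = superLogDeriv blockParity D G G' := by
    rw [hfac, hN, superLogDeriv_mul blockParity hP hD hU hU' hGT hTG hUU',
      superLogDeriv_mul blockParity hP hD hG hG' hT hT' hGG' hTT, hLU, hLT, zero_add, add_zero]
    rw [Matrix.mul_assoc, ← Matrix.mul_assoc T, hTT, Matrix.one_mul, hGG]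
  rw [hL, hLG]
  set u := ∑ i, ∑ j, S⁻¹ j i • δ (S i j)
  set v := ∑ i, ∑ j, E⁻¹ j i • δ (E i j)
  set t := Ring.inverse E.det with ht
  have hδS : δ S.det = S.det • u := δ.det_eq_smul hSu
  have hδE : δ E.det = E.det • v := δ.det_eq_smul hEu
  have htE : t * E.det = 1 := Ring.inverse_mul_cancel _ hEu
  have hδt : δ t = -(t • v) := by
    have h1 : δ (t * E.det) = 0 := by rw [htE]; exact δ.map_one_eq_zero
    rw [δ.leibniz, hδE, smul_smul, htE, one_smul] at h1
    have h2 : t • (v + E.det • δ t) = 0 := by rw [h1, smul_zero]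
    rw [smul_add, smul_smul, htE, one_smul] at h2
    exact eq_neg_of_add_eq_zero_right h2
  change δ (S.det * t) = (S.det * t) • (u - v)
  rw [δ.leibniz, hδS, hδt, smul_smul, smul_neg, smul_smul, smul_sub, mul_comm t]
  abel

end Blocks

end SuperMatrix

/-! ### Berezinians and powers of superfunctions -/

section BerezinianFunctions

open Grassmann Filter Topology

variable {n m : ℕ} {V : Opens (Fin n → ℝ)}

/-- The superfunctions of parity `p`. -/
def parityFun (m : ℕ) (V : Opens (Fin n → ℝ)) (p : ZMod 2) : Submodule ℝ (superFun m V) where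
  carrier := {f | superFunParity p f}
  add_mem' := add_parity
  zero_mem' := zero_parity p
  smul_mem' r _ := smul_parity r

theorem isSupercommutative_parityFun : IsSupercommutative (parityFun m V) :=
  ⟨one_parity, mul_parity, mul_comm_of_parity⟩

theorem isSuperderivation_pdFun (a : CoordIndex n m) :
    IsSuperderivation (parityFun m V) (coordParity a) (pdFun a) :=
  ⟨pdFun_parity a, pdFun_mul_of_parity a⟩

theorem coordParity_eq_blockParity : (coordParity : CoordIndex n m → ZMod 2) = blockParity := by
  funext a
  cases a <;> rfl

theorem even_mul_comm {f : superFun m V} (hf : superFunParity 0 f) (g : superFun m V) :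
    f * g = g * f := superFun_ext fun x => even_comm (hf x) (g.1 x)

/-- The commutative algebra of superfunctions of parity `0`. -/
def EvenFun (m : ℕ) (V : Opens (Fin n → ℝ)) : Type :=
  evenPart (isSupercommutative_parityFun (m := m) (V := V))

noncomputable instance : CommRing (EvenFun m V) :=
  evenPartCommRing (isSupercommutative_parityFun (m := m) (V := V))

noncomputable instance : Algebra ℝ (EvenFun m V) :=
  (evenPart (isSupercommutative_parityFun (m := m) (V := V))).algebra

noncomputable instance : Module (EvenFun m V) (superFun m V) :=
  inferInstanceAs
    (Module (evenPart (isSupercommutative_parityFun (m := m) (V := V))) (superFun m V))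

instance : IsScalarTower ℝ (EvenFun m V) (superFun m V) :=
  ⟨fun r f g => smul_mul_assoc r f.1 g⟩

variable (V) in
/-- The partial derivatives as derivations on even superfunctions. -/
noncomputable def pdEven (a : CoordIndex n m) : Derivation ℝ (EvenFun m V) (superFun m V) :=
  (isSuperderivation_pdFun a).toDerivation isSupercommutative_parityFun

/-- Evaluation of even superfunctions at a point. -/
noncomputable def evalEven (x : V) : EvenFun m V →+* even m where
  toFun f := ⟨f.1.1 x, f.2 x⟩
  map_one' := rfl
  map_mul' _ _ := rfl
  map_zero' := rfl
  map_add' _ _ := rfl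

/-- The body of an even element. -/
noncomputable def bodyEven (m : ℕ) : even m →+* ℝ :=
  (bodyHom m).toRingHom.comp (even m).val.toRingHom

theorem bodyEven_apply (f : even m) : bodyEven m f = body f.1 := rfl

theorem isUnit_evenFun {f : EvenFun m V} (hf : ∀ x, body (f.1.1 x) ≠ 0) : IsUnit f := by
  obtain ⟨g, h1, h2⟩ := exists_mul_eq_one hf
  have hg : superFunParity 0 g := by
    have e : g = partFun 0 g + partFun 1 g := (partFun_add_partFun g).symm
    have h3 : f.1 * partFun 1 g = 0 := by
      refine superFun_ext fun x => Grassmann.ext fun I => ?_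
      by_cases hI : (I.card : ZMod 2) = 1
      · have h4 : (f.1 * partFun 0 g + f.1 * partFun 1 g).1 x I = (1 : superFun m V).1 x I := by
          rw [← mul_add, ← e, h1]
        have h5 : (f.1 * partFun 0 g).1 x I = 0 :=
          (mul_parity f.2 (partFun_parity 0 g)) x I (by rw [hI]; decide)
        have h6 : (1 : superFun m V).1 x I = 0 := one_parity x I (by rw [hI]; decide)
        rw [h6] at h4
        change (f.1 * partFun 0 g).1 x I + (f.1 * partFun 1 g).1 x I = 0 at h4
        rw [h5, zero_add] at h4
        exact h4
      · exact (mul_parity f.2 (partFun_parity 1 g)) x I (by simpa using hI)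
    have h7 : partFun 1 g = 0 := by
      rw [← one_mul (partFun 1 g), ← h2, mul_assoc, h3, mul_zero]
    rw [e, h7, add_zero]
    exact partFun_parity 0 g
  exact ⟨⟨f, ⟨g, hg⟩, Subtype.ext h1, Subtype.ext h2⟩, rfl⟩

theorem map_ringInverse {A B : Type*} [CommRing A] [CommRing B] (φ : A →+* B) {a : A}
    (ha : IsUnit a) : Ring.inverse (φ a) = φ (Ring.inverse a) := by
  have h1 : φ (Ring.inverse a) * φ a = 1 := by
    rw [← map_mul, Ring.inverse_mul_cancel _ ha, map_one]
  rw [← one_mul (Ring.inverse (φ a)), ← h1, mul_assoc, Ring.mul_inverse_cancel _ (ha.map φ),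
    mul_one]

theorem map_matrix_inv {A B ι : Type*} [CommRing A] [CommRing B] [Fintype ι] [DecidableEq ι]
    (φ : A →+* B) {E : Matrix ι ι A} (hE : IsUnit E.det) : (E.map φ)⁻¹ = E⁻¹.map φ := by
  refine Matrix.inv_eq_left_inv ?_
  have := Matrix.map_mul (L := E⁻¹) (M := E) (f := φ)
  rwa [Matrix.nonsing_inv_mul _ hE, Matrix.map_one _ (map_zero _) (map_one _), eq_comm] at this

theorem toEven_of_mem {f : Grassmann m} (hf : f ∈ parity m 0) : toEven f = ⟨f, hf⟩ := by
  refine Subtype.ext (Grassmann.ext fun I => ?_)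
  change (if (I.card : ZMod 2) = 0 then f I else 0) = f I
  split_ifs with h
  · rfl
  · exact (hf I h).symm

/-- The value of a matrix of superfunctions at a point. -/
def evalMatrix (M : Matrix (CoordIndex n m) (CoordIndex n m) (superFun m V)) (x : V) :
    Matrix (CoordIndex n m) (CoordIndex n m) (Grassmann m) := fun a b => (M a b).1 x

/-- The body of a matrix of superfunctions at a point. -/
noncomputable def bodyMatrix (M : Matrix (CoordIndex n m) (CoordIndex n m) (superFun m V)) (x : V) :
    Matrix (CoordIndex n m) (CoordIndex n m) ℝ := fun a b => body ((M a b).1 x)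

theorem bodyMatrix_mul (M N : Matrix (CoordIndex n m) (CoordIndex n m) (superFun m V)) (x : V) :
    bodyMatrix (M * N) x = bodyMatrix M x * bodyMatrix N x := by
  ext a b
  change bodyHom m (((M * N) a b).1 x) = _
  rw [Matrix.mul_apply, superFun_sum_apply, map_sum, Matrix.mul_apply]
  exact Finset.sum_congr rfl fun c _ => map_mul (bodyHom m) _ _

theorem bodyMatrix_one (x : V) :
    bodyMatrix (1 : Matrix (CoordIndex n m) (CoordIndex n m) (superFun m V)) x = 1 := by
  ext a b
  simp only [bodyMatrix, Matrix.one_apply]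
  split_ifs
  · exact map_one (bodyHom m)
  · exact map_zero (bodyHom m)

variable {M N : Matrix (CoordIndex n m) (CoordIndex n m) (superFun m V)}

theorem bodyMatrix_eq_fromBlocks (hM : IsEvenMatrix coordParity (parityFun m V) M) (x : V) :
    bodyMatrix M x =
      Matrix.fromBlocks (bodyMatrix M x).toBlocks₁₁ 0 0 (bodyMatrix M x).toBlocks₂₂ := by
  conv_lhs => rw [← Matrix.fromBlocks_toBlocks (bodyMatrix M x)]
  congr 1
  · ext i j
    exact body_of_odd (by simpa [coordParity] using hM (Sum.inl i) (Sum.inr j) x)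
  · ext i j
    exact body_of_odd (by simpa [coordParity] using hM (Sum.inr i) (Sum.inl j) x)

theorem det_body_ne_zero (hM : IsEvenMatrix coordParity (parityFun m V) M)
    (hN : IsEvenMatrix coordParity (parityFun m V) N) (hMN : M * N = 1) (x : V) :
    (bodyMatrix M x).toBlocks₁₁.det ≠ 0 ∧ (bodyMatrix M x).toBlocks₂₂.det ≠ 0 := by
  have h := bodyMatrix_mul M N x
  rw [hMN, bodyMatrix_one, bodyMatrix_eq_fromBlocks hM, bodyMatrix_eq_fromBlocks hN,
    Matrix.fromBlocks_multiply, ← Matrix.fromBlocks_one, Matrix.fromBlocks_inj] at h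
  simp only [Matrix.mul_zero, Matrix.zero_mul, add_zero, zero_add] at h
  constructor
  · intro h0
    have := congrArg Matrix.det h.1
    rw [Matrix.det_mul, h0, zero_mul, Matrix.det_one] at this
    exact one_ne_zero this
  · intro h0
    have := congrArg Matrix.det h.2.2.2
    rw [Matrix.det_mul, h0, zero_mul, Matrix.det_one] at this
    exact one_ne_zero this

/-- The Berezinian of an invertible even matrix of superfunctions is a superfunction, with known
body and logarithmic derivatives. -/
theorem exists_berezinian (hM : IsEvenMatrix coordParity (parityFun m V) M)
    (hN : IsEvenMatrix coordParity (parityFun m V) N) (hMN : M * N = 1) (hNM : N * M = 1) :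
    ∃ J : EvenFun m V, (∀ x, evalEven x J = ber (evalMatrix M x)) ∧
      (∀ x, body (J.1.1 x) =
        (bodyMatrix M x).toBlocks₁₁.det * ((bodyMatrix M x).toBlocks₂₂.det)⁻¹) ∧
      ∀ a, pdFun a J.1 = J.1 * superLogDeriv coordParity (pdFun a) M N := by
  let hP := isSupercommutative_parityFun (m := m) (V := V)
  let E : Matrix (Fin m) (Fin m) (EvenFun m V) := fun i j =>
    ⟨M (Sum.inr i) (Sum.inr j), hM (Sum.inr i) (Sum.inr j)⟩
  have hbE : ∀ x, body (E.det.1.1 x) = (bodyMatrix M x).toBlocks₂₂.det := by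
    intro x
    change bodyEven m (evalEven x E.det) = _
    rw [RingHom.map_det, RingHom.map_det]
    rfl
  have hEu : IsUnit E.det := isUnit_evenFun fun x => by
    rw [hbE]; exact (det_body_ne_zero hM hN hMN x).2
  let S' : Matrix (Fin n) (Fin n) (superFun m V) :=
    M.toBlocks₁₁ - M.toBlocks₁₂ * E⁻¹.map Subtype.val * M.toBlocks₂₁
  have hS' : ∀ i j, S' i j ∈ parityFun m V 0 := by
    intro i j
    change M (Sum.inl i) (Sum.inl j) -
      (M.toBlocks₁₂ * E⁻¹.map Subtype.val * M.toBlocks₂₁) i j ∈ parityFun m V 0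
    rw [Matrix.mul_apply]
    refine Submodule.sub_mem _ ?_ (Submodule.sum_mem _ fun k _ => ?_)
    · simpa [coordParity] using hM (Sum.inl i) (Sum.inl j)
    · have h1 : (M.toBlocks₁₂ * E⁻¹.map Subtype.val) i k ∈ parityFun m V 1 := by
        rw [Matrix.mul_apply]
        refine Submodule.sum_mem _ fun l _ => ?_
        have := hP.mul_mem (hM (Sum.inl i) (Sum.inr l)) (E⁻¹ l k).2
        have e : coordParity (Sum.inl i : CoordIndex n m) + coordParity (Sum.inr l : CoordIndex n m)
          + 0 = 1 := by simp only [coordParity]; decide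
        rw [e] at this
        exact this
      have h2 := hP.mul_mem h1 (hM (Sum.inr k) (Sum.inl j))
      have e : (1 : ZMod 2) + (coordParity (Sum.inr k : CoordIndex n m) +
        coordParity (Sum.inl j : CoordIndex n m)) = 0 := by simp only [coordParity]; decide
      rwa [e] at h2
  let S : Matrix (Fin n) (Fin n) (EvenFun m V) := fun i j => ⟨S' i j, hS' i j⟩
  have hbS : ∀ x, body (S.det.1.1 x) = (bodyMatrix M x).toBlocks₁₁.det := by
    intro x
    change bodyEven m (evalEven x S.det) = _
    rw [RingHom.map_det, RingHom.map_det]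
    congr 1
    ext i j
    change bodyHom m ((S' i j).1 x) = _
    have h1 : (S' i j).1 x = (M (Sum.inl i) (Sum.inl j)).1 x -
        ∑ k, ((M.toBlocks₁₂ * E⁻¹.map Subtype.val) i k).1 x * (M (Sum.inr k) (Sum.inl j)).1 x := by
      change _ - (∑ k, _ : superFun m V).1 x = _
      rw [superFun_sum_apply]
      rfl
    rw [h1, map_sub, map_sum, Finset.sum_eq_zero, sub_zero]
    · rfl
    · intro k _
      have h2 : bodyHom m ((M (Sum.inr k) (Sum.inl j)).1 x) = 0 :=
        body_of_odd (by simpa [coordParity] using hM (Sum.inr k) (Sum.inl j) x)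
      rw [map_mul, h2, mul_zero]
  have hSu : IsUnit S.det := isUnit_evenFun fun x => by
    rw [hbS]; exact (det_body_ne_zero hM hN hMN x).1
  refine ⟨S.det * Ring.inverse E.det, fun x => ?_, fun x => ?_, fun a => ?_⟩
  · have hE : (evalMatrix M x).toBlocks₂₂.map toEven = E.map (evalEven x) := by
      ext1 i j
      exact toEven_of_mem (f := (E i j).1.1 x) ((E i j).2 x)
    have hS : ((evalMatrix M x).toBlocks₁₁ - (evalMatrix M x).toBlocks₁₂ *
        (((evalMatrix M x).toBlocks₂₂.map toEven)⁻¹).map Subtype.val *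
          (evalMatrix M x).toBlocks₂₁).map toEven = S.map (evalEven x) := by
      rw [hE, map_matrix_inv _ hEu]
      ext1 i j
      have h1 : ((evalMatrix M x).toBlocks₁₁ - (evalMatrix M x).toBlocks₁₂ *
        ((E⁻¹.map (evalEven x))).map Subtype.val * (evalMatrix M x).toBlocks₂₁) i j
          = (S' i j).1 x := by
        change _ = evalFun x (S' i j)
        simp only [S', Matrix.sub_apply, Matrix.mul_apply, map_sub, map_sum, map_mul]
        rfl
      rw [Matrix.map_apply, h1]
      exact toEven_of_mem (hS' i j x)
    rw [ber, hS, hE, map_mul, RingHom.map_det, ← map_ringInverse _ hEu, RingHom.map_det]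
    rfl
  · rw [← hbS, ← hbE]
    change bodyEven m (evalEven x (S.det * Ring.inverse E.det)) = _
    rw [map_mul, map_mul, ← map_ringInverse _ hEu, ← map_ringInverse _ (hEu.map (evalEven x)),
      Ring.inverse_eq_inv]
    rfl
  · rw [coordParity_eq_blockParity]
    refine (isSuperderivation_pdFun a).ber hP ?_ hNM (E := E) rfl hEu (S := S) rfl hSu
    rw [← coordParity_eq_blockParity]
    exact hM

/-! ### Powers -/

theorem sum_choose_mul_one_add {A : Type*} [CommRing A] [Algebra ℝ A] (w : ℝ) (ν : A) (k : ℕ) :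
    (∑ j ∈ Finset.range (k + 1), Ring.choose w j • ((j : A) * ν ^ (j - 1))) * (1 + ν) =
      w • ∑ j ∈ Finset.range (k + 1), Ring.choose w j • ν ^ j +
        ((k - w) * Ring.choose w k) • ν ^ k := by
  have hrec : ∀ k : ℕ, ((k : ℝ) + 1) * Ring.choose w (k + 1) = Ring.choose w k * (w - k) := by
    intro k
    have := Ring.choose_smul_choose w (n := k + 1) (k := k) (Nat.le_succ k)
    rw [Nat.choose_succ_self_right, Nat.add_sub_cancel_left, Ring.choose_one_right] at this
    simpa using this
  induction k with
  | zero =>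
    simp
  | succ k ih =>
    rw [Finset.sum_range_succ, add_mul, ih, Finset.sum_range_succ (n := k + 1), Nat.add_sub_cancel]
    have h1 := hrec k
    have h2 : ((k + 1 : ℕ) : A) = algebraMap ℝ A (k + 1) := by simp
    rw [h2]
    simp only [Algebra.smul_def, map_mul, map_sub, Nat.cast_add, Nat.cast_one]
    have h3 : algebraMap ℝ A (k + 1) * algebraMap ℝ A (Ring.choose w (k + 1)) =
        algebraMap ℝ A (Ring.choose w k) * (algebraMap ℝ A w - algebraMap ℝ A k) := by
      rw [← map_mul, h1, map_mul, map_sub]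
    linear_combination (ν ^ k) * h3

/-- The derivative of `β (1 + ν)^w = |J|^w`, where `b` is the body of `J`, `β = |b|^w`, and
`1 + ν = b⁻¹ J` with `ν` nilpotent. -/
theorem _root_.Derivation.power_rule {A E : Type*} [CommRing A] [Algebra ℝ A] [AddCommGroup E]
    [Module A E] [Module ℝ E] [IsScalarTower ℝ A E] (δ : Derivation ℝ A E) {J b bi β ν : A} {L : E}
    {w : ℝ} (hbi : bi * b = 1) (hδJ : δ J = J • L) (hν : ν = bi * (J - b)) {k : ℕ}
    (hν0 : ν ^ (k + 1) = 0) (hδβ : δ β = w • ((bi * β) • δ b)) :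
    δ (β * ∑ j ∈ Finset.range (k + 1), Ring.choose w j • ν ^ j) =
      w • ((β * ∑ j ∈ Finset.range (k + 1), Ring.choose w j • ν ^ j) • L) := by
  set Q := ∑ j ∈ Finset.range (k + 1), Ring.choose w j • ν ^ j with hQ
  let ℓ : E := L - bi • δ b
  have hcomm : ∀ (a : A) (r : ℝ) (e : E), a • r • e = r • a • e := fun a r e => by
    rw [← algebraMap_smul A r e, ← algebraMap_smul A r (a • e), smul_smul, smul_smul, mul_comm]
  have hδbi : δ bi = -((bi * bi) • δ b) := by
    have h1 : δ (bi * b) = 0 := by rw [hbi]; exact δ.map_one_eq_zero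
    rw [δ.leibniz] at h1
    have h2 : bi • (bi • δ b + b • δ bi) = 0 := by rw [h1, smul_zero]
    rw [smul_add, smul_smul, smul_smul, hbi, one_smul] at h2
    exact eq_neg_of_add_eq_zero_right h2
  have hν1 : ν = bi * J - 1 := by rw [hν, mul_sub, hbi]
  have hδν : δ ν = (1 + ν) • ℓ := by
    have e : 1 + ν = bi * J := by rw [hν1]; abel
    rw [e, hν1, map_sub, δ.map_one_eq_zero, sub_zero, δ.leibniz, hδbi, hδJ]
    change _ = (bi * J) • (L - bi • δ b)
    rw [smul_sub, smul_neg, smul_smul, smul_smul, smul_smul, ← sub_eq_add_neg]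
    congr 2
    ring
  have hνℓ : ν ^ k • ℓ = 0 := by
    have h1 : δ (ν ^ (k + 1)) = 0 := by rw [hν0, map_zero]
    rw [δ.leibniz_pow, Nat.add_sub_cancel, hδν, smul_smul, mul_add, mul_one, ← pow_succ, hν0,
      add_zero] at h1
    have h2 : ((k : ℝ) + 1) • (ν ^ k • ℓ) = 0 := by
      rw [← h1, ← Nat.cast_smul_eq_nsmul ℝ]
      norm_num
    exact (smul_eq_zero.1 h2).resolve_left (by positivity)
  have hδQ : δ Q = w • (Q • ℓ) := by
    have h1 : δ Q = (∑ j ∈ Finset.range (k + 1),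
        Ring.choose w j • ((j : A) * ν ^ (j - 1))) • δ ν := by
      rw [map_sum, Finset.sum_smul]
      refine Finset.sum_congr rfl fun j _ => ?_
      rw [δ.map_smul, δ.leibniz_pow, smul_assoc, mul_smul, Nat.cast_smul_eq_nsmul]
    rw [h1, hδν, smul_smul, sum_choose_mul_one_add, add_smul, smul_assoc, smul_assoc, hνℓ,
      smul_zero, add_zero]
  rw [δ.leibniz, hδQ, hδβ, hcomm, hcomm, ← smul_add, smul_smul, smul_smul]
  congr 1
  change (β * Q) • (L - bi • δ b) + _ = _
  rw [smul_sub, smul_smul]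
  have : Q * (bi * β) = β * Q * bi := by ring
  rw [this]
  abel

theorem body_absPow (J : even m) (w : ℝ) :
    body (absPow J w).1 = Real.exp (w * Real.log |body J.1|) := by
  change bodyEven m (absPow J w) = _
  have hs : ∀ (r : ℝ) (f : even m), bodyEven m (r • f) = r * bodyEven m f := fun _ _ => rfl
  have hν : bodyEven m ((body J.1)⁻¹ • (J - algebraMap ℝ (even m) (body J.1))) = 0 := by
    rw [hs, map_sub]
    have : bodyEven m (algebraMap ℝ (even m) (body J.1)) = body J.1 :=
      (bodyHom m).commutes _
    rw [this, bodyEven_apply, sub_self, mul_zero]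
  rw [absPow, hs, map_sum, Finset.sum_eq_single 0]
  · rw [hs, Ring.choose_zero_right, pow_zero, map_one, mul_one, mul_one]
  · intro k _ hk
    rw [hs, map_pow, hν, zero_pow hk, mul_zero]
  · simp

/-- The power `|J|^w` of an even superfunction with nonvanishing body is a superfunction. -/
theorem exists_absPow (J : EvenFun m V) (hJ : ∀ x, body (J.1.1 x) ≠ 0) (w : ℝ) :
    ∃ R : EvenFun m V, (∀ x, evalEven x R = absPow (evalEven x J) w) ∧
      ∀ (a : CoordIndex n m) (L : superFun m V), pdFun a J.1 = J.1 * L →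
        pdFun a R.1 = w • (R.1 * L) := by
  let F : (Fin n → ℝ) → ℝ := fun x => body (extendZero J.1.1 x)
  have hF : ContDiffOn ℝ ∞ F V := contDiffOn_body J.1
  have hF0 : ∀ x ∈ V, F x ≠ 0 := fun x hx => by
    simp only [F]
    rw [extendZero_apply _ ⟨x, hx⟩]; exact hJ ⟨x, hx⟩
  have hβ : ContDiffOn ℝ ∞ (fun x => Real.exp (w * Real.log |F x|)) V := by
    simp only [Real.log_abs]
    exact (contDiffOn_const.mul (hF.log hF0)).exp
  let b : EvenFun m V := ⟨bodyFun J.1, ofReal_parity _ _⟩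
  let bi : EvenFun m V := ⟨ofReal (fun x => (F x)⁻¹) (hF.inv hF0), ofReal_parity _ _⟩
  let β : EvenFun m V := ⟨ofReal _ hβ, ofReal_parity _ _⟩
  have hbi : bi * b = 1 := Subtype.ext <| superFun_ext fun x => by
    change (_ • (1 : Grassmann m)) * (_ • (1 : Grassmann m)) = 1
    rw [smul_mul_smul_comm, mul_one, inv_mul_cancel₀ (hF0 _ x.2), one_smul]
  let ν : EvenFun m V := bi * (J - b)
  have hνb : ∀ x, body (evalEven x ν).1 = 0 := by
    intro x
    change bodyEven m (evalEven x (bi * (J - b))) = 0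
    rw [map_mul, map_mul, map_sub, map_sub]
    have : bodyEven m (evalEven x b) = bodyEven m (evalEven x J) := by
      change bodyHom m ((bodyFun J.1).1 x) = _
      rw [bodyFun_apply, map_smul, map_one, smul_eq_mul, mul_one]
      rfl
    rw [this, sub_self, mul_zero]
  have hν0 : ν ^ (m + 1) = 0 := by
    refine Subtype.ext (superFun_ext fun x => ?_)
    have := pow_eq_zero_of_body (hνb x) (Nat.lt_succ_self m)
    rw [← map_pow] at this
    exact congrArg Subtype.val this
  let Q : EvenFun m V := ∑ k ∈ Finset.range (m + 1), Ring.choose w k • ν ^ k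
  have hsm : ∀ (x : V) (r : ℝ) (f : EvenFun m V), evalEven x (r • f) = r • evalEven x f :=
    fun _ _ _ => rfl
  refine ⟨β * Q, fun x => ?_, fun a L hL => ?_⟩
  · have h1 : evalEven x β = Real.exp (w * Real.log |body (evalEven x J).1|) • 1 := by
      refine Subtype.ext ?_
      change Real.exp (w * Real.log |F x|) • (1 : Grassmann m) = _ • (1 : Grassmann m)
      simp only [F]
      rw [extendZero_apply]
      rfl
    have h2 : evalEven x ν =
        (body (evalEven x J).1)⁻¹ • (evalEven x J - algebraMap ℝ (even m) (body (evalEven x J).1)) := by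
      have h3 : evalEven x bi = (body (evalEven x J).1)⁻¹ • 1 := by
        refine Subtype.ext ?_
        change (F x)⁻¹ • (1 : Grassmann m) = _ • (1 : Grassmann m)
        simp only [F]
        rw [extendZero_apply]
        rfl
      have h4 : evalEven x b = algebraMap ℝ (even m) (body (evalEven x J).1) := by
        rw [Algebra.algebraMap_eq_smul_one]
        exact Subtype.ext (bodyFun_apply J.1 x)
      rw [map_mul, map_sub, h3, h4, smul_mul_assoc, one_mul]
    rw [map_mul, h1, map_sum, absPow, smul_mul_assoc, one_mul]
    congr 1
    refine Finset.sum_congr rfl fun k _ => ?_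
    rw [hsm, map_pow, h2]
  · let δ := pdEven V a
    have hδβ : δ β = w • ((bi * β) • δ b) := by
      refine superFun_ext fun x => ?_
      change (pdFun a β.1).1 x = w • ((bi.1.1 x * β.1.1 x) * (pdFun a b.1).1 x)
      cases a with
      | inr μ =>
        have e1 : pdFun (Sum.inr μ) β.1 = 0 := pdFun_inr_ofReal μ _ _
        have e2 : pdFun (Sum.inr μ) b.1 = 0 := pdFun_inr_ofReal μ _ _
        rw [e1, e2]
        change (0 : Grassmann m) = w • (_ * (0 : Grassmann m))
        rw [mul_zero, smul_zero]
      | inl k =>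
        have e1 : (pdFun (Sum.inl k) β.1).1 x = _ := pd_inl_ofReal k _ hβ x
        have e2 : (pdFun (Sum.inl k) b.1).1 x = _ := pd_inl_ofReal k _ hF x
        have hd : HasFDerivAt F (fderiv ℝ F x.1) x.1 :=
          ((hF.contDiffAt (V.isOpen.mem_nhds x.2)).differentiableAt (by simp)).hasFDerivAt
        have h3 := ((hd.log (hF0 _ x.2)).const_mul w).exp
        have h4 : (fun x => Real.exp (w * Real.log |F x|)) = fun x => Real.exp (w * Real.log (F x)) :=
          by simp only [Real.log_abs]
        rw [e1, e2, h4, h3.fderiv]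
        change _ = w • ((((F x.1)⁻¹ • (1 : Grassmann m)) *
          (Real.exp (w * Real.log |F x.1|) • (1 : Grassmann m))) *
            (fderiv ℝ F x.1 (Pi.single k 1) • (1 : Grassmann m)))
        simp only [_root_.smul_apply, smul_eq_mul, smul_mul_smul_comm, mul_one, smul_smul,
          Real.log_abs]
        congr 1
        ring
    exact δ.power_rule hbi (J := J) (L := L) hL rfl hν0 hδβ

end BerezinianFunctions

namespace Supermanifold

open Grassmann Filter Topology

variable {n m : ℕ} (M : Supermanifold.{u, v} n m)

/-! ### Changes of coordinates -/

section Trans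

variable {i j : M.ι} {W : Opens M.X} (hW : W ≤ chartDom (M.chart i) ⊓ chartDom (M.chart j))

theorem trans_twistFun (q : ZMod 2) (f : superFun m (chartImage (M.chart j) W)) :
    M.trans i j W hW (twistFun q f) = twistFun q (M.trans i j W hW f) := by
  rw [← partFun_add_partFun f, map_add, map_add, map_add,
    twistFun_of_parity (partFun_parity 0 f), twistFun_of_parity (partFun_parity 1 f), map_smul,
    map_smul, map_add, twistFun_of_parity (M.trans_parity i j W hW 0 _ (partFun_parity 0 f)),
    twistFun_of_parity (M.trans_parity i j W hW 1 _ (partFun_parity 1 f))]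

theorem change_mem_chartImage {i j : M.ι} {W : Opens M.X}
    (hW : W ≤ chartDom (M.chart i) ⊓ chartDom (M.chart j)) {x : Fin n → ℝ} (hx : x ∈ chartImage (M.chart i) W) :
    M.chart j ((M.chart i).symm x) ∈ chartImage (M.chart j) W := by
  have h := (hW hx.2).2
  refine ⟨(M.chart j).map_source h, ?_⟩
  change (M.chart j).symm _ ∈ W
  rw [(M.chart j).left_inv h]
  exact hx.2

/-- The change of coordinates of the underlying manifold. -/
def changePt (x : chartImage (M.chart i) W) : chartImage (M.chart j) W :=
  ⟨M.chart j ((M.chart i).symm x.1), M.change_mem_chartImage hW x.2⟩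

theorem symm_changePt (x : chartImage (M.chart i) W) :
    (M.chart j).symm (M.changePt hW x).1 = (M.chart i).symm x.1 :=
  (M.chart j).left_inv (hW x.2.2).2

theorem body_trans (f : superFun m (chartImage (M.chart j) W)) (x : chartImage (M.chart i) W) :
    body ((M.trans i j W hW f).1 x) = body (f.1 (M.changePt hW x)) :=
  M.trans_body i j W hW f x _ (M.symm_changePt hW x).symm

/-- The Jacobi matrix over an open set contained in the domains of two charts. -/
noncomputable def jac : Matrix (CoordIndex n m) (CoordIndex n m)
    (superFun m (chartImage (M.chart i) W)) :=
  fun a b => pdFun a (M.trans i j W hW (coordFun _ b))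

theorem jac_even : IsEvenMatrix coordParity (parityFun m _) (M.jac hW) := fun a b =>
  pdFun_parity a (M.trans_parity i j W hW _ _ (coordFun_parity b))

/-- The chain rule. -/
theorem chain_rule (a : CoordIndex n m) (f : superFun m (chartImage (M.chart j) W)) :
    pdFun a (M.trans i j W hW f) = ∑ b, M.jac hW a b * M.trans i j W hW (pdFun b f) := by
  refine superFun_ext fun x => ?_
  have := twistedDerivation_eq_sum (y := M.changePt hW x)
    ((evalFun x).comp (M.trans i j W hW))
    (fun k => by
      change body ((M.trans i j W hW _).1 x) = _
      rw [M.body_trans hW]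
      change bodyHom m ((M.changePt hW x).1 k • (1 : Grassmann m)) = _
      rw [map_smul, map_one (bodyHom m), smul_eq_mul, mul_one])
    (fun q f => by
      change (M.trans i j W hW (twistFun q f)).1 x = _
      rw [M.trans_twistFun hW]
      rfl)
    (coordParity a)
    ((evalFun x).toLinearMap.comp ((pdFun a).comp (M.trans i j W hW).toLinearMap))
    (fun f g => by
      change (pdFun a (M.trans i j W hW (f * g))).1 x = _
      rw [map_mul, pdFun_mul]
      rfl)
    (fun b => M.jac_even hW a b x) f
  rw [superFun_sum_apply]
  exact this

theorem trans_comp {k : M.ι} (hjk : W ≤ chartDom (M.chart j) ⊓ chartDom (M.chart k))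
    (hik : W ≤ chartDom (M.chart i) ⊓ chartDom (M.chart k)) (A : Matrix (CoordIndex n m)
      (CoordIndex n m) (superFun m (chartImage (M.chart k) W))) :
    (A.map (M.trans j k W hjk)).map (M.trans i j W hW) = A.map (M.trans i k W hik) := by
  ext1 a b
  exact M.trans_trans i j k W hW hjk hik _

theorem jac_mul {k : M.ι} (hjk : W ≤ chartDom (M.chart j) ⊓ chartDom (M.chart k))
    (hik : W ≤ chartDom (M.chart i) ⊓ chartDom (M.chart k)) :
    M.jac hW * (M.jac hjk).map (M.trans i j W hW) = M.jac hik := by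
  ext1 a c
  rw [Matrix.mul_apply, jac, ← M.trans_trans i j k W hW hjk hik, M.chain_rule hW]
  rfl

theorem jac_self (hii : W ≤ chartDom (M.chart i) ⊓ chartDom (M.chart i)) : M.jac hii = 1 := by
  ext1 a b
  rw [jac, M.trans_self, pdFun_coordFun, Matrix.one_apply]

/-- The inverse Jacobi matrix. -/
noncomputable def jacInv : Matrix (CoordIndex n m) (CoordIndex n m)
    (superFun m (chartImage (M.chart i) W)) :=
  (M.jac (i := j) (j := i) (hW.trans (le_of_eq (inf_comm _ _)))).map (M.trans i j W hW)

theorem jacInv_even : IsEvenMatrix coordParity (parityFun m _) (M.jacInv hW) := fun a b =>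
  M.trans_parity i j W hW _ _ (M.jac_even _ a b)

theorem jac_mul_jacInv : M.jac hW * M.jacInv hW = 1 := by
  rw [jacInv, M.jac_mul hW _ (le_inf (hW.trans inf_le_left) (hW.trans inf_le_left)), M.jac_self]

theorem jacInv_mul_jac : M.jacInv hW * M.jac hW = 1 := by
  have hji : W ≤ chartDom (M.chart j) ⊓ chartDom (M.chart i) := hW.trans (le_of_eq (inf_comm _ _))
  have h := M.jac_mul_jacInv hji
  have h2 := congrArg (fun A => Matrix.map A (M.trans i j W hW)) h
  beta_reduce at h2
  rw [Matrix.map_mul, jacInv, M.trans_comp hW hji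
    (le_inf (hW.trans inf_le_left) (hW.trans inf_le_left)),
    Matrix.map_one _ (map_zero _) (map_one _)] at h2
  have h3 : (M.jac hW).map (M.trans i i W
      (le_inf (hW.trans inf_le_left) (hW.trans inf_le_left))) = M.jac hW := by
    ext1 a b
    exact M.trans_self i W _ _
  rw [h3] at h2
  exact h2

/-- The logarithmic derivatives of the Jacobian. -/
noncomputable def logJac (a : CoordIndex n m) : superFun m (chartImage (M.chart i) W) :=
  superLogDeriv coordParity (pdFun a) (M.jac hW) (M.jacInv hW)

theorem exists_berPow (w : ℝ) : ∃ R : EvenFun m (chartImage (M.chart i) W),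
    (∀ x, evalEven x R = absPow (ber (evalMatrix (M.jac hW) x)) w) ∧
    (∀ x, body (R.1.1 x) = Real.exp (w * Real.log |(bodyMatrix (M.jac hW) x).toBlocks₁₁.det *
      ((bodyMatrix (M.jac hW) x).toBlocks₂₂.det)⁻¹|)) ∧
    ∀ a, pdFun a R.1 = w • (R.1 * M.logJac hW a) := by
  obtain ⟨J, h1, h2, h3⟩ := exists_berezinian (M.jac_even hW) (M.jacInv_even hW)
    (M.jac_mul_jacInv hW) (M.jacInv_mul_jac hW)
  have h4 := det_body_ne_zero (M.jac_even hW) (M.jacInv_even hW) (M.jac_mul_jacInv hW)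
  obtain ⟨R, h5, h6⟩ := exists_absPow J (fun x => by
    rw [h2]; exact mul_ne_zero (h4 x).1 (inv_ne_zero (h4 x).2)) w
  refine ⟨R, fun x => by rw [h5, h1], fun x => ?_, fun a => h6 a _ (h3 a)⟩
  rw [← h2]
  change body (evalEven x R).1 = _
  rw [h5, body_absPow]
  rfl

/-- The power `|Dx_j / Dx_i|^w` as a superfunction over an open set contained in the domains of
two charts. -/
noncomputable def berPow (w : ℝ) : EvenFun m (chartImage (M.chart i) W) :=
  (M.exists_berPow hW w).choose

theorem evalEven_berPow (w : ℝ) (x : chartImage (M.chart i) W) :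
    evalEven x (M.berPow hW w) = absPow (ber (evalMatrix (M.jac hW) x)) w :=
  (M.exists_berPow hW w).choose_spec.1 x

theorem body_berPow (w : ℝ) (x : chartImage (M.chart i) W) :
    body ((M.berPow hW w).1.1 x) =
      Real.exp (w * Real.log |(bodyMatrix (M.jac hW) x).toBlocks₁₁.det *
        ((bodyMatrix (M.jac hW) x).toBlocks₂₂.det)⁻¹|) :=
  (M.exists_berPow hW w).choose_spec.2.1 x

theorem pdFun_berPow (w : ℝ) (a : CoordIndex n m) :
    pdFun a (M.berPow hW w).1 = w • ((M.berPow hW w).1 * M.logJac hW a) :=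
  (M.exists_berPow hW w).choose_spec.2.2 a

theorem berPow_parity (w : ℝ) : superFunParity 0 (M.berPow hW w).1 := (M.berPow hW w).2

theorem evenFun_ext {V : Opens (Fin n → ℝ)} {f g : EvenFun m V}
    (h : ∀ x, evalEven x f = evalEven x g) : f = g :=
  Subtype.ext (superFun_ext fun x => congrArg Subtype.val (h x))

theorem berPow_add (u v : ℝ) : M.berPow hW (u + v) = M.berPow hW u * M.berPow hW v :=
  evenFun_ext fun x => by
    rw [map_mul, evalEven_berPow, evalEven_berPow, evalEven_berPow, absPow_add]

theorem berPow_zero : M.berPow hW 0 = 1 :=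
  evenFun_ext fun x => by rw [evalEven_berPow, absPow_zero, map_one]

theorem berPow_neg_mul (w : ℝ) : (M.berPow hW (-w)).1 * (M.berPow hW w).1 = 1 := by
  have h := M.berPow_add hW (-w) w
  rw [neg_add_cancel, berPow_zero] at h
  exact (congrArg Subtype.val h).symm

theorem logJac_comp {k : M.ι} (hjk : W ≤ chartDom (M.chart j) ⊓ chartDom (M.chart k))
    (hik : W ≤ chartDom (M.chart i) ⊓ chartDom (M.chart k)) (a : CoordIndex n m) :
    M.logJac hik a = M.logJac hW a +
      ∑ b, M.jac hW a b * M.trans i j W hW (M.logJac hjk b) := by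
  have hkj : W ≤ chartDom (M.chart k) ⊓ chartDom (M.chart j) := hjk.trans (le_of_eq (inf_comm _ _))
  have hji : W ≤ chartDom (M.chart j) ⊓ chartDom (M.chart i) := hW.trans (le_of_eq (inf_comm _ _))
  have hki : W ≤ chartDom (M.chart k) ⊓ chartDom (M.chart i) := hik.trans (le_of_eq (inf_comm _ _))
  have hN : M.jacInv hik = (M.jacInv hjk).map (M.trans i j W hW) * M.jacInv hW := by
    change (M.jac hki).map (M.trans i k W hik) = _
    rw [← M.jac_mul hkj hji hki, Matrix.map_mul, M.trans_comp hik hkj hW]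
    congr 1
    exact (M.trans_comp hW hjk hik _).symm
  have h2 : (M.jac hjk).map (M.trans i j W hW) * (M.jacInv hjk).map (M.trans i j W hW) = 1 := by
    rw [← Matrix.map_mul, M.jac_mul_jacInv, Matrix.map_one _ (map_zero _) (map_one _)]
  rw [logJac, hN, ← M.jac_mul hW hjk hik, superLogDeriv_mul (M₁ := M.jac hW)
    (N₁ := M.jacInv hW) (M₂ := (M.jac hjk).map (M.trans i j W hW))
    (N₂ := (M.jacInv hjk).map (M.trans i j W hW)) coordParity
    isSupercommutative_parityFun (isSuperderivation_pdFun a) (M.jac_even hW) (M.jacInv_even hW)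
    (fun a b => M.trans_parity i j W hW _ _ (M.jac_even hjk a b))
    (fun a b => M.trans_parity i j W hW _ _ (M.jacInv_even hjk a b)) (M.jacInv_mul_jac hW) h2]
  congr 1
  simp only [superLogDeriv, logJac, Matrix.map_apply, M.chain_rule hW a, map_sum, map_smul,
    map_mul, Finset.mul_sum, Finset.sum_mul, Finset.smul_sum, mul_smul_comm, mul_assoc]
  rw [Finset.sum_congr rfl fun c _ => Finset.sum_comm, Finset.sum_comm]

theorem bodyMatrix_map_trans (A : Matrix (CoordIndex n m) (CoordIndex n m)
    (superFun m (chartImage (M.chart j) W))) (x : chartImage (M.chart i) W) :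
    bodyMatrix (A.map (M.trans i j W hW)) x = bodyMatrix A (M.changePt hW x) := by
  ext a b
  exact M.body_trans hW _ x

/-- The cocycle condition for the powers of the Berezinian. The quotient of the two sides has
vanishing logarithmic derivatives, so it is determined by its body. -/
theorem berPow_mul_trans {k : M.ι} (hjk : W ≤ chartDom (M.chart j) ⊓ chartDom (M.chart k))
    (hik : W ≤ chartDom (M.chart i) ⊓ chartDom (M.chart k)) (w : ℝ) :
    (M.berPow hW w).1 * M.trans i j W hW (M.berPow hjk w).1 = (M.berPow hik w).1 := by
  set A := (M.berPow hW w).1 with hA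
  set B := M.trans i j W hW (M.berPow hjk w).1 with hB
  set C := (M.berPow hik (-w)).1 with hC
  have hA0 : superFunParity 0 A := M.berPow_parity hW w
  have hB0 : superFunParity 0 B := M.trans_parity i j W hW _ _ (M.berPow_parity hjk w)
  have hC0 : superFunParity 0 C := M.berPow_parity hik (-w)
  have hAB0 : superFunParity 0 (A * B) := by simpa using mul_parity hA0 hB0
  have dB : ∀ a, pdFun a B = w • (B * ∑ b, M.jac hW a b * M.trans i j W hW (M.logJac hjk b)) := by
    intro a
    rw [hB, M.chain_rule hW, Finset.mul_sum, Finset.smul_sum]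
    refine Finset.sum_congr rfl fun b _ => ?_
    rw [M.pdFun_berPow hjk, map_smul, map_mul, mul_smul_comm, ← mul_assoc, ← even_mul_comm hB0,
      mul_assoc]
  have key : A * B * C = 1 := by
    refine superFun_ext fun x => ?_
    refine eq_one_of_pdFun_inr (f := A * B * C) (fun μ => ?_) ?_
    · have hz : pdFun (Sum.inr μ) (A * B * C) = 0 := by
        rw [pdFun_mul_of_parity _ hAB0, pdFun_mul_of_parity _ hA0, koszul_zero_right, one_smul,
          one_smul, dB, M.pdFun_berPow hW, M.pdFun_berPow hik, M.logJac_comp hW hjk hik]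
        set L := M.logJac hW (Sum.inr μ)
        set L' := ∑ b, M.jac hW (Sum.inr μ) b * M.trans i j W hW (M.logJac hjk b)
        have e1 : A * L * B * C = A * B * C * L := by
          rw [mul_assoc A L B, ← even_mul_comm hB0 L, mul_assoc, mul_assoc B L C,
            ← even_mul_comm hC0 L]
          simp only [mul_assoc]
        have e2 : A * (B * L') * C = A * B * C * L' := by
          rw [mul_assoc, mul_assoc B L' C, ← even_mul_comm hC0 L']
          simp only [mul_assoc]
        rw [add_mul, smul_mul_assoc, smul_mul_assoc, mul_smul_comm, smul_mul_assoc, mul_smul_comm,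
          e1, e2, ← hC, ← mul_assoc, mul_add]
        module
      rw [hz]; rfl
    · change bodyHom m (A.1 x * B.1 x * C.1 x) = 1
      rw [map_mul, map_mul]
      change body (A.1 x) * body (B.1 x) * body (C.1 x) = 1
      rw [hB, M.body_trans hW, body_berPow, body_berPow, body_berPow, ← Real.exp_add,
        ← Real.exp_add, Real.exp_eq_one_iff]
      have hm := bodyMatrix_mul (M.jac hW) ((M.jac hjk).map (M.trans i j W hW)) x
      rw [M.jac_mul hW hjk hik, M.bodyMatrix_map_trans hW, bodyMatrix_eq_fromBlocks (M.jac_even hik),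
        bodyMatrix_eq_fromBlocks (M.jac_even hW), bodyMatrix_eq_fromBlocks (M.jac_even hjk),
        Matrix.fromBlocks_multiply, Matrix.fromBlocks_inj] at hm
      simp only [Matrix.mul_zero, Matrix.zero_mul, add_zero, zero_add] at hm
      have d1 := det_body_ne_zero (M.jac_even hW) (M.jacInv_even hW) (M.jac_mul_jacInv hW) x
      have d2 := det_body_ne_zero (M.jac_even hjk) (M.jacInv_even hjk) (M.jac_mul_jacInv hjk)
        (M.changePt hW x)
      rw [hm.1, hm.2.2.2, Matrix.det_mul, Matrix.det_mul, mul_inv]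
      have e : ∀ a b c d : ℝ, a * b * (c⁻¹ * d⁻¹) = (a * c⁻¹) * (b * d⁻¹) := fun a b c d => by ring
      rw [e, abs_mul (_ * _) (_ * _), Real.log_mul (abs_ne_zero.2
        (mul_ne_zero d1.1 (inv_ne_zero d1.2))) (abs_ne_zero.2
        (mul_ne_zero d2.1 (inv_ne_zero d2.2)))]
      ring
  calc A * B = A * B * (C * (M.berPow hik w).1) := by rw [M.berPow_neg_mul hik, mul_one]
    _ = (M.berPow hik w).1 := by rw [← mul_assoc, key, one_mul]

end Trans

end Supermanifold

namespace Supermanifold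

open Grassmann Filter Topology

variable {n m : ℕ} (M : Supermanifold.{u, v} n m)

/-! ### The Piola identity -/

section Piola

variable {i j : M.ι} {W : Opens M.X} (hW : W ≤ chartDom (M.chart i) ⊓ chartDom (M.chart j))

theorem pdFun_jac (a b c : CoordIndex n m) :
    pdFun a (M.jac hW b c) = koszul (coordParity a) (coordParity b) • pdFun b (M.jac hW a c) :=
  pdFun_comm a b _

theorem logJac_parity (a : CoordIndex n m) : superFunParity (coordParity a) (M.logJac hW a) := by
  refine sum_parity _ fun b _ => smul_parity _ (sum_parity _ fun c _ => ?_)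
  have := mul_parity (pdFun_parity a (M.jac_even hW b c)) (M.jacInv_even hW c b)
  have e : coordParity a + (coordParity b + coordParity c) + (coordParity c + coordParity b) =
      coordParity a := by
    generalize coordParity a = p
    generalize coordParity b = q
    generalize coordParity c = r
    revert p q r
    decide
  rwa [e] at this

theorem pdFun_jacInv (a b c : CoordIndex n m) :
    pdFun a (M.jacInv hW b c) = -∑ e, ∑ f, koszul (coordParity a) (coordParity b + coordParity e) •
      (M.jacInv hW b e * pdFun a (M.jac hW e f) * M.jacInv hW f c) := by
  have h1 : ∀ f, (∑ e, pdFun a (M.jacInv hW b e) * M.jac hW e f) =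
      -∑ e, koszul (coordParity a) (coordParity b + coordParity e) •
        (M.jacInv hW b e * pdFun a (M.jac hW e f)) := by
    intro f
    have h2 := congrArg (fun A => pdFun a (A b f)) (M.jacInv_mul_jac hW)
    beta_reduce at h2
    rw [Matrix.mul_apply, map_sum, Finset.sum_congr rfl fun e _ =>
      pdFun_mul_of_parity a (M.jacInv_even hW b e) (M.jac hW e f), Finset.sum_add_distrib] at h2
    rw [eq_neg_iff_add_eq_zero, h2, Matrix.one_apply]
    split_ifs
    · exact pdFun_one a
    · exact map_zero _
  have h3 : pdFun a (M.jacInv hW b c) =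
      ∑ f, (∑ e, pdFun a (M.jacInv hW b e) * M.jac hW e f) * M.jacInv hW f c := by
    have h4 := M.jac_mul_jacInv hW
    simp only [Finset.sum_mul, mul_assoc]
    rw [Finset.sum_comm]
    simp only [← Finset.mul_sum]
    rw [Finset.sum_congr rfl fun e _ => by rw [← Matrix.mul_apply, h4, Matrix.one_apply]]
    simp
  rw [h3, Finset.sum_comm, ← Finset.sum_neg_distrib]
  refine Finset.sum_congr rfl fun f _ => ?_
  rw [h1]
  refine (neg_mul (_ : superFun m (chartImage (M.chart i) W)) _).trans (congrArg _ ?_)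
  rw [Finset.sum_mul]
  simp only [smul_mul_assoc]

/-- The Piola identity: the vector fields `∂_b` of one chart, multiplied by the Berezinian, have
divergence zero in the coordinates of the other chart. -/
theorem piola (b : CoordIndex n m) :
    ∑ a, koszul (coordParity a) (coordParity a + coordParity b) •
      pdFun a ((M.berPow hW 1).1 * M.jacInv hW b a) = 0 := by
  set ρ := (M.berPow hW 1).1
  have hρ : superFunParity 0 ρ := M.berPow_parity hW 1
  have h1 : ∀ a, koszul (coordParity a) (coordParity a + coordParity b) •
      pdFun a (ρ * M.jacInv hW b a) = ρ * (M.jacInv hW b a * M.logJac hW a) +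
      ρ * (koszul (coordParity a) (coordParity a + coordParity b) • pdFun a (M.jacInv hW b a)) := by
    intro a
    rw [pdFun_mul_of_parity a hρ, koszul_zero_right, one_smul, M.pdFun_berPow, one_smul, smul_add,
      mul_assoc, mul_comm_of_parity (M.jacInv_even hW b a) (M.logJac_parity hW a), mul_smul_comm,
      mul_smul_comm, koszul_comm, add_comm (coordParity a) (coordParity b)]
  have h2 : ∀ a, koszul (coordParity a) (coordParity a + coordParity b) •
      pdFun a (M.jacInv hW b a) = -∑ e, M.jacInv hW b e * ∑ f, koszul (coordParity a) 1 •
        (pdFun e (M.jac hW a f) * M.jacInv hW f a) := by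
    intro a
    rw [M.pdFun_jacInv hW, smul_neg, Finset.smul_sum]
    refine congrArg _ (Finset.sum_congr rfl fun e _ => ?_)
    rw [Finset.smul_sum, Finset.mul_sum]
    refine Finset.sum_congr rfl fun f _ => ?_
    rw [M.pdFun_jac hW a e f, mul_smul_comm, smul_mul_assoc, mul_smul_comm, smul_smul, smul_smul]
    refine congrArg₂ _ ?_ (mul_assoc _ _ _)
    simp only [koszul_add_right]
    generalize coordParity a = p
    generalize coordParity b = q
    generalize coordParity e = r
    rcases zmod_two_cases p with rfl | rfl <;> rcases zmod_two_cases q with rfl | rfl <;>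
      rcases zmod_two_cases r with rfl | rfl <;>
      simp [koszul_zero_left, koszul_zero_right, koszul_one_one]
  rw [Finset.sum_congr rfl fun a _ => h1 a, Finset.sum_add_distrib, ← Finset.mul_sum,
    ← Finset.mul_sum, ← mul_add, Finset.sum_congr rfl fun a _ => h2 a, Finset.sum_neg_distrib,
    Finset.sum_comm]
  simp only [← Finset.mul_sum]
  rw [← Finset.sum_neg_distrib, ← Finset.sum_add_distrib, Finset.sum_eq_zero, mul_zero]
  intro e _
  rw [← sub_eq_add_neg, ← mul_sub, logJac, superLogDeriv]
  simp only [Finset.smul_sum, sub_self, mul_zero]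

theorem berPow_mul_trans_pdFun (b : CoordIndex n m) (v : superFun m (chartImage (M.chart j) W)) :
    (M.berPow hW 1).1 * M.trans i j W hW (pdFun b v) =
      ∑ a, koszul (coordParity a) (coordParity a + coordParity b) •
        pdFun a ((M.berPow hW 1).1 * M.jacInv hW b a * M.trans i j W hW v) := by
  set ρ := (M.berPow hW 1).1 with hρd
  have hρ : superFunParity 0 ρ := M.berPow_parity hW 1
  have h1 : ∀ a, koszul (coordParity a) (coordParity a + coordParity b) •
      pdFun a (ρ * M.jacInv hW b a * M.trans i j W hW v) =
      (koszul (coordParity a) (coordParity a + coordParity b) • pdFun a (ρ * M.jacInv hW b a)) *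
        M.trans i j W hW v + ρ * (M.jacInv hW b a * pdFun a (M.trans i j W hW v)) := by
    intro a
    have hp : superFunParity (coordParity a + coordParity b) (ρ * M.jacInv hW b a) := by
      have := mul_parity hρ (M.jacInv_even hW b a)
      rwa [zero_add, add_comm] at this
    rw [pdFun_mul_of_parity a hp, smul_add, smul_smul, koszul_mul_self, one_smul, smul_mul_assoc,
      mul_assoc ρ]
  rw [Finset.sum_congr rfl fun a _ => h1 a, Finset.sum_add_distrib, ← Finset.sum_mul, M.piola hW,
    zero_mul, zero_add, ← Finset.mul_sum]
  congr 1
  simp only [M.chain_rule hW, Finset.mul_sum, ← mul_assoc]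
  rw [Finset.sum_comm]
  simp only [← Finset.sum_mul]
  rw [Finset.sum_congr rfl fun e _ => by rw [← Matrix.mul_apply, M.jacInv_mul_jac, Matrix.one_apply]]
  simp

end Piola

/-! ### Supports -/

section Supports

variable {i j : M.ι} {W : Opens M.X} (hW : W ≤ chartDom (M.chart i) ⊓ chartDom (M.chart j))

theorem trans_apply_eq_zero {W' : Opens M.X} (h : W' ≤ W)
    {f : superFun m (chartImage (M.chart j) W)} (x : chartImage (M.chart i) W)
    (hx : (M.chart i).symm x.1 ∈ W')
    (hf : ∀ y : chartImage (M.chart j) W, (M.chart j).symm y.1 ∈ W' → f.1 y = 0) :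
    (M.trans i j W hW f).1 x = 0 := by
  have h1 : restrictFun (chartImage_mono (M.chart j) h) f = 0 :=
    superFun_ext fun y => hf _ y.2.2
  have h2 := M.trans_restrict i j W hW W' h f
  rw [h1, map_zero] at h2
  exact congrArg (fun g => g.1 ⟨x.1, x.2.1, hx⟩) h2

theorem hasCompactSupp_trans {f : superFun m (chartImage (M.chart j) W)} (hf : HasCompactSupp f) :
    HasCompactSupp (M.trans i j W hW f) := by
  obtain ⟨K, hK, hKW, hfK⟩ := hf
  have hc : ContinuousOn (M.chart j).symm K :=
    (M.chart j).continuousOn_symm.mono fun x hx => (hKW hx).1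
  have hK' : IsCompact ((M.chart j).symm '' K) := hK.image_of_continuousOn hc
  have hKW' : (M.chart j).symm '' K ⊆ W := by
    rintro _ ⟨x, hx, rfl⟩
    exact (hKW hx).2
  refine ⟨M.chart i '' ((M.chart j).symm '' K), hK'.image_of_continuousOn
    ((M.chart i).continuousOn.mono fun p hp => (hW (hKW' hp)).1), ?_, fun x hx => ?_⟩
  · rintro _ ⟨p, hp, rfl⟩
    have hp1 := hKW' hp
    refine ⟨(M.chart i).map_source (hW hp1).1, ?_⟩
    change (M.chart i).symm _ ∈ W
    rwa [(M.chart i).left_inv (hW hp1).1]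
  · refine M.trans_apply_eq_zero hW (W' := W ⊓ ⟨((M.chart j).symm '' K)ᶜ, hK'.isClosed.isOpen_compl⟩)
      inf_le_left x ⟨x.2.2, fun h => hx ⟨_, h, (M.chart i).right_inv x.2.1⟩⟩ fun y hy => ?_
    exact hfK y fun h => hy.2 ⟨_, h, rfl⟩

end Supports

end Supermanifold

section Integral

variable {n m : ℕ} {V V' : Opens (Fin n → ℝ)}

theorem HasCompactSupp.integrable {f : superFun m V} (hf : HasCompactSupp f) :
    IntegrableOn (fun x => extendZero f.1 x Finset.univ) (V : Set (Fin n → ℝ)) := by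
  let L : Grassmann m →L[ℝ] ℝ := (Grassmann.coeff Finset.univ).toContinuousLinearMap
  exact ((L.contDiff.comp hf.contDiff).continuous.integrable_of_hasCompactSupport
    (hf.hasCompactSupport.comp_left (g := L) (map_zero L))).integrableOn

theorem HasCompactSupp.add {f g : superFun m V} (hf : HasCompactSupp f) (hg : HasCompactSupp g) :
    HasCompactSupp (f + g) := by
  obtain ⟨K, h1, h2, h3⟩ := hf
  obtain ⟨L, l1, l2, l3⟩ := hg
  refine ⟨K ∪ L, h1.union l1, Set.union_subset h2 l2, fun x hx => ?_⟩
  change f.1 x + g.1 x = 0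
  rw [h3 x fun h => hx (Or.inl h), l3 x fun h => hx (Or.inr h), add_zero]

theorem HasCompactSupp.smul {f : superFun m V} (hf : HasCompactSupp f) (r : ℝ) :
    HasCompactSupp (r • f) := by
  obtain ⟨K, h1, h2, h3⟩ := hf
  refine ⟨K, h1, h2, fun x hx => ?_⟩
  change r • f.1 x = 0
  rw [h3 x hx, smul_zero]

theorem HasCompactSupp.zero : HasCompactSupp (0 : superFun m V) :=
  ⟨∅, isCompact_empty, Set.empty_subset _, fun _ _ => rfl⟩

theorem HasCompactSupp.sum {ι : Type*} (s : Finset ι) {f : ι → superFun m V}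
    (hf : ∀ i ∈ s, HasCompactSupp (f i)) : HasCompactSupp (∑ i ∈ s, f i) :=
  Finset.sum_induction _ _ (fun _ _ => HasCompactSupp.add) HasCompactSupp.zero hf

theorem berezinIntegral_add {f g : superFun m V} (hf : HasCompactSupp f) (hg : HasCompactSupp g) :
    berezinIntegral (f + g).1 = berezinIntegral f.1 + berezinIntegral g.1 := by
  rw [berezinIntegral, berezinIntegral, berezinIntegral, ← integral_add hf.integrable hg.integrable]
  refine setIntegral_congr_fun V.isOpen.measurableSet fun x hx => ?_
  rw [extendZero_apply _ ⟨x, hx⟩, extendZero_apply _ ⟨x, hx⟩, extendZero_apply _ ⟨x, hx⟩]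
  rfl

theorem berezinIntegral_smul (r : ℝ) (f : superFun m V) :
    berezinIntegral (r • f).1 = r * berezinIntegral f.1 := by
  rw [berezinIntegral, berezinIntegral, ← integral_const_mul]
  refine setIntegral_congr_fun V.isOpen.measurableSet fun x hx => ?_
  rw [extendZero_apply _ ⟨x, hx⟩, extendZero_apply _ ⟨x, hx⟩]
  rfl

theorem berezinIntegral_zero : berezinIntegral (0 : superFun m V).1 = 0 := by
  have := berezinIntegral_smul 0 (0 : superFun m V)
  rwa [zero_smul, zero_mul] at this

theorem berezinIntegral_sum {ι : Type*} (s : Finset ι) {f : ι → superFun m V}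
    (hf : ∀ i ∈ s, HasCompactSupp (f i)) :
    berezinIntegral (∑ i ∈ s, f i).1 = ∑ i ∈ s, berezinIntegral (f i).1 := by
  classical
  induction s using Finset.induction_on with
  | empty => exact berezinIntegral_zero
  | insert a s ha ih =>
    rw [Finset.sum_insert ha, Finset.sum_insert ha, berezinIntegral_add (hf a (by simp))
      (HasCompactSupp.sum s fun i hi => hf i (by simp [hi])),
      ih fun i hi => hf i (by simp [hi])]

end Integral

namespace Supermanifold

variable {n m : ℕ} (M : Supermanifold.{u, v} n m)

/-- A total derivative with respect to the coordinates of one chart integrates to zero over another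
chart. -/
theorem berezinIntegral_berPow_mul_trans_pdFun {i j : M.ι} {W : Opens M.X}
    (hW : W ≤ chartDom (M.chart i) ⊓ chartDom (M.chart j)) (b : CoordIndex n m)
    {v : superFun m (chartImage (M.chart j) W)} (hv : HasCompactSupp v) :
    berezinIntegral ((M.berPow hW 1).1 * M.trans i j W hW (pdFun b v)).1 = 0 := by
  have h := fun a => (M.hasCompactSupp_trans hW hv).mul_left
    ((M.berPow hW 1).1 * M.jacInv hW b a)
  rw [M.berPow_mul_trans_pdFun hW, berezinIntegral_sum _ fun a _ => ((h a).pdFun a).smul _]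
  refine Finset.sum_eq_zero fun a _ => ?_
  rw [berezinIntegral_smul, berezinIntegral_pdFun (h a), mul_zero]

end Supermanifold

section ExtensionByZero

variable {n m : ℕ} {V V' : Opens (Fin n → ℝ)}

/-- The extension by zero of a compactly supported superfunction. -/
noncomputable def extendFun (V' : Opens (Fin n → ℝ)) (f : superFun m V) (hf : HasCompactSupp f) :
    superFun m V' :=
  ofContDiffOn (extendZero f.1) hf.contDiff.contDiffOn

theorem extendFun_apply {f : superFun m V} (hf : HasCompactSupp f) (x : V) (hx : x.1 ∈ V') :
    (extendFun V' f hf).1 ⟨x.1, hx⟩ = f.1 x :=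
  extendZero_apply f.1 x

theorem extendFun_eq_zero {f : superFun m V} (hf : HasCompactSupp f) (x : V') (hx : x.1 ∉ V) :
    (extendFun V' f hf).1 x = 0 :=
  extendZero_eq_zero hx

theorem hasCompactSupp_extendFun {f : superFun m V} (hf : HasCompactSupp f) (h : V ≤ V') :
    HasCompactSupp (extendFun V' f hf) := by
  obtain ⟨K, h1, h2, h3⟩ := id hf
  refine ⟨K, h1, h2.trans h, fun x hx => ?_⟩
  by_cases hxV : x.1 ∈ V
  · exact (extendFun_apply hf ⟨x.1, hxV⟩ x.2).trans (h3 _ hx)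
  · exact extendFun_eq_zero hf x hxV

theorem restrictFun_extendFun {f : superFun m V} (hf : HasCompactSupp f) (h : V ≤ V') :
    restrictFun h (extendFun V' f hf) = f :=
  superFun_ext fun x => extendFun_apply hf x (h x.2)

theorem restrictFun_coordFun (h : V' ≤ V) (a : CoordIndex n m) :
    restrictFun h (coordFun V a) = coordFun V' a := by
  cases a <;> rfl

theorem restrictFun_parity (h : V' ≤ V) {p : ZMod 2} {f : superFun m V} (hf : superFunParity p f) :
    superFunParity p (restrictFun h f) := fun x => hf ⟨x.1, h x.2⟩

end ExtensionByZero

namespace Supermanifold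

open Grassmann Filter Topology

variable {n m : ℕ} (M : Supermanifold.{u, v} n m)

/-! ### Densities over open sets -/

section Restriction

variable {i j : M.ι} {W W' : Opens M.X} (hW : W ≤ chartDom (M.chart i) ⊓ chartDom (M.chart j))

theorem jac_restrict (h : W' ≤ W) (a b : CoordIndex n m) :
    restrictFun (chartImage_mono (M.chart i) h) (M.jac hW a b) = M.jac (h.trans hW) a b := by
  rw [jac, ← pdFun_restrictFun, M.trans_restrict i j W hW W' h, restrictFun_coordFun]
  rfl

theorem berPow_restrict (h : W' ≤ W) (w : ℝ) :
    restrictFun (chartImage_mono (M.chart i) h) (M.berPow hW w).1 =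
      (M.berPow (h.trans hW) w).1 := by
  refine superFun_ext fun x => ?_
  have h1 := congrArg Subtype.val (M.evalEven_berPow hW w ⟨x.1, chartImage_mono _ h x.2⟩)
  have h2 := congrArg Subtype.val (M.evalEven_berPow (h.trans hW) w x)
  refine h1.trans (Eq.trans ?_ h2.symm)
  have h3 : evalMatrix (M.jac hW) ⟨x.1, chartImage_mono _ h x.2⟩ =
      evalMatrix (M.jac (h.trans hW)) x := by
    ext1 a b
    exact congrArg (fun f => f.1 x) (M.jac_restrict hW h a b)
  rw [h3]

theorem berPow_self (hii : W ≤ chartDom (M.chart i) ⊓ chartDom (M.chart i)) (w : ℝ) :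
    (M.berPow hii w).1 = 1 := by
  have h := M.berPow_mul_trans hii hii hii w
  rw [M.trans_self] at h
  calc (M.berPow hii w).1 = (M.berPow hii (-w)).1 * (M.berPow hii w).1 * (M.berPow hii w).1 := by
        rw [M.berPow_neg_mul, one_mul]
    _ = 1 := by rw [mul_assoc, h, M.berPow_neg_mul]

end Restriction

theorem overlap_le (i j : M.ι) : M.overlap i j ≤ chartDom (M.chart i) ⊓ chartDom (M.chart j) :=
  le_rfl

variable {M} in
theorem le_overlap {i j : M.ι} {W : Opens M.X}
    (hW : W ≤ chartDom (M.chart i) ⊓ chartDom (M.chart j)) : W ≤ M.overlap i j := hW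

theorem jacobian_eq (i j : M.ι) (x : chartImage (M.chart i) (M.overlap i j)) :
    M.jacobian i j x = evalMatrix (M.jac (M.overlap_le i j)) x := by
  ext1 a b
  rw [jacobian, change, restrictFun_coordFun]
  rfl

/-- The compatibility of the coordinate expressions of a density over any open set contained in two
charts. -/
theorem density_restrict {w : ℝ} {ψ : M.Family} (hψ : ψ ∈ M.densities w) {i j : M.ι}
    {W : Opens M.X} (hW : W ≤ chartDom (M.chart i) ⊓ chartDom (M.chart j)) :
    restrictFun (M.chartImage_le_domain i W) (ψ i) =
      (M.berPow hW w).1 * M.trans i j W hW (restrictFun (M.chartImage_le_domain j W) (ψ j)) := by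
  have h1 : restrictFun (M.chartImage_le_domain i (M.overlap i j)) (ψ i) =
      (M.berPow (M.overlap_le i j) w).1 * M.change i j (ψ j) := by
    refine superFun_ext fun x => (hψ i j x).trans ?_
    rw [M.jacobian_eq, ← M.evalEven_berPow]
    rfl
  have h2 := congrArg (restrictFun (chartImage_mono (M.chart i) (le_overlap hW))) h1
  rw [map_mul, M.berPow_restrict (M.overlap_le i j) (le_overlap hW), change, M.trans_restrict i j _ (M.overlap_le i j) W hW] at h2
  exact h2

theorem mem_densities_of_local {w : ℝ} {ψ : M.Family}
    (h : ∀ i j, ∀ p ∈ M.overlap i j, ∃ W : Opens M.X, p ∈ W ∧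
      ∃ hW : W ≤ chartDom (M.chart i) ⊓ chartDom (M.chart j),
        restrictFun (M.chartImage_le_domain i W) (ψ i) = (M.berPow hW w).1 *
          M.trans i j W hW (restrictFun (M.chartImage_le_domain j W) (ψ j))) :
    ψ ∈ M.densities w := by
  intro i j x
  obtain ⟨W, hp, hW, h1⟩ := h i j _ x.2.2
  have h2 := congrArg (fun f => f.1 ⟨x.1, x.2.1, hp⟩) h1
  refine h2.trans ?_
  rw [M.jacobian_eq, ← M.evalEven_berPow]
  have h3 := M.berPow_restrict (M.overlap_le i j) (le_overlap hW) w
  have h4 := M.trans_restrict i j _ (M.overlap_le i j) W hW (restrictFun (M.chartImage_le_domain j _) (ψ j))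
  exact congrArg₂ (· * ·) (congrArg (fun f => f.1 ⟨x.1, x.2.1, hp⟩) h3.symm)
    (congrArg (fun f => f.1 ⟨x.1, x.2.1, hp⟩) h4.symm)

variable {M}

/-- A density that vanishes outside a chart is determined by its expression in this chart. -/
theorem density_ext_chart {w : ℝ} {ψ χ : M.densities w} (i : M.ι) (h : ψ.1 i = χ.1 i)
    (h' : ∀ j (y : M.domain j), (M.chart j).symm y.1 ∉ (M.chart i).source →
      (ψ.1 j).1 y = (χ.1 j).1 y) : ψ = χ := by
  refine Subtype.ext (funext fun j => superFun_ext fun y => ?_)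
  by_cases hy : (M.chart j).symm y.1 ∈ (M.chart i).source
  · have h1 := M.density_restrict ψ.2 (M.overlap_le j i)
    have h2 := M.density_restrict χ.2 (M.overlap_le j i)
    rw [h, ← h2] at h1
    exact congrArg (fun f => f.1 ⟨y.1, y.2, (M.chart j).map_target y.2, hy⟩) h1
  · exact h' j y hy

/-! ### Densities supported in a chart -/

section Extension

variable {i : M.ι} (w : ℝ) (f : superFun m (M.domain i))

open Classical in
/-- The coordinate expressions of the extension by zero of `f (Dx_i)^w`. -/
noncomputable def extCoord (j : M.ι) (y : M.domain j) : Grassmann m :=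
  if h : (M.chart j).symm y.1 ∈ (M.chart i).source then
    ((M.berPow (M.overlap_le j i) w).1 * M.change j i f).1
      ⟨y.1, y.2, (M.chart j).map_target y.2, h⟩
  else 0

variable {f}

theorem extCoord_eq_zero {K : Set (Fin n → ℝ)} (hK : IsCompact K) (hKd : K ⊆ M.domain i)
    (hf : ∀ x : M.domain i, x.1 ∉ K → f.1 x = 0) (j : M.ι) (y : M.domain j)
    (hy : (M.chart j).symm y.1 ∉ (M.chart i).symm '' K) : extCoord w f j y = 0 := by
  rw [extCoord]
  split_ifs with h
  · have hc : IsClosed ((M.chart i).symm '' K) :=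
      (hK.image_of_continuousOn ((M.chart i).continuousOn_symm.mono hKd)).isClosed
    have h1 := M.trans_apply_eq_zero (M.overlap_le j i)
      (W' := M.overlap j i ⊓ ⟨((M.chart i).symm '' K)ᶜ, hc.isOpen_compl⟩) inf_le_left
      (f := restrictFun (M.chartImage_le_domain i _) f)
      ⟨y.1, y.2, (M.chart j).map_target y.2, h⟩ ⟨⟨(M.chart j).map_target y.2, h⟩, hy⟩
      fun z hz => hf _ fun hzK => hz.2 ⟨_, hzK, rfl⟩
    change _ * (M.trans j i (M.overlap j i) _ _).1 _ = 0
    rw [h1, mul_zero]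
  · rfl

theorem extCoord_mem (hf : HasCompactSupp f) (j : M.ι) :
    extCoord w f j ∈ superFun m (M.domain j) := by
  obtain ⟨K, hK, hKd, hfK⟩ := hf
  have hc : IsClosed ((M.chart i).symm '' K) :=
    (hK.image_of_continuousOn ((M.chart i).continuousOn_symm.mono hKd)).isClosed
  refine mem_superFun_of_local fun y => ?_
  by_cases h : (M.chart j).symm y.1 ∈ (M.chart i).source
  · let F := (M.berPow (M.overlap_le j i) w).1 * M.change j i f
    have hy : y.1 ∈ chartImage (M.chart j) (M.overlap j i) := ⟨y.2, (M.chart j).map_target y.2, h⟩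
    refine ⟨extendZero F.1, contDiffAt_extendZero F ⟨y.1, hy⟩, ?_⟩
    filter_upwards [(chartImage (M.chart j) (M.overlap j i)).isOpen.mem_nhds hy] with z hz hzd
    rw [extendZero_apply F.1 ⟨z, hz⟩]
    exact dif_pos hz.2.2
  · refine ⟨fun _ => 0, contDiffAt_const, ?_⟩
    have hy : y.1 ∈ chartImage (M.chart j) ⟨((M.chart i).symm '' K)ᶜ, hc.isOpen_compl⟩ := by
      refine ⟨y.2, ?_⟩
      rintro ⟨x, hx, hxy⟩
      exact h (hxy ▸ (M.chart i).map_target (hKd hx))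
    filter_upwards [(chartImage (M.chart j) _).isOpen.mem_nhds hy] with z hz hzd
    exact extCoord_eq_zero w hK hKd hfK j ⟨z, hzd⟩ hz.2

variable (f) in
/-- The coordinate expressions as superfunctions. -/
noncomputable def extFamily (hf : HasCompactSupp f) : M.Family :=
  fun j => ⟨extCoord w f j, extCoord_mem w hf j⟩

theorem extFamily_restrict (hf : HasCompactSupp f) {j : M.ι} {W : Opens M.X}
    (hW : W ≤ chartDom (M.chart j) ⊓ chartDom (M.chart i)) :
    restrictFun (M.chartImage_le_domain j W) (extFamily w f hf j) = (M.berPow hW w).1 *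
      M.trans j i W hW (restrictFun (M.chartImage_le_domain i W) f) := by
  refine superFun_ext fun y => ?_
  have h2 := M.berPow_restrict (M.overlap_le j i) (le_overlap hW) w
  have h3 := M.trans_restrict j i (M.overlap j i) (M.overlap_le j i) W hW
    (restrictFun (M.chartImage_le_domain i _) f)
  have h4 : extCoord w f j ⟨y.1, y.2.1⟩ = _ := dif_pos (hW y.2.2).2
  refine h4.trans ?_
  exact congrArg₂ (· * ·) (congrArg (fun f => f.1 y) h2) (congrArg (fun f => f.1 y) h3)

theorem extFamily_mem (hf : HasCompactSupp f) : extFamily w f hf ∈ M.densities w := by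
  obtain ⟨K, hK, hKd, hfK⟩ := id hf
  have hc : IsClosed ((M.chart i).symm '' K) :=
    (hK.image_of_continuousOn ((M.chart i).continuousOn_symm.mono hKd)).isClosed
  refine M.mem_densities_of_local fun j k p hp => ?_
  by_cases h : p ∈ (M.chart i).source
  · have hjk : M.overlap j k ⊓ chartDom (M.chart i) ≤
        chartDom (M.chart j) ⊓ chartDom (M.chart k) := inf_le_left
    have hji : M.overlap j k ⊓ chartDom (M.chart i) ≤
        chartDom (M.chart j) ⊓ chartDom (M.chart i) := inf_le_inf_right _ inf_le_left
    have hki : M.overlap j k ⊓ chartDom (M.chart i) ≤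
        chartDom (M.chart k) ⊓ chartDom (M.chart i) := inf_le_inf_right _ inf_le_right
    refine ⟨M.overlap j k ⊓ chartDom (M.chart i), ⟨hp, h⟩, hjk, ?_⟩
    rw [extFamily_restrict w hf hji, extFamily_restrict w hf hki, map_mul, ← mul_assoc,
      M.berPow_mul_trans hjk hki hji, M.trans_trans]
  · refine ⟨M.overlap j k ⊓ ⟨((M.chart i).symm '' K)ᶜ, hc.isOpen_compl⟩, ⟨hp, ?_⟩,
      inf_le_left, ?_⟩
    · rintro ⟨x, hx, rfl⟩
      exact h ((M.chart i).map_target (hKd hx))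
    · have hz : ∀ l, restrictFun (M.chartImage_le_domain l
          (M.overlap j k ⊓ ⟨((M.chart i).symm '' K)ᶜ, hc.isOpen_compl⟩)) (extFamily w f hf l) = 0 :=
        fun l => superFun_ext fun y => extCoord_eq_zero w hK hKd hfK l ⟨y.1, y.2.1⟩ y.2.2.2
      rw [hz, hz, map_zero, mul_zero]

variable (f) in
/-- The extension by zero of `f (Dx_i)^w`, where `f` has compact support. -/
noncomputable def extDensity (hf : HasCompactSupp f) : M.densities w :=
  ⟨extFamily w f hf, extFamily_mem w hf⟩

theorem extDensity_coord (hf : HasCompactSupp f) : (extDensity w f hf).1 i = f := by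
  have h := extFamily_restrict w hf (j := i) (W := chartDom (M.chart i)) (le_inf le_rfl le_rfl)
  rw [M.berPow_self, one_mul, M.trans_self] at h
  exact superFun_ext fun y => congrArg (fun f => f.1 ⟨y.1, y.2, (M.chart i).map_target y.2⟩) h

theorem extDensity_support (hf : HasCompactSupp f) : ∃ K : Set M.X, IsCompact K ∧
    K ⊆ (M.chart i).source ∧ ∀ (j : M.ι) (y : M.domain j), (M.chart j).symm y.1 ∉ K →
      ((extDensity w f hf).1 j).1 y = 0 := by
  obtain ⟨K, hK, hKd, hfK⟩ := id hf
  refine ⟨_, hK.image_of_continuousOn ((M.chart i).continuousOn_symm.mono hKd), ?_,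
    extCoord_eq_zero w hK hKd hfK⟩
  rintro _ ⟨x, hx, rfl⟩
  exact (M.chart i).map_target (hKd hx)

theorem extDensity_eq_zero (hf : HasCompactSupp f) (j : M.ι) (y : M.domain j)
    (hy : (M.chart j).symm y.1 ∉ (M.chart i).source) : ((extDensity w f hf).1 j).1 y = 0 :=
  dif_neg hy

theorem extDensity_parity (hf : HasCompactSupp f) {p : ZMod 2} (hp : superFunParity p f) (j : M.ι) :
    superFunParity p ((extDensity w f hf).1 j) := by
  intro y
  change extCoord w f j y ∈ _
  rw [extCoord]
  split_ifs
  · have := mul_parity (M.berPow_parity (M.overlap_le j i) w)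
      (M.trans_parity j i _ le_rfl p _ (restrictFun_parity (M.chartImage_le_domain i _) hp))
    rw [zero_add] at this
    exact this _
  · exact Submodule.zero_mem _

end Extension

end Supermanifold

namespace Supermanifold

open Grassmann Filter Topology

variable {n m : ℕ} {M : Supermanifold.{u, v} n m}

/-! ### The algebra of densities -/

/-- The coordinate expression in the chart `i`, as a homomorphism of algebras. -/
noncomputable def coordHom (i : M.ι) : M.DensityAlgebra →ₐ[ℝ] superFun m (M.domain i) where
  toFun Ψ := DirectSum.coeLinearMap M.densities Ψ i
  map_one' := congrFun (map_one (DirectSum.coeAlgHom M.densities)) i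
  map_mul' Ψ Φ := congrFun (map_mul (DirectSum.coeAlgHom M.densities) Ψ Φ) i
  map_zero' := congrFun (map_zero (DirectSum.coeAlgHom M.densities)) i
  map_add' Ψ Φ := congrFun (map_add (DirectSum.coeAlgHom M.densities) Ψ Φ) i
  commutes' r := congrFun ((DirectSum.coeAlgHom M.densities).commutes r) i

theorem coord_eq (i : M.ι) (Ψ : M.DensityAlgebra) : coord i Ψ = (coordHom i Ψ).1 := rfl

theorem coordHom_ofWeight (i : M.ι) (w : ℝ) (ψ : M.densities w) :
    coordHom i (ofWeight w ψ) = ψ.1 i :=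
  congrFun (DirectSum.coeLinearMap_lof M.densities w ψ) i

/-- The product of two densities. -/
noncomputable def densityMul {w w' : ℝ} (ψ : M.densities w) (χ : M.densities w') :
    M.densities (w + w') :=
  ⟨ψ.1 * χ.1, SetLike.GradedMonoid.toGradedMul.mul_mem ψ.2 χ.2⟩

theorem ofWeight_mul {w w' : ℝ} (ψ : M.densities w) (χ : M.densities w') :
    ofWeight w ψ * ofWeight w' χ = ofWeight (w + w') (densityMul ψ χ) :=
  DirectSum.of_mul_of (A := fun w => M.densities w) ψ χ

theorem ofWeight_congr {w w' : ℝ} (h : w = w') {ψ : M.densities w} {χ : M.densities w'}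
    (hψ : ψ.1 = χ.1) : ofWeight w ψ = ofWeight w' χ := by
  subst h
  rw [Subtype.ext hψ]

/-- A density of weight `w`, regarded as a density of the equal weight `w'`. -/
def densityCast {w w' : ℝ} (h : w = w') (ψ : M.densities w) : M.densities w' := ⟨ψ.1, h ▸ ψ.2⟩

theorem ofWeight_densityCast {w w' : ℝ} (h : w = w') (ψ : M.densities w) :
    ofWeight w' (densityCast h ψ) = ofWeight w ψ :=
  ofWeight_congr h.symm rfl

/-- The function `1` as a density of weight zero. -/
noncomputable def oneDensity (M : Supermanifold.{u, v} n m) : M.densities 0 :=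
  ⟨1, SetLike.GradedOne.one_mem⟩

theorem ofWeight_one : ofWeight 0 (oneDensity M) = 1 := rfl

theorem component_ofWeight (w : ℝ) (ψ : M.densities w) : component w (ofWeight w ψ) = ψ :=
  DirectSum.component.lof_self (R := ℝ) (M := fun w => M.densities w) w ψ

theorem component_ofWeight_of_ne {w w' : ℝ} (h : w ≠ w') (ψ : M.densities w) :
    component w' (ofWeight w ψ) = 0 := by
  refine (DirectSum.component.of (R := ℝ) (M := fun w => M.densities w) w' w ψ).trans ?_
  rw [dif_neg h]

theorem sum_ofWeight_component (Ψ : M.DensityAlgebra) : ∃ s : Finset ℝ,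
    ∑ w ∈ s, ofWeight w (component w Ψ) = Ψ := by
  classical
  exact ⟨_, DirectSum.sum_support_of (β := fun w => M.densities w) Ψ⟩

theorem density_induction {C : M.DensityAlgebra → Prop} (h0 : C 0)
    (hadd : ∀ Ψ Φ, C Ψ → C Φ → C (Ψ + Φ)) (hof : ∀ w ψ, C (ofWeight w ψ)) (Ψ : M.DensityAlgebra) :
    C Ψ := by
  obtain ⟨s, hs⟩ := sum_ofWeight_component Ψ
  rw [← hs]
  exact Finset.sum_induction _ C hadd h0 fun w _ => hof w _

theorem hasParity_induction {p : ZMod 2} {C : M.DensityAlgebra → Prop} (h0 : C 0)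
    (hadd : ∀ Ψ Φ, C Ψ → C Φ → C (Ψ + Φ))
    (hof : ∀ w (ψ : M.densities w), (∀ i, superFunParity p (ψ.1 i)) → C (ofWeight w ψ))
    {Ψ : M.DensityAlgebra} (hΨ : HasParity p Ψ) : C Ψ := by
  obtain ⟨s, hs⟩ := sum_ofWeight_component Ψ
  rw [← hs]
  exact Finset.sum_induction _ C hadd h0 fun w _ => hof w _ (hΨ w)

theorem hasParity_zero (p : ZMod 2) : HasParity p (0 : M.DensityAlgebra) := fun w i => by
  rw [map_zero]; exact zero_parity p

theorem HasParity.add {p : ZMod 2} {Ψ Φ : M.DensityAlgebra} (hΨ : HasParity p Ψ)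
    (hΦ : HasParity p Φ) : HasParity p (Ψ + Φ) := fun w i => by
  rw [map_add]; exact add_parity (hΨ w i) (hΦ w i)

theorem HasParity.smul {p : ZMod 2} (r : ℝ) {Ψ : M.DensityAlgebra} (hΨ : HasParity p Ψ) :
    HasParity p (r • Ψ) := fun w i => by
  rw [map_smul]; exact smul_parity r (hΨ w i)

theorem HasParity.sub {p : ZMod 2} {Ψ Φ : M.DensityAlgebra} (hΨ : HasParity p Ψ)
    (hΦ : HasParity p Φ) : HasParity p (Ψ - Φ) := by
  rw [sub_eq_add_neg, ← neg_one_smul ℝ Φ]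
  exact hΨ.add (hΦ.smul _)

theorem hasParity_ofWeight {p : ZMod 2} {w : ℝ} {ψ : M.densities w}
    (hψ : ∀ i, superFunParity p (ψ.1 i)) : HasParity p (ofWeight w ψ) := by
  intro w' i
  by_cases h : w = w'
  · subst h
    rw [component_ofWeight]
    exact hψ i
  · rw [component_ofWeight_of_ne h]
    exact zero_parity p

theorem hasParity_one : HasParity 0 (1 : M.DensityAlgebra) :=
  hasParity_ofWeight (ψ := oneDensity M) fun _ => one_parity

theorem HasParity.mul {p q : ZMod 2} {Ψ Φ : M.DensityAlgebra} (hΨ : HasParity p Ψ)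
    (hΦ : HasParity q Φ) : HasParity (p + q) (Ψ * Φ) := by
  refine hasParity_induction (C := fun Ψ => HasParity (p + q) (Ψ * Φ)) ?_ ?_ ?_ hΨ
  · rw [zero_mul]; exact hasParity_zero _
  · intro Ψ Ψ' h h'
    rw [add_mul]; exact h.add h'
  intro w ψ hψ
  refine hasParity_induction (C := fun Φ => HasParity (p + q) (ofWeight w ψ * Φ)) ?_ ?_ ?_ hΦ
  · rw [mul_zero]; exact hasParity_zero _
  · intro Ψ Ψ' h h'
    rw [mul_add]; exact h.add h'
  intro w' χ hχ
  rw [ofWeight_mul]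
  exact hasParity_ofWeight fun i => mul_parity (hψ i) (hχ i)

theorem HasParity.coordHom {p : ZMod 2} {Ψ : M.DensityAlgebra} (hΨ : HasParity p Ψ) (i : M.ι) :
    superFunParity p (coordHom i Ψ) := by
  refine hasParity_induction (C := fun Ψ => superFunParity p (Supermanifold.coordHom i Ψ)) ?_ ?_ ?_
    hΨ
  · rw [map_zero]; exact zero_parity p
  · intro Ψ Φ h h'
    rw [map_add]; exact add_parity h h'
  · intro w ψ hψ
    rw [coordHom_ofWeight]; exact hψ i

/-- The algebra of densities is supercommutative. -/
theorem HasParity.mul_comm {p q : ZMod 2} {Ψ Φ : M.DensityAlgebra} (hΨ : HasParity p Ψ)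
    (hΦ : HasParity q Φ) : Ψ * Φ = koszul p q • (Φ * Ψ) := by
  refine hasParity_induction (C := fun Ψ => Ψ * Φ = koszul p q • (Φ * Ψ)) ?_ ?_ ?_ hΨ
  · rw [zero_mul, mul_zero, smul_zero]
  · intro Ψ Ψ' h h'
    rw [add_mul, mul_add, h, h', smul_add]
  intro w ψ hψ
  refine hasParity_induction
    (C := fun Φ => ofWeight w ψ * Φ = koszul p q • (Φ * ofWeight w ψ)) ?_ ?_ ?_ hΦ
  · rw [zero_mul, mul_zero, smul_zero]
  · intro Ψ Ψ' h h'
    rw [add_mul, mul_add, h, h', smul_add]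
  intro w' χ hχ
  rw [ofWeight_mul, ofWeight_mul, ← map_smul]
  exact ofWeight_congr (add_comm w w') (funext fun i => mul_comm_of_parity (hψ i) (hχ i))

/-- The parity automorphism on densities of weight `w`. -/
noncomputable def twistDensity (p : ZMod 2) (w : ℝ) : M.densities w →ₗ[ℝ] M.densities w where
  toFun ψ := ⟨fun i => twistFun p (ψ.1 i), M.mem_densities_of_local fun i j x hx =>
    ⟨M.overlap i j, hx, M.overlap_le i j, by
      have h := congrArg (twistFun p) (M.density_restrict ψ.2 (M.overlap_le i j))
      rw [map_mul, twistFun_of_parity (M.berPow_parity _ w), koszul_zero_right, one_smul,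
        ← M.trans_twistFun] at h
      exact h⟩⟩
  map_add' ψ χ := Subtype.ext (funext fun i => map_add (twistFun p) (ψ.1 i) (χ.1 i))
  map_smul' r ψ := Subtype.ext (funext fun i => map_smul (twistFun p) r (ψ.1 i))

/-- The parity automorphism `Ψ ↦ (-1)^{p Ψ̃} Ψ` of the algebra of densities. -/
noncomputable def sigma (p : ZMod 2) : M.DensityAlgebra →ₗ[ℝ] M.DensityAlgebra :=
  DirectSum.lmap (twistDensity p)

theorem sigma_ofWeight (p : ZMod 2) (w : ℝ) (ψ : M.densities w) :
    sigma p (ofWeight w ψ) = ofWeight w (twistDensity p w ψ) :=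
  DirectSum.lmap_lof (R := ℝ) (twistDensity (M := M) p) w ψ

theorem sigma_of_hasParity {p q : ZMod 2} {Ψ : M.DensityAlgebra} (hΨ : HasParity q Ψ) :
    sigma p Ψ = koszul p q • Ψ := by
  refine hasParity_induction (C := fun Ψ => sigma p Ψ = koszul p q • Ψ) ?_ ?_ ?_ hΨ
  · rw [map_zero, smul_zero]
  · intro Ψ Φ h h'
    rw [map_add, h, h', smul_add]
  · intro w ψ hψ
    rw [sigma_ofWeight, ← map_smul]
    exact congrArg _ (Subtype.ext (funext fun i => twistFun_of_parity (hψ i)))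

theorem exists_parts (w : ℝ) (ψ : M.densities w) : ∃ ψ₀ ψ₁ : M.densities w,
    (∀ i, superFunParity 0 (ψ₀.1 i)) ∧ (∀ i, superFunParity 1 (ψ₁.1 i)) ∧ ψ = ψ₀ + ψ₁ := by
  refine ⟨(1 / 2 : ℝ) • (ψ + koszul 1 0 • twistDensity 1 w ψ),
    (1 / 2 : ℝ) • (ψ + koszul 1 1 • twistDensity 1 w ψ), fun i => partFun_parity 0 (ψ.1 i),
    fun i => partFun_parity 1 (ψ.1 i), ?_⟩
  rw [koszul_zero_right, koszul_one_one]
  module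

/-- To prove an additive property of all elements, it suffices to consider densities that are
homogeneous with respect to the weight and the parity. -/
theorem homogeneous_induction {C : M.DensityAlgebra → Prop} (h0 : C 0)
    (hadd : ∀ Ψ Φ, C Ψ → C Φ → C (Ψ + Φ))
    (hof : ∀ p w (ψ : M.densities w), (∀ i, superFunParity p (ψ.1 i)) → C (ofWeight w ψ))
    (Ψ : M.DensityAlgebra) : C Ψ := by
  refine density_induction h0 hadd (fun w ψ => ?_) Ψ
  obtain ⟨ψ₀, ψ₁, h1, h2, rfl⟩ := exists_parts w ψ
  rw [map_add]
  exact hadd _ _ (hof 0 w ψ₀ h1) (hof 1 w ψ₁ h2)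

theorem parity_induction {C : M.DensityAlgebra → Prop} (hadd : ∀ Ψ Φ, C Ψ → C Φ → C (Ψ + Φ))
    (hof : ∀ p Ψ, HasParity p Ψ → C Ψ) (Ψ : M.DensityAlgebra) : C Ψ :=
  homogeneous_induction (hof 0 0 (hasParity_zero 0)) hadd
    (fun p _ _ h => hof p _ (hasParity_ofWeight h)) Ψ

/-! ### The bracket of a second-order operator -/

section GeneratedBracket

variable {ε : ZMod 2}

theorem superComm_apply (p q : ZMod 2) (T : Operator M) (f g : M.DensityAlgebra) :
    superComm p q T f g = T (f * g) - koszul p q • (f * T g) := rfl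

/-- The bracket `Δ(fg) - (Δf) g - (-1)^{ε f̃} f (Δg) + Δ(1) f g`. -/
noncomputable def generatedBracket (ε : ZMod 2) (Δ : Operator M) : BilinearOperation M :=
  LinearMap.mk₂ ℝ (fun f g => Δ (f * g) - Δ f * g - sigma ε f * Δ g + Δ 1 * f * g)
    (fun f f' g => by simp only [add_mul, mul_add, map_add]; abel)
    (fun r f g => by
      simp only [smul_mul_assoc, mul_smul_comm, map_smul, smul_sub, smul_add])
    (fun f g g' => by simp only [mul_add, map_add]; abel)
    (fun r f g => by
      simp only [mul_smul_comm, map_smul, smul_sub, smul_add])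

theorem generatedBracket_apply (Δ : Operator M) (f g : M.DensityAlgebra) :
    generatedBracket ε Δ f g = Δ (f * g) - Δ f * g - sigma ε f * Δ g + Δ 1 * f * g := rfl

theorem generates_generatedBracket (Δ : Operator M) : Generates ε Δ (generatedBracket ε Δ) := by
  intro p f g hf
  rw [generatedBracket_apply, sigma_of_hasParity hf, smul_mul_assoc]

theorem Generates.unique {Δ : Operator M} {B B' : BilinearOperation M} (h : Generates ε Δ B)
    (h' : Generates ε Δ B') : B' = B :=
  LinearMap.ext fun f => parity_induction (C := fun f => B' f = B f)
    (fun Ψ Φ h1 h2 => by rw [map_add, map_add, h1, h2])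
    (fun p f hf => LinearMap.ext fun g => by rw [h' p f g hf, h p f g hf]) f

theorem isBracket_generatedBracket {Δ : Operator M} (hΔ : IsSecondOrder ε Δ) :
    IsBracket ε (generatedBracket ε Δ) := by
  have h1 : HasParity ε (Δ 1) := by simpa using hΔ.1 0 1 hasParity_one
  have hpar : ∀ p q f g, HasParity p f → HasParity q g →
      HasParity (ε + p + q) (generatedBracket ε Δ f g) := by
    intro p q f g hf hg
    rw [generates_generatedBracket Δ p f g hf]
    refine HasParity.add (HasParity.sub (HasParity.sub ?_ ((hΔ.1 p f hf).mul hg))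
      (HasParity.smul _ ?_)) ((h1.mul hf).mul hg)
    · rw [add_assoc]; exact hΔ.1 _ _ (hf.mul hg)
    · have := hf.mul (hΔ.1 q g hg)
      rwa [show p + (ε + q) = ε + p + q by ring] at this
  -- a double commutator commutes with multiplications, so it is the multiplication by its value at 1
  have hT : ∀ p q f g, HasParity p f → HasParity q g →
      superComm (ε + p) q (superComm ε p Δ f) g 1 = generatedBracket ε Δ f g := by
    intro p q f g hf hg
    rw [generates_generatedBracket Δ p f g hf, superComm_apply, superComm_apply, superComm_apply,
      mul_one, mul_one, mul_sub, mul_smul_comm, smul_sub, (hΔ.1 p f hf).mul_comm hg, smul_smul,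
      ← mul_assoc, (hg.mul hf).mul_comm h1, ← mul_assoc, mul_assoc _ g f, hg.mul_comm hf,
      mul_smul_comm, smul_smul, smul_smul]
    have e : koszul (ε + p) q * koszul ε p * koszul (q + p) ε * koszul q p = 1 := by
      rcases zmod_two_cases p with rfl | rfl <;> rcases zmod_two_cases q with rfl | rfl <;>
        rcases zmod_two_cases ε with rfl | rfl <;>
        simp [koszul_zero_left, koszul_zero_right, koszul_one_one, koszul_add_left]
    rw [← mul_assoc] at *
    rw [e, one_smul, mul_assoc]
    abel
  have hmul : ∀ p q r f g h, HasParity p f → HasParity q g → HasParity r h →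
      superComm (ε + p) q (superComm ε p Δ f) g h = generatedBracket ε Δ f g * h := by
    intro p q r f g h hf hg hh
    have h3 := congrArg (fun T : Operator M => T 1) (hΔ.2 p q r f g h hf hg hh)
    rw [(hpar p q f g hf hg).mul_comm hh, ← hT p q f g hf hg]
    refine Eq.trans ?_ (sub_eq_zero.1 h3)
    change _ = superComm (ε + p) q (superComm ε p Δ f) g (h * 1)
    rw [mul_one]
  refine ⟨hpar, ?_, ?_⟩
  · intro p q f g hf hg
    rw [generates_generatedBracket Δ p f g hf, generates_generatedBracket Δ q g f hg,
      hf.mul_comm hg, map_smul, (hΔ.1 p f hf).mul_comm hg, hf.mul_comm (hΔ.1 q g hg), mul_assoc,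
      hf.mul_comm hg, mul_smul_comm, smul_smul, mul_assoc, smul_add, smul_sub, smul_sub, smul_smul]
    have e1 : koszul ε p * koszul p (ε + q) = koszul p q := by
      rw [koszul_add_right, ← mul_assoc, koszul_comm p ε, koszul_mul_self, one_mul]
    have e2 : koszul (ε + p) q = koszul p q * koszul ε q := by
      rw [koszul_add_left, mul_comm]
    rw [e1, e2]
    abel
  · intro p q f g h hf hg
    refine parity_induction (C := fun h => generatedBracket ε Δ f (g * h) =
      generatedBracket ε Δ f g * h + koszul (ε + p) q • (g * generatedBracket ε Δ f h))
      (fun Ψ Φ h1 h2 => ?_) (fun r h hh => ?_) h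
    · simp only [mul_add, map_add, smul_add, h1, h2]
      abel
    · have e1 := hT p (q + r) f (g * h) hf (hg.mul hh)
      have e2 := hmul p q r f g h hf hg hh
      have e3 := hT p r f h hf hh
      rw [superComm_apply, mul_one] at e1 e3
      rw [superComm_apply] at e2
      rw [← e1, ← e2, ← e3, mul_sub, mul_smul_comm, smul_sub, smul_smul, koszul_add_right,
        ← mul_assoc]
      abel

end GeneratedBracket

end Supermanifold

namespace Supermanifold

open Grassmann Filter Topology

variable {n m : ℕ} {M : Supermanifold.{u, v} n m} {ε : ZMod 2}

/-- The bracket generated by an operator of weight `l` has weight `l`. For the continuity, a family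
`ψ_w` with a fixed coordinate expression is multiplied by a density `χ` of weight `w'`: this is again
such a family, with the weight shifted by `w'`. -/
theorem bracketHasWeight_generatedBracket {Δ : Operator M} {l : ℝ} (hl : OperatorHasWeight l Δ) :
    BracketHasWeight l (generatedBracket ε Δ) := by
  obtain ⟨φ₁, h₁⟩ := hl.1 0 (oneDensity M)
  rw [ofWeight_one] at h₁
  refine ⟨fun w w' ψ χ => ?_, fun i f ψ hψ Φ x => ?_⟩
  · obtain ⟨φ₂, h₂⟩ := hl.1 (w + w') (densityMul ψ χ)
    obtain ⟨φ₃, h₃⟩ := hl.1 w ψ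
    obtain ⟨φ₄, h₄⟩ := hl.1 w' χ
    refine ⟨φ₂ - densityCast (by ring) (densityMul φ₃ χ) -
      densityCast (by ring) (densityMul (twistDensity ε w ψ) φ₄) +
      densityCast (by ring) (densityMul (densityMul φ₁ ψ) χ), ?_⟩
    rw [generatedBracket_apply, sigma_ofWeight, h₁, h₃, h₄, ofWeight_mul, h₂, ofWeight_mul,
      ofWeight_mul, ofWeight_mul, ofWeight_mul, map_add, map_sub, map_sub, ofWeight_densityCast,
      ofWeight_densityCast, ofWeight_densityCast]
  · refine density_induction
      (C := fun Φ => Continuous fun w => coord i (generatedBracket ε Δ (ofWeight w (ψ w)) Φ) x)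
      ?_ ?_ ?_ Φ
    · simp only [map_zero, coord_eq]
      exact continuous_const
    · intro Φ Φ' h h'
      simp only [map_add, coord_eq] at h h' ⊢
      exact h.add h'
    · intro w' χ
      have c1 : Continuous fun w => coord i (Δ (ofWeight w (ψ w) * ofWeight w' χ)) x := by
        have h5 := (hl.2 i (f * χ.1 i)
          (fun w => densityCast (sub_add_cancel w w') (densityMul (ψ (w - w')) χ))
          (fun w => by rw [← hψ (w - w')]; rfl) x).comp (continuous_add_const w')
        refine h5.congr fun w => ?_
        simp only [Function.comp_apply]
        rw [ofWeight_mul, ofWeight_densityCast]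
        refine congrArg (fun Ψ => coord i (Δ Ψ) x) (ofWeight_congr (by ring) ?_)
        change (ψ (w + w' - w')).1 * χ.1 = (ψ w).1 * χ.1
        rw [add_sub_cancel_right]
      have c2 := hl.2 i f ψ hψ x
      simp only [generatedBracket_apply, coord_eq, map_add, map_sub, map_mul, sigma_ofWeight,
        coordHom_ofWeight] at c1 c2 ⊢
      have h6 : ∀ w, (twistDensity ε w (ψ w)).1 i = twistFun ε f := fun w => by rw [← hψ w]; rfl
      simp only [h6, hψ] at c1 ⊢
      refine ((c1.sub ?_).sub continuous_const).add continuous_const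
      exact (LinearMap.mulRight ℝ ((χ.1 i).1 x)).toContinuousLinearMap.continuous.comp c2

/-- An operator with `Δ 1 = 0` that generates a bracket has order at most two: its double commutators
are the multiplications by brackets. -/
theorem isSecondOrder_of_generates {Δ : Operator M} {B : BilinearOperation M}
    (hB : IsBracket ε B) (hp : ∀ p f, HasParity p f → HasParity (ε + p) (Δ f))
    (hΔ : Generates ε Δ B) (h1 : Δ 1 = 0) : IsSecondOrder ε Δ := by
  have hD : ∀ p f x, HasParity p f → superComm ε p Δ f x = B f x + Δ f * x := by
    intro p f x hf
    rw [hΔ p f x hf, superComm_apply, h1, zero_mul, zero_mul]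
    abel
  have hT : ∀ p q f g x, HasParity p f → HasParity q g →
      superComm (ε + p) q (superComm ε p Δ f) g x = B f g * x := by
    intro p q f g x hf hg
    rw [superComm_apply, hD p f _ hf, hD p f _ hf, hB.2.2 p q f g x hf hg, mul_add, smul_add,
      ← mul_assoc, ← mul_assoc, (hp p f hf).mul_comm hg, smul_mul_assoc]
    abel
  refine ⟨hp, fun p q r f g h hf hg hh => LinearMap.ext fun x => ?_⟩
  rw [superComm_apply, hT p q f g _ hf hg, hT p q f g _ hf hg, ← mul_assoc, ← mul_assoc,
    (hB.1 p q f g hf hg).mul_comm hh, smul_mul_assoc, sub_self]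
  rfl

end Supermanifold

open Grassmann Filter Topology

section Cutoffs

variable {n m : ℕ} {V : Opens (Fin n → ℝ)}

/-- A cut-off function that equals `1` near `x` and vanishes outside a given neighbourhood. -/
theorem exists_cutoff (m : ℕ) (x : V) {U : Set (Fin n → ℝ)} (hU : U ∈ 𝓝 x.1) :
    ∃ H : superFun m V, superFunParity 0 H ∧ HasCompactSupp H ∧
      (∀ᶠ y in 𝓝 x.1, ∀ hy : y ∈ V, H.1 ⟨y, hy⟩ = 1) ∧ ∀ y : V, y.1 ∉ U → H.1 y = 0 := by
  obtain ⟨O, hO, hOo, hxO⟩ := mem_nhds_iff.1 hU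
  obtain ⟨b, hb⟩ := exists_contDiffBump (V := V ⊓ ⟨O, hOo⟩) ⟨x.1, x.2, hxO⟩
  refine ⟨ofReal b b.contDiff.contDiffOn, ofReal_parity _ _,
    hasCompactSupp_ofReal b.contDiff b.hasCompactSupport ?_, ?_, fun y hy => ?_⟩
  · rw [b.tsupport_eq]
    exact fun y hy => (hb hy).1
  · filter_upwards [b.eventuallyEq_one] with y hy hyV
    rw [ofReal_apply, hy, Pi.one_apply, one_smul]
  · have h : b y.1 = 0 := image_eq_zero_of_notMem_tsupport (by
      rw [b.tsupport_eq]
      exact fun h => hy (hO (hb h).2))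
    rw [ofReal_apply, h, zero_smul]

theorem eq_zero_of_parity {q : ZMod 2} {f : superFun m V} (h : superFunParity q f)
    (h' : superFunParity (q + 1) f) : f = 0 := by
  have h1 := (twistFun_of_parity (p := 1) h).symm.trans (twistFun_of_parity h')
  rw [koszul_add_right, koszul_one_one, mul_neg_one, neg_smul, eq_neg_iff_add_eq_zero,
    ← add_smul] at h1
  refine (smul_eq_zero.1 h1).resolve_left ?_
  rcases zmod_two_cases q with rfl | rfl <;> simp [koszul_zero_right, koszul_one_one]

theorem pd_mul_cutoff {H : superFun m V} {x : V}
    (hH : ∀ᶠ y in 𝓝 x.1, ∀ hy : y ∈ V, H.1 ⟨y, hy⟩ = 1) (f : superFun m V) (a : CoordIndex n m) :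
    pd a (H * f).1 x = pd a f.1 x := by
  refine pd_congr a x.2 x.2 ?_
  filter_upwards [hH] with y hy hy1 hy2
  change H.1 ⟨y, hy1⟩ * f.1 ⟨y, hy1⟩ = _
  rw [hy hy1, one_mul]

theorem mul_cutoff_apply {H : superFun m V} {x : V}
    (hH : ∀ᶠ y in 𝓝 x.1, ∀ hy : y ∈ V, H.1 ⟨y, hy⟩ = 1) (f : superFun m V) :
    (H * f).1 x = f.1 x := by
  change H.1 ⟨x.1, x.2⟩ * f.1 x = _
  rw [hH.self_of_nhds x.2, one_mul]

end Cutoffs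

namespace Supermanifold

variable {n m : ℕ} {M : Supermanifold.{u, v} n m}

section ExtensionAlgebra

variable {i : M.ι}

theorem extDensity_add (w : ℝ) {f g : superFun m (M.domain i)} (hf : HasCompactSupp f)
    (hg : HasCompactSupp g) (hfg : HasCompactSupp (f + g)) :
    extDensity w (f + g) hfg = extDensity w f hf + extDensity w g hg := by
  refine density_ext_chart i ?_ fun j y hy => ?_
  · change _ = (extDensity w f hf).1 i + (extDensity w g hg).1 i
    rw [extDensity_coord, extDensity_coord, extDensity_coord]
  · change _ = ((extDensity w f hf).1 j).1 y + ((extDensity w g hg).1 j).1 y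
    rw [extDensity_eq_zero w hfg j y hy, extDensity_eq_zero w hf j y hy,
      extDensity_eq_zero w hg j y hy, add_zero]

theorem extDensity_smul (w r : ℝ) {f : superFun m (M.domain i)} (hf : HasCompactSupp f)
    (hrf : HasCompactSupp (r • f)) : extDensity w (r • f) hrf = r • extDensity w f hf := by
  refine density_ext_chart i ?_ fun j y hy => ?_
  · change _ = r • (extDensity w f hf).1 i
    rw [extDensity_coord, extDensity_coord]
  · change _ = r • ((extDensity w f hf).1 j).1 y
    rw [extDensity_eq_zero w hrf j y hy, extDensity_eq_zero w hf j y hy, smul_zero]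

theorem extDensity_mul (w w' : ℝ) {f : superFun m (M.domain i)} (hf : HasCompactSupp f)
    (χ : M.densities w') (hfχ : HasCompactSupp (f * χ.1 i)) :
    densityMul (extDensity w f hf) χ = extDensity (w + w') (f * χ.1 i) hfχ := by
  refine density_ext_chart i ?_ fun j y hy => ?_
  · change (extDensity w f hf).1 i * χ.1 i = _
    rw [extDensity_coord, extDensity_coord]
  · change ((extDensity w f hf).1 j).1 y * (χ.1 j).1 y = _
    rw [extDensity_eq_zero w hf j y hy, extDensity_eq_zero (w + w') hfχ j y hy, zero_mul]

end ExtensionAlgebra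

/-! ### Brackets in coordinates -/

section Local

variable {ε : ZMod 2} {B : BilinearOperation M} {i : M.ι}

/-- A bracket is local. -/
theorem bracket_eq_zero_of_germ (hB : IsBracket ε B) {p : ZMod 2} {Ψ : M.DensityAlgebra}
    (hΨ : HasParity p Ψ) {w : ℝ} {χ : M.densities w} {x : M.domain i}
    (hχ : ∀ᶠ y in 𝓝 x.1, ∀ hy : y ∈ M.domain i, (χ.1 i).1 ⟨y, hy⟩ = 0) :
    (coordHom i (B Ψ (ofWeight w χ))).1 x = 0 := by
  obtain ⟨h, h0, hc, h1, hU⟩ := exists_cutoff m x hχ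
  have hz : h * χ.1 i = 0 := by
    refine superFun_ext fun y => ?_
    by_cases hy : ∀ hy : y.1 ∈ M.domain i, (χ.1 i).1 ⟨y.1, hy⟩ = 0
    · exact (congrArg (h.1 y * ·) (hy y.2)).trans (mul_zero _)
    · exact (congrArg (· * (χ.1 i).1 y) (hU y hy)).trans (zero_mul _)
  have hE : ofWeight 0 (extDensity 0 h hc) * ofWeight w χ = 0 := by
    rw [ofWeight_mul, extDensity_mul 0 w hc χ (hc.mul_right _), ← map_zero (ofWeight (0 + w))]
    refine congrArg _ (density_ext_chart i ?_ fun j y hy => extDensity_eq_zero _ _ j y hy)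
    rw [extDensity_coord, hz]
    rfl
  have h2 := hB.2.2 p 0 Ψ _ (ofWeight w χ) hΨ
    (hasParity_ofWeight (extDensity_parity 0 hc h0))
  rw [hE, map_zero, koszul_zero_right, one_smul] at h2
  have h3 := congrArg (fun Φ => (coordHom i Φ).1 x) h2
  simp only [map_zero, map_add, map_mul, coordHom_ofWeight, extDensity_coord] at h3
  have h4 : (0 : Grassmann m) = (coordHom i (B Ψ (ofWeight 0 (extDensity 0 h hc)))).1 x *
      (χ.1 i).1 ⟨x.1, x.2⟩ + h.1 ⟨x.1, x.2⟩ * (coordHom i (B Ψ (ofWeight w χ))).1 x := h3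
  rw [hχ.self_of_nhds x.2, h1.self_of_nhds x.2, mul_zero, zero_add, one_mul] at h4
  exact h4.symm

theorem bracket_congr_right (hB : IsBracket ε B) {p : ZMod 2} {Ψ : M.DensityAlgebra}
    (hΨ : HasParity p Ψ) {w : ℝ} {χ χ' : M.densities w} {x : M.domain i}
    (hχ : ∀ᶠ y in 𝓝 x.1, ∀ hy : y ∈ M.domain i, (χ.1 i).1 ⟨y, hy⟩ = (χ'.1 i).1 ⟨y, hy⟩) :
    (coordHom i (B Ψ (ofWeight w χ))).1 x = (coordHom i (B Ψ (ofWeight w χ'))).1 x := by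
  have h := bracket_eq_zero_of_germ hB hΨ (χ := χ - χ') (x := x) (by
    filter_upwards [hχ] with y hy hy'
    exact sub_eq_zero.2 (hy hy'))
  rw [map_sub, map_sub, map_sub] at h
  exact sub_eq_zero.1 h

theorem bracket_congr (hB : IsBracket ε B) {p q : ZMod 2} {w w' : ℝ} {ψ ψ' : M.densities w}
    {χ χ' : M.densities w'} (hψ : ∀ i, superFunParity p (ψ.1 i))
    (hψ' : ∀ i, superFunParity p (ψ'.1 i))
    (hχ' : ∀ i, superFunParity q (χ'.1 i)) {x : M.domain i}
    (h1 : ∀ᶠ y in 𝓝 x.1, ∀ hy : y ∈ M.domain i, (ψ.1 i).1 ⟨y, hy⟩ = (ψ'.1 i).1 ⟨y, hy⟩)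
    (h2 : ∀ᶠ y in 𝓝 x.1, ∀ hy : y ∈ M.domain i, (χ.1 i).1 ⟨y, hy⟩ = (χ'.1 i).1 ⟨y, hy⟩) :
    (coordHom i (B (ofWeight w ψ) (ofWeight w' χ))).1 x =
      (coordHom i (B (ofWeight w ψ') (ofWeight w' χ'))).1 x := by
  rw [bracket_congr_right hB (hasParity_ofWeight hψ) h2,
    hB.2.1 p q _ _ (hasParity_ofWeight hψ) (hasParity_ofWeight hχ'),
    hB.2.1 p q _ _ (hasParity_ofWeight hψ') (hasParity_ofWeight hχ'), map_smul, map_smul]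
  exact congrArg (koszul p q • ·) (bracket_congr_right hB (hasParity_ofWeight hχ') h1)

/-- The density `H f (Dx_i)^w`, where `H` is a cut-off function. -/
noncomputable def testDensity (w : ℝ) {H : superFun m (M.domain i)} (hc : HasCompactSupp H)
    (f : superFun m (M.domain i)) : M.densities w :=
  extDensity w (H * f) (hc.mul_right f)

variable {H : superFun m (M.domain i)} (hc : HasCompactSupp H)

theorem testDensity_coord (w : ℝ) (f : superFun m (M.domain i)) :
    (testDensity w hc f).1 i = H * f := extDensity_coord w _

theorem testDensity_parity (h0 : superFunParity 0 H) (w : ℝ) {q : ZMod 2}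
    {f : superFun m (M.domain i)} (hf : superFunParity q f) (j : M.ι) :
    superFunParity q ((testDensity w hc f).1 j) := by
  refine extDensity_parity w _ ?_ j
  have := mul_parity h0 hf
  rwa [zero_add] at this

theorem testDensity_apply_of_eq_one (w : ℝ) (f : superFun m (M.domain i)) {y : M.domain i}
    (hy : H.1 y = 1) : ((testDensity w hc f).1 i).1 y = f.1 y := by
  rw [testDensity_coord]
  change H.1 y * f.1 y = _
  rw [hy, one_mul]

/-- The operation `f ↦ {Ψ, H f}` at a point where `H = 1`. -/
noncomputable def bracketAtPoint (B : BilinearOperation M) (Ψ : M.DensityAlgebra)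
    (hc : HasCompactSupp H) (x : M.domain i) : superFun m (M.domain i) →ₗ[ℝ] Grassmann m where
  toFun f := (coordHom i (B Ψ (ofWeight 0 (testDensity 0 hc f)))).1 x
  map_add' f g := by
    have : testDensity 0 hc (f + g) = testDensity 0 hc f + testDensity 0 hc g := by
      have h : H * (f + g) = H * f + H * g := mul_add H f g
      simp only [testDensity, h]
      exact extDensity_add 0 _ _ _
    rw [this, map_add, map_add, map_add]
    rfl
  map_smul' r f := by
    have : testDensity 0 hc (r • f) = r • testDensity 0 hc f := by
      have h : H * (r • f) = r • (H * f) := mul_smul_comm r H f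
      simp only [testDensity, h]
      exact extDensity_smul 0 r _ _
    rw [this, map_smul, map_smul, map_smul]
    rfl

/-- The bracket with a fixed element, in coordinates: it is a first-order operator in the second
argument, and its dependence on the weight is additive and continuous, hence linear. -/
theorem bracket_apply_eq {x : M.domain i} (h0 : superFunParity 0 H)
    (hH : ∀ᶠ y in 𝓝 x.1, ∀ hy : y ∈ M.domain i, H.1 ⟨y, hy⟩ = 1) (hB : IsBracket ε B) {l : ℝ} (hl : BracketHasWeight l B) {p : ZMod 2}
    {Ψ : M.DensityAlgebra} (hΨ : HasParity p Ψ) (w : ℝ) (χ : M.densities w) :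
    (coordHom i (B Ψ (ofWeight w χ))).1 x =
      w • ((coordHom i (B Ψ (ofWeight 1 (testDensity 1 hc 1)))).1 x * (χ.1 i).1 x) +
      ∑ a, (coordHom i (B Ψ (ofWeight 0 (testDensity 0 hc (coordFun _ a))))).1 x *
        pd a (χ.1 i).1 x := by
  have hp : ∀ w {q : ZMod 2} {f : superFun m (M.domain i)}, superFunParity q f →
      HasParity q (ofWeight w (testDensity w hc f)) := fun w {q f} hf =>
    hasParity_ofWeight (testDensity_parity hc h0 w hf)
  have hx1 : ∀ w f, ((testDensity w hc f).1 i).1 x = f.1 x := fun w f =>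
    testDensity_apply_of_eq_one hc w f (hH.self_of_nhds x.2)
  -- the Leibniz rule for a homogeneous first factor
  have leib : ∀ {q : ZMod 2} {u v : ℝ} {f g : superFun m (M.domain i)} (ξ : M.densities (u + v)),
      superFunParity q f → (∀ᶠ y in 𝓝 x.1, ∀ hy, (f * g).1 ⟨y, hy⟩ = (ξ.1 i).1 ⟨y, hy⟩) →
      (coordHom i (B Ψ (ofWeight (u + v) ξ))).1 x =
        (coordHom i (B Ψ (ofWeight u (testDensity u hc f)))).1 x * g.1 x + koszul (ε + p) q •
          (f.1 x * (coordHom i (B Ψ (ofWeight v (testDensity v hc g)))).1 x) := by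
    intro q u v f g ξ hf hξ
    have h1 := hB.2.2 p q Ψ _ (ofWeight v (testDensity v hc g)) hΨ (hp u hf)
    rw [ofWeight_mul] at h1
    have h2 := congrArg (fun Φ => (coordHom i Φ).1 x) h1
    simp only [map_add, map_mul, map_smul, coordHom_ofWeight] at h2
    rw [← hx1 v g, ← hx1 u f]
    refine Eq.trans (bracket_congr_right hB hΨ ?_) h2
    filter_upwards [hξ, hH] with y hy hy1 hyd
    rw [← hy hyd]
    change f.1 _ * g.1 _ = ((testDensity u hc f).1 i).1 _ * ((testDensity v hc g).1 i).1 _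
    rw [testDensity_apply_of_eq_one hc u f (hy1 hyd), testDensity_apply_of_eq_one hc v g (hy1 hyd)]
  have hder : ∀ f, (coordHom i (B Ψ (ofWeight 0 (testDensity 0 hc f)))).1 x =
      ∑ a, (coordHom i (B Ψ (ofWeight 0 (testDensity 0 hc (coordFun _ a))))).1 x *
        pd a f.1 x := by
    intro f
    refine twistedDerivation_eq_sum (y := x) (evalFun x) (fun k => ?_) (fun q f => rfl) (ε + p)
      (bracketAtPoint B Ψ hc x) (fun f g => ?_) (fun a => ?_) f
    · change bodyHom m (x.1 k • (1 : Grassmann m)) = _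
      rw [map_smul, map_one (bodyHom m), smul_eq_mul, mul_one]
    · have hq : ∀ (q : ZMod 2) (f : superFun m (M.domain i)), superFunParity q f →
          bracketAtPoint B Ψ hc x (f * g) = bracketAtPoint B Ψ hc x f * evalFun x g +
            twist (ε + p) (evalFun x f) * bracketAtPoint B Ψ hc x g := by
        intro q f hf
        rw [evalFun_apply, evalFun_apply, twist_of_parity (hf x), smul_mul_assoc]
        have h3 : testDensity 0 hc (f * g) =
            densityCast (add_zero 0) (densityCast (add_zero 0).symm (testDensity 0 hc (f * g))) :=
          rfl
        change (coordHom i (B Ψ (ofWeight 0 (testDensity 0 hc (f * g))))).1 x = _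
        rw [h3, ofWeight_densityCast]
        refine leib _ hf ?_
        filter_upwards [hH] with y hy hyd
        exact (testDensity_apply_of_eq_one hc 0 (f * g) (hy hyd)).symm
      have hf := partFun_add_partFun f
      rw [← hf, add_mul, map_add, map_add, map_add, map_add, hq 0 _ (partFun_parity 0 f),
        hq 1 _ (partFun_parity 1 f)]
      noncomm_ring
    · have := (hB.1 p _ Ψ _ hΨ (hp 0 (coordFun_parity a))).coordHom i
      exact this x
  have hlin : ∀ u, (coordHom i (B Ψ (ofWeight u (testDensity u hc 1)))).1 x =
      u • (coordHom i (B Ψ (ofWeight 1 (testDensity 1 hc 1)))).1 x := by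
    intro u
    have hadd : ∀ u v, (coordHom i (B Ψ (ofWeight (u + v) (testDensity (u + v) hc 1)))).1 x =
        (coordHom i (B Ψ (ofWeight u (testDensity u hc 1)))).1 x +
        (coordHom i (B Ψ (ofWeight v (testDensity v hc 1)))).1 x := by
      intro u v
      rw [leib (testDensity (u + v) hc 1) one_parity (g := 1) (by
        filter_upwards [hH] with y hy hyd
        rw [mul_one]
        exact (testDensity_apply_of_eq_one hc (u + v) 1 (hy hyd)).symm), koszul_zero_right, one_smul]
      change _ * (1 : Grassmann m) + (1 : Grassmann m) * _ = _
      rw [mul_one, one_mul]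
    let F : ℝ →+ Grassmann m := AddMonoidHom.mk'
      (fun u => (coordHom i (B Ψ (ofWeight u (testDensity u hc 1)))).1 x) hadd
    have hF : Continuous F := by
      refine (hl.2 i (H * 1) (fun u => testDensity u hc 1) (fun u => testDensity_coord hc u 1)
        Ψ x).congr fun u => ?_
      change _ = (coordHom i (B Ψ (ofWeight u (testDensity u hc 1)))).1 x
      rw [hB.2.1 p 0 Ψ _ hΨ (hp u one_parity), koszul_zero_right, one_smul]
      rfl
    have := map_real_smul F hF u 1
    rwa [smul_eq_mul, mul_one] at this
  have h5 : χ = densityCast (add_zero w) (densityCast (add_zero w).symm χ) := rfl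
  rw [h5, ofWeight_densityCast, leib (f := 1) (g := χ.1 i) _ one_parity (by
    filter_upwards with y hyd
    rw [one_mul]
    rfl), koszul_zero_right, one_smul, hlin w, hder]
  change _ + (1 : Grassmann m) * _ = _
  rw [one_mul, smul_mul_assoc]
  rfl

end Local

end Supermanifold

namespace Supermanifold

open Grassmann Filter Topology

variable {n m : ℕ} {M : Supermanifold.{u, v} n m} {ε : ZMod 2} {B : BilinearOperation M} {i : M.ι}

/-! ### The coordinate data of a bracket -/

/-- Brackets of test densities, with a cut-off function that depends on the point, are smooth. -/
theorem bracket_testDensity_mem (hB : IsBracket ε B)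
    {H : M.domain i → superFun m (M.domain i)} (h0 : ∀ x, superFunParity 0 (H x))
    (hc : ∀ x, HasCompactSupp (H x))
    (hH : ∀ x : M.domain i, ∀ᶠ y in 𝓝 x.1, ∀ hy : y ∈ M.domain i, (H x).1 ⟨y, hy⟩ = 1)
    (w w' : ℝ) {p q : ZMod 2} {f g : superFun m (M.domain i)} (hf : superFunParity p f)
    (hg : superFunParity q g) :
    (fun x => (coordHom i (B (ofWeight w (testDensity w (hc x) f))
      (ofWeight w' (testDensity w' (hc x) g)))).1 x) ∈ superFun m (M.domain i) := by
  refine mem_superFun_of_local fun x => ⟨_, contDiffAt_extendZero (coordHom i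
    (B (ofWeight w (testDensity w (hc x) f)) (ofWeight w' (testDensity w' (hc x) g)))) x, ?_⟩
  filter_upwards [(hH x).eventually_nhds] with z hz hzd
  rw [extendZero_apply _ ⟨z, hzd⟩]
  have h := fun u (k : superFun m (M.domain i)) => (hH ⟨z, hzd⟩).and hz |>.mono fun y hy hyd =>
    (testDensity_apply_of_eq_one (hc ⟨z, hzd⟩) u k (hy.1 hyd)).trans
      (testDensity_apply_of_eq_one (hc x) u k (hy.2 hyd)).symm
  exact bracket_congr hB (testDensity_parity _ (h0 _) w hf) (testDensity_parity _ (h0 _) w hf)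
    (testDensity_parity _ (h0 _) w' hg) (h w f) (h w' g)

/-- A density whose expression in the chart `i` has parity `p` is the sum of a density of parity `p`
and of a density of the opposite parity that vanishes in the chart `i`. -/
theorem exists_parity_part (i : M.ι) {p : ZMod 2} {w : ℝ} {ψ : M.densities w}
    (hψ : superFunParity p (ψ.1 i)) : ∃ ψ' ψ'' : M.densities w, ψ = ψ' + ψ'' ∧
      (∀ j, superFunParity p (ψ'.1 j)) ∧ (∀ j, superFunParity (p + 1) (ψ''.1 j)) ∧
      ψ'.1 i = ψ.1 i ∧ ψ''.1 i = 0 := by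
  obtain ⟨ψ₀, ψ₁, h0, h1, rfl⟩ := exists_parts w ψ
  have key : ∀ ψ' ψ'' : M.densities w, ψ₀ + ψ₁ = ψ' + ψ'' → (∀ j, superFunParity p (ψ'.1 j)) →
      (∀ j, superFunParity (p + 1) (ψ''.1 j)) → ∃ ψ' ψ'' : M.densities w, ψ₀ + ψ₁ = ψ' + ψ'' ∧
      (∀ j, superFunParity p (ψ'.1 j)) ∧ (∀ j, superFunParity (p + 1) (ψ''.1 j)) ∧
      ψ'.1 i = (ψ₀ + ψ₁).1 i ∧ ψ''.1 i = 0 := by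
    intro ψ' ψ'' h hp' hp''
    rw [h] at hψ
    have hs : (ψ' + ψ'').1 i = ψ'.1 i + ψ''.1 i := rfl
    have hz : ψ''.1 i = 0 := by
      refine eq_zero_of_parity ?_ (hp'' i)
      have := add_parity hψ (smul_parity (-1) (hp' i))
      rwa [hs, neg_one_smul, add_assoc, add_comm, add_assoc, neg_add_cancel, add_zero] at this
    exact ⟨ψ', ψ'', h, hp', hp'', by rw [h, hs, hz, add_zero], hz⟩
  rcases zmod_two_cases p with rfl | rfl
  · exact key ψ₀ ψ₁ rfl h0 h1
  · exact key ψ₁ ψ₀ (add_comm _ _) h1 h0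

theorem exists_bracketData (hB : IsBracket ε B) {l : ℝ} (hl : BracketHasWeight l B) (i : M.ι) :
    ∃ D : BracketData m (M.domain i), D.IsSymmetric ε ∧ D.Represents B := by
  choose H h0 hc hH using fun x : M.domain i => exists_cutoff m x Filter.univ_mem
  have hH1 := fun x => (hH x).1
  have hp : ∀ x w {q : ZMod 2} {f : superFun m (M.domain i)}, superFunParity q f →
      HasParity q (ofWeight w (testDensity w (hc x) f)) := fun x w {q f} hf =>
    hasParity_ofWeight (testDensity_parity (hc x) (h0 x) w hf)
  let D : BracketData m (M.domain i) :=
    { S := fun a b => ⟨_, bracket_testDensity_mem hB h0 hc hH1 0 0 (coordFun_parity a)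
        (coordFun_parity b)⟩
      γ := fun a => ⟨_, bracket_testDensity_mem hB h0 hc hH1 0 1 (coordFun_parity a) one_parity⟩
      θ := ⟨_, bracket_testDensity_mem hB h0 hc hH1 1 1 one_parity one_parity⟩ }
  have hrep : ∀ (p : ZMod 2) (w w' : ℝ) (ψ : M.densities w) (χ : M.densities w'),
      (∀ j, superFunParity p (ψ.1 j)) → ∀ x,
      (coordHom i (B (ofWeight w ψ) (ofWeight w' χ))).1 x =
        D.bracket p w w' (ψ.1 i).1 (χ.1 i).1 x := by
    intro p w w' ψ χ hψ x
    have hψ' := hasParity_ofWeight hψ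
    have hswap : ∀ {q u f}, superFunParity q f →
        (coordHom i (B (ofWeight w ψ) (ofWeight u (testDensity u (hc x) f)))).1 x =
        koszul p q • (coordHom i (B (ofWeight u (testDensity u (hc x) f)) (ofWeight w ψ))).1 x := by
      intro q u f hf
      rw [hB.2.1 p q _ _ hψ' (hp x u hf), map_smul]
      rfl
    have hγ : ∀ a, (coordHom i (B (ofWeight 1 (testDensity 1 (hc x) 1))
        (ofWeight 0 (testDensity 0 (hc x) (coordFun _ a))))).1 x = (D.γ a).1 x := by
      intro a
      rw [hB.2.1 0 _ _ _ (hp x 1 one_parity) (hp x 0 (coordFun_parity a)), koszul_zero_left,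
        one_smul]
    rw [bracket_apply_eq (hc x) (h0 x) (hH1 x) hB hl hψ' w' χ, hswap one_parity, koszul_zero_right,
      one_smul, bracket_apply_eq (hc x) (h0 x) (hH1 x) hB hl (hp x 1 one_parity) w ψ]
    simp only [hγ]
    have hS : ∀ a, (coordHom i (B (ofWeight w ψ)
        (ofWeight 0 (testDensity 0 (hc x) (coordFun _ a))))).1 x =
        koszul (coordParity a) p • (w • ((D.γ a).1 x * (ψ.1 i).1 x) +
          ∑ b, (D.S a b).1 x * pd b (ψ.1 i).1 x) := by
      intro a
      rw [hswap (coordFun_parity a), bracket_apply_eq (hc x) (h0 x) (hH1 x) hB hl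
        (hp x 0 (coordFun_parity a)) w ψ, koszul_comm]
    simp only [hS]
    change w' • ((w • (D.θ.1 x * (ψ.1 i).1 x) + _) * (χ.1 i).1 x) + _ = _
    rw [BracketData.bracket]
    have hk : ∀ a : CoordIndex n m,
        koszul (coordParity a) p * w = w * koszul (coordParity a) p := fun a => mul_comm _ _
    have hw : w' * w = w * w' := mul_comm _ _
    simp only [add_mul, smul_mul_assoc, smul_add, Finset.sum_mul, Finset.sum_add_distrib,
      Finset.smul_sum, smul_smul, hk, hw]
    abel
  refine ⟨D, ⟨fun a b x => ?_, fun a b => superFun_ext fun x => ?_, fun a x => ?_, fun x => ?_⟩,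
    fun p w w' ψ χ hψ x => ?_⟩
  · exact (hB.1 _ _ _ _ (hp x 0 (coordFun_parity a)) (hp x 0 (coordFun_parity b))).coordHom i x
  · change (coordHom i (B _ _)).1 x = koszul _ _ • (coordHom i (B _ _)).1 x
    rw [hB.2.1 _ _ _ _ (hp x 0 (coordFun_parity a)) (hp x 0 (coordFun_parity b)), map_smul]
    rfl
  · have := (hB.1 _ _ _ _ (hp x 0 (coordFun_parity a)) (hp x 1 one_parity)).coordHom i x
    rwa [add_zero] at this
  · have := (hB.1 _ _ _ _ (hp x 1 one_parity) (hp x 1 one_parity)).coordHom i x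
    rwa [add_zero, add_zero] at this
  · obtain ⟨ψ', ψ'', rfl, hp', hp'', h1, h2⟩ := exists_parity_part i hψ
    rw [map_add, map_add, LinearMap.add_apply, coord_eq, map_add]
    change (coordHom i _).1 x + (coordHom i _).1 x = _
    rw [hrep p w w' ψ' χ hp' x, hrep (p + 1) w w' ψ'' χ hp'' x, ← h1, h2]
    have hz : ∀ b, pd b (0 : M.domain i → Grassmann m) x = 0 := fun b =>
      congrArg (fun g : superFun m (M.domain i) => g.1 x) (map_zero (pdFun b))
    simp [BracketData.bracket, hz, -Fintype.sum_sum_type]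

/-- The data of a bracket are the brackets of test densities. -/
theorem BracketData.Represents.unique {D D' : BracketData m (M.domain i)} (hD : D.IsSymmetric ε)
    (hD' : D'.IsSymmetric ε) (h : D.Represents B) (h' : D'.Represents B) : D' = D := by
  have key : ∀ x : M.domain i, ∃ (s : CoordIndex n m → CoordIndex n m → Grassmann m)
      (c : CoordIndex n m → Grassmann m) (t : Grassmann m), ∀ D : BracketData m (M.domain i),
      D.IsSymmetric ε → D.Represents B →
        (∀ a b, (D.S a b).1 x = s a b) ∧ (∀ a, (D.γ a).1 x = c a) ∧ D.θ.1 x = t := by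
    intro x
    obtain ⟨H, h0, hc, hH, -⟩ := exists_cutoff m x Filter.univ_mem
    have h1 : ∀ a b, pd a (H * coordFun (M.domain i) b).1 x = if a = b then 1 else 0 := by
      intro a b
      rw [pd_mul_cutoff hH]
      have := congrArg (fun g => g.1 x) (pdFun_coordFun (V := M.domain i) a b)
      refine this.trans ?_
      split_ifs <;> rfl
    have h2 : ∀ a, pd a (H * 1).1 x = 0 := by
      intro a
      rw [pd_mul_cutoff hH]
      exact congrArg (fun g => g.1 x) (pdFun_one (V := M.domain i) a)
    have h3 : (H * 1).1 x = 1 := mul_cutoff_apply hH 1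
    have hpx : ∀ a, superFunParity (coordParity a) (H * coordFun (M.domain i) a) := fun a => by
      have := mul_parity h0 (coordFun_parity (V := M.domain i) a)
      rwa [zero_add] at this
    have hp1 : superFunParity 0 (H * 1) := by
      have := mul_parity h0 (one_parity (V := M.domain i))
      rwa [zero_add] at this
    refine ⟨fun a b => coord i (B (ofWeight 0 (testDensity 0 hc (coordFun _ a)))
        (ofWeight 0 (testDensity 0 hc (coordFun _ b)))) x,
      fun a => coord i (B (ofWeight 0 (testDensity 0 hc (coordFun _ a)))
        (ofWeight 1 (testDensity 1 hc 1))) x,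
      coord i (B (ofWeight 1 (testDensity 1 hc 1)) (ofWeight 1 (testDensity 1 hc 1))) x,
      fun D hD h => ⟨fun a b => Eq.symm ?_, fun a => Eq.symm ?_, Eq.symm ?_⟩⟩
    · refine (h (coordParity a) 0 0 (testDensity 0 hc (coordFun _ a))
        (testDensity 0 hc (coordFun _ b)) (by rw [testDensity_coord]; exact hpx a) x).trans ?_
      rw [testDensity_coord, testDensity_coord, hD.2.1 a b, koszul_comm]
      simp only [BracketData.bracket, h1]
      simp [-Fintype.sum_sum_type]
    · refine (h (coordParity a) 0 1 (testDensity 0 hc (coordFun _ a))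
        (testDensity 1 hc 1) (by rw [testDensity_coord]; exact hpx a) x).trans ?_
      rw [testDensity_coord, testDensity_coord]
      simp only [BracketData.bracket, h1, h2, h3]
      simp [-Fintype.sum_sum_type]
    · refine (h 0 1 1 (testDensity 1 hc 1)
        (testDensity 1 hc 1) (by rw [testDensity_coord]; exact hp1) x).trans ?_
      rw [testDensity_coord]
      simp only [BracketData.bracket, h2, h3]
      simp [-Fintype.sum_sum_type]
  choose s c t hk using key
  obtain ⟨S, γ, θ⟩ := D
  obtain ⟨S', γ', θ'⟩ := D'
  congr 1
  · funext a b
    exact superFun_ext fun x => ((hk x _ hD' h').1 a b).trans ((hk x _ hD h).1 a b).symm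
  · funext a
    exact superFun_ext fun x => ((hk x _ hD' h').2.1 a).trans ((hk x _ hD h).2.1 a).symm
  · exact superFun_ext fun x => (hk x _ hD' h').2.2.trans (hk x _ hD h).2.2.symm

end Supermanifold

namespace Supermanifold

open Grassmann Filter Topology

/-! ### The canonical operator in coordinates -/

namespace BracketData

variable {n m : ℕ} {V : Opens (Fin n → ℝ)} (D : BracketData m V) (ε : ZMod 2) (l w : ℝ)

/-- The vector density `S^{ab} ∂_b f + w γ^a f`, whose divergence is the main part of the canonical
operator. -/
noncomputable def flux (a : CoordIndex n m) : superFun m V →ₗ[ℝ] superFun m V :=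
  ∑ b, (LinearMap.mulLeft ℝ (D.S a b)).comp (pdFun b) + w • LinearMap.mulLeft ℝ (D.γ a)

theorem flux_apply (a : CoordIndex n m) (f : superFun m V) :
    D.flux w a f = ∑ b, D.S a b * pdFun b f + w • (D.γ a * f) := by
  simp [flux, LinearMap.sum_apply, -Fintype.sum_sum_type]

/-- The operator `γ^a ∂_a f + w θ f`. -/
noncomputable def drift : superFun m V →ₗ[ℝ] superFun m V :=
  ∑ a, (LinearMap.mulLeft ℝ (D.γ a)).comp (pdFun a) + w • LinearMap.mulLeft ℝ D.θ

theorem drift_apply (f : superFun m V) :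
    D.drift w f = ∑ a, D.γ a * pdFun a f + w • (D.θ * f) := by
  simp [drift, LinearMap.sum_apply, -Fintype.sum_sum_type]

/-- The canonical operator of weight `l` on densities of weight `w`, as one half of the divergence of
the flux minus `(1 - w - l)` times the drift; `1 - w - l` is the weight of the densities that are
paired with the result. -/
noncomputable def op : superFun m V →ₗ[ℝ] superFun m V :=
  (1 / 2 : ℝ) • (∑ a, koszul (coordParity a) (ε + 1) • (pdFun a).comp (D.flux w a) -
    (1 - w - l) • D.drift w)

theorem op_apply (f : superFun m V) :
    D.op ε l w f = (1 / 2 : ℝ) • (∑ a, koszul (coordParity a) (ε + 1) • pdFun a (D.flux w a f) -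
      (1 - w - l) • D.drift w f) := by
  simp [op, LinearMap.sum_apply, -Fintype.sum_sum_type]

/-- The bracket as a superfunction. -/
noncomputable def bracketFun (p : ZMod 2) (w' : ℝ) (f g : superFun m V) : superFun m V :=
  ∑ a, koszul (coordParity a) p • (D.flux w a f * pdFun a g) + w' • (D.drift w f * g)

theorem bracketFun_apply (p : ZMod 2) (w' : ℝ) (f g : superFun m V) (x : V) :
    (D.bracketFun w p w' f g).1 x = D.bracket p w w' f.1 g.1 x := by
  have h : (D.bracketFun w p w' f g).1 x = ∑ a, koszul (coordParity a) p •
      ((D.flux w a f).1 x * pd a g.1 x) + w' • ((D.drift w f).1 x * g.1 x) := by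
    rw [← evalFun_apply, bracketFun, map_add, map_sum, map_smul]
    rfl
  have h1 : ∀ a, (D.flux w a f).1 x = ∑ b, (D.S a b).1 x * pd b f.1 x +
      w • ((D.γ a).1 x * f.1 x) := by
    intro a
    rw [← evalFun_apply, flux_apply, map_add, map_sum, map_smul]
    rfl
  have h2 : (D.drift w f).1 x = ∑ a, (D.γ a).1 x * pd a f.1 x + w • (D.θ.1 x * f.1 x) := by
    rw [← evalFun_apply, drift_apply, map_add, map_sum, map_smul]
    rfl
  rw [h, bracket, h2]
  have hk : ∀ a : CoordIndex n m,
      koszul (coordParity a) p * w = w * koszul (coordParity a) p := fun a => mul_comm _ _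
  have hw : w' * w = w * w' := mul_comm _ _
  simp only [h1, add_mul, smul_mul_assoc, smul_add, Finset.sum_mul, Finset.sum_add_distrib,
    Finset.smul_sum, smul_smul, hk, hw]
  abel

variable {D ε}

theorem IsSymmetric.flux_parity (hD : D.IsSymmetric ε) {p : ZMod 2} {f : superFun m V}
    (hf : superFunParity p f) (a : CoordIndex n m) :
    superFunParity (ε + coordParity a + p) (D.flux w a f) := by
  rw [flux_apply]
  refine add_parity (sum_parity _ fun b _ => ?_) (smul_parity _ (mul_parity (hD.2.2.1 a) hf))
  have := mul_parity (hD.1 a b) (pdFun_parity b hf)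
  rwa [show ε + coordParity a + coordParity b + (coordParity b + p) = ε + coordParity a + p by
    have : coordParity b + coordParity b = 0 := CharTwo.add_self_eq_zero _
    linear_combination this] at this

theorem IsSymmetric.drift_parity (hD : D.IsSymmetric ε) {p : ZMod 2} {f : superFun m V}
    (hf : superFunParity p f) : superFunParity (ε + p) (D.drift w f) := by
  rw [drift_apply]
  refine add_parity (sum_parity _ fun b _ => ?_) (smul_parity _ (mul_parity hD.2.2.2 hf))
  have := mul_parity (hD.2.2.1 b) (pdFun_parity b hf)
  rwa [show ε + coordParity b + (coordParity b + p) = ε + p by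
    have : coordParity b + coordParity b = 0 := CharTwo.add_self_eq_zero _
    linear_combination this] at this

theorem IsSymmetric.op_parity (hD : D.IsSymmetric ε) {p : ZMod 2} {f : superFun m V}
    (hf : superFunParity p f) : superFunParity (ε + p) (D.op ε l w f) := by
  rw [op_apply, sub_eq_add_neg, ← neg_smul]
  refine smul_parity _ (add_parity (sum_parity _ fun a _ => smul_parity _ ?_)
    (smul_parity _ (hD.drift_parity w hf)))
  have := pdFun_parity a (hD.flux_parity w hf a)
  rwa [show coordParity a + (ε + coordParity a + p) = ε + p by
    have : coordParity a + coordParity a = 0 := CharTwo.add_self_eq_zero _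
    linear_combination this] at this

/-- Integration by parts: the canonical operator is dual to minus one half of the bracket. -/
theorem IsSymmetric.op_mul (hD : D.IsSymmetric ε) {p : ZMod 2} {f : superFun m V}
    (hf : superFunParity p f) (g : superFun m V) :
    D.op ε l w f * g = (1 / 2 : ℝ) • (∑ a, koszul (coordParity a) (ε + 1) •
      pdFun a (D.flux w a f * g) - D.bracketFun w p (1 - w - l) f g) := by
  have h : ∀ a, koszul (coordParity a) (ε + 1) • pdFun a (D.flux w a f * g) =
      koszul (coordParity a) (ε + 1) • (pdFun a (D.flux w a f) * g) +
      koszul (coordParity a) p • (D.flux w a f * pdFun a g) := by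
    intro a
    rw [pdFun_mul_of_parity a (hD.flux_parity w hf a), smul_add, smul_smul]
    congr 2
    generalize coordParity a = r
    rcases zmod_two_cases p with rfl | rfl <;> rcases zmod_two_cases ε with rfl | rfl <;>
      rcases zmod_two_cases r with rfl | rfl <;>
      simp [koszul_zero_left, koszul_zero_right, koszul_one_one, koszul_add_right]
  rw [op_apply, bracketFun, Finset.sum_congr rfl fun a _ => h a, Finset.sum_add_distrib,
    smul_mul_assoc, sub_mul, smul_mul_assoc, Finset.sum_mul]
  simp only [smul_mul_assoc]
  congr 1
  abel

variable (D ε)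

theorem op_one : D.op ε l 0 1 = 0 := by
  have h1 : ∀ a, D.flux 0 a 1 = 0 := fun a => by simp [flux_apply, pdFun_one]
  have h2 : D.drift 0 1 = 0 := by simp [drift_apply, pdFun_one]
  rw [op_apply, h2, Finset.sum_eq_zero fun a _ => by rw [h1, map_zero, smul_zero], smul_zero,
    sub_zero, smul_zero]

theorem continuous_op (f : superFun m V) (x : V) : Continuous fun w => (D.op ε l w f).1 x := by
  have h : ∀ w, (D.op ε l w f).1 x = (1 / 2 : ℝ) • (∑ a, koszul (coordParity a) (ε + 1) •
      ((pdFun a (∑ b, D.S a b * pdFun b f)).1 x + w • (pdFun a (D.γ a * f)).1 x) -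
      (1 - w - l) • ((∑ a, D.γ a * pdFun a f).1 x + w • (D.θ * f).1 x)) := by
    intro w
    rw [← evalFun_apply, op_apply, map_smul, map_sub, map_sum, map_smul, drift_apply]
    simp only [flux_apply, map_add, map_smul]
    rfl
  simp only [h]
  fun_prop

theorem hasCompactSupp_op {f : superFun m V} (hf : HasCompactSupp f) :
    HasCompactSupp (D.op ε l w f) := by
  have h1 : ∀ a, HasCompactSupp (D.flux w a f) := fun a => by
    rw [flux_apply]
    exact (HasCompactSupp.sum _ fun b _ => (hf.pdFun b).mul_left _).add ((hf.mul_left _).smul _)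
  rw [op_apply, sub_eq_add_neg, ← neg_smul, drift_apply]
  exact ((HasCompactSupp.sum _ fun a _ => ((h1 a).pdFun a).smul _).add
    (((HasCompactSupp.sum _ fun b _ => (hf.pdFun b).mul_left _).add
      ((hf.mul_left _).smul _)).smul _)).smul _

theorem hasCompactSupp_flux_mul {f g : superFun m V} (h : HasCompactSupp f ∨ HasCompactSupp g)
    (a : CoordIndex n m) : HasCompactSupp (D.flux w a f * g) := by
  rcases h with hf | hg
  · rw [flux_apply]
    exact ((HasCompactSupp.sum _ fun b _ => (hf.pdFun b).mul_left _).add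
      ((hf.mul_left _).smul _)).mul_right _
  · exact hg.mul_left _

theorem hasCompactSupp_bracketFun {p : ZMod 2} {w' : ℝ} {f g : superFun m V}
    (hf : HasCompactSupp f) : HasCompactSupp (D.bracketFun w p w' f g) := by
  have h1 : ∀ a, HasCompactSupp (D.flux w a f) := fun a => by
    rw [flux_apply]
    exact (HasCompactSupp.sum _ fun b _ => (hf.pdFun b).mul_left _).add ((hf.mul_left _).smul _)
  rw [bracketFun, drift_apply]
  exact (HasCompactSupp.sum _ fun a _ => ((h1 a).mul_right _).smul _).add
    ((((HasCompactSupp.sum _ fun b _ => (hf.pdFun b).mul_left _).add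
      ((hf.mul_left _).smul _)).mul_right _).smul _)

/-- For weight zero the canonical operator is the canonical pencil. -/
theorem op_eq_pencil (hD : D.IsSymmetric ε) (f : superFun m V) (x : V) :
    (D.op ε 0 w f).1 x = D.pencil ε w f.1 x := by
  have hS : ∑ a, ∑ b, koszul (coordParity a) (ε + 1) • pdFun a (D.S a b * pdFun b f) =
      ∑ a, ∑ b, D.S a b * pdFun b (pdFun a f) +
      ∑ a, (∑ b, koszul (coordParity b) (ε + 1) • pdFun b (D.S b a)) * pdFun a f := by
    have h1 : ∀ a b, koszul (coordParity a) (ε + 1) • pdFun a (D.S a b * pdFun b f) =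
        D.S b a * pdFun a (pdFun b f) +
        (koszul (coordParity a) (ε + 1) • pdFun a (D.S a b)) * pdFun b f := by
      intro a b
      rw [pdFun_mul_of_parity a (hD.1 a b), smul_add, smul_smul, hD.2.1 b a, smul_mul_assoc,
        smul_mul_assoc, add_comm]
      congr 2
      generalize coordParity a = r
      generalize coordParity b = s
      rcases zmod_two_cases s with rfl | rfl <;> rcases zmod_two_cases ε with rfl | rfl <;>
        rcases zmod_two_cases r with rfl | rfl <;>
        simp [koszul_zero_left, koszul_zero_right, koszul_one_one, koszul_add_right]
    simp only [h1, Finset.sum_add_distrib, Finset.sum_mul]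
    congr 1
    · exact Finset.sum_comm
    · exact Finset.sum_comm
  have hγ : ∀ a, koszul (coordParity a) (ε + 1) • pdFun a (D.γ a * f) =
      (koszul (coordParity a) (ε + 1) • pdFun a (D.γ a)) * f + D.γ a * pdFun a f := by
    intro a
    rw [pdFun_mul_of_parity a (hD.2.2.1 a), smul_add, smul_smul, smul_mul_assoc]
    have : koszul (coordParity a) (ε + 1) * koszul (coordParity a) (ε + coordParity a) = 1 := by
      generalize coordParity a = r
      rcases zmod_two_cases ε with rfl | rfl <;> rcases zmod_two_cases r with rfl | rfl <;>
        simp [koszul_zero_left, koszul_zero_right, koszul_one_one, koszul_add_right]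
    rw [this, one_smul]
  have key : D.op ε 0 w f = (1 / 2 : ℝ) • (
      (∑ a, ∑ b, D.S a b * pdFun b (pdFun a f)) +
      (∑ a, ((∑ b, koszul (coordParity b) (ε + 1) • pdFun b (D.S b a)) +
        (2 * w - 1) • D.γ a) * pdFun a f) +
      w • (∑ a, koszul (coordParity a) (ε + 1) • pdFun a (D.γ a)) * f +
      (w * (w - 1)) • (D.θ * f)) := by
    rw [op_apply, drift_apply]
    congr 1
    simp only [flux_apply, map_add, map_sum, map_smul, smul_add, Finset.smul_sum,
      Finset.sum_add_distrib, add_mul, smul_comm _ w, hγ, hS, smul_mul_assoc, Finset.sum_mul]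
    simp only [← Finset.smul_sum]
    module
  rw [key, ← evalFun_apply, map_smul, map_add, map_add, map_add, map_smul, map_mul (evalFun x),
    map_mul (evalFun x), map_sum, map_sum, map_smul, map_sum]
  simp only [map_sum, map_add, map_mul, map_smul]
  rfl

end BracketData

end Supermanifold

namespace Supermanifold

open Grassmann Filter Topology

variable {n m : ℕ} {M : Supermanifold.{u, v} n m} {ε : ZMod 2} {B : BilinearOperation M} {l : ℝ}

/-! ### The canonical operator on a supermanifold -/

theorem BracketData.Represents.coordHom_eq {i : M.ι} {D : BracketData m (M.domain i)}
    (h : D.Represents B) {p : ZMod 2} {w w' : ℝ} {ψ : M.densities w} (χ : M.densities w')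
    (hψ : superFunParity p (ψ.1 i)) :
    coordHom i (B (ofWeight w ψ) (ofWeight w' χ)) = D.bracketFun w p w' (ψ.1 i) (χ.1 i) :=
  superFun_ext fun x => (h p w w' ψ χ hψ x).trans (D.bracketFun_apply w p w' _ _ x).symm

variable {D : ∀ i, BracketData m (M.domain i)}

/-- The coordinate expressions of the canonical operator agree on overlaps. The difference of the two
expressions over an overlap is orthogonal to every compactly supported test function `g`: the brackets
of `ψ` with the density extending `g` cancel, and what remains are total derivatives in the coordinates
of either chart. -/
theorem op_mem_densities (hl : BracketHasWeight l B)
    (hD : ∀ i, (D i).IsSymmetric ε) (hrep : ∀ i, (D i).Represents B) {p : ZMod 2} {w : ℝ}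
    {ψ : M.densities w} (hψ : ∀ i, superFunParity p (ψ.1 i)) :
    (fun i => (D i).op ε l w (ψ.1 i) : M.Family) ∈ M.densities (w + l) := by
  suffices h : ∀ (i j : M.ι) (W : Opens M.X)
      (hW : W ≤ chartDom (M.chart i) ⊓ chartDom (M.chart j)),
      restrictFun (M.chartImage_le_domain i W) ((D i).op ε l w (ψ.1 i)) =
        (M.berPow hW (w + l)).1 * M.trans i j W hW
          (restrictFun (M.chartImage_le_domain j W) ((D j).op ε l w (ψ.1 j))) from
    M.mem_densities_of_local fun i j z hz =>
      ⟨M.overlap i j, hz, M.overlap_le i j, h i j _ (M.overlap_le i j)⟩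
  intro i j W hW
  have hW' : W ≤ chartDom (M.chart j) ⊓ chartDom (M.chart i) :=
    hW.trans (le_of_eq (inf_comm _ _))
  have hdi := M.chartImage_le_domain i W
  have hdj := M.chartImage_le_domain j W
  rw [← sub_eq_zero]
  refine eq_zero_of_berezinIntegral fun q g _ hg => ?_
  let χ : M.densities (1 - w - l) :=
    extDensity (1 - w - l) (extendFun (M.domain i) g hg) (hasCompactSupp_extendFun hg hdi)
  have hχi : restrictFun hdi (χ.1 i) = g := by
    rw [extDensity_coord, restrictFun_extendFun]
  have hχ := M.density_restrict χ.2 hW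
  have hχj : HasCompactSupp (restrictFun hdj (χ.1 j)) := by
    have h := extFamily_restrict (1 - w - l) (hasCompactSupp_extendFun hg hdi) hW'
    rw [restrictFun_extendFun] at h
    change HasCompactSupp (restrictFun hdj (extFamily (1 - w - l) (extendFun (M.domain i) g hg)
      (hasCompactSupp_extendFun hg hdi) j))
    rw [h]
    exact (M.hasCompactSupp_trans hW' hg).mul_left _
  obtain ⟨φ, hφ⟩ := hl.1 w (1 - w - l) ψ χ
  have hφc : ∀ k, φ.1 k = (D k).bracketFun w p (1 - w - l) (ψ.1 k) (χ.1 k) := fun k => by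
    rw [← (hrep k).coordHom_eq χ (hψ k), hφ, coordHom_ofWeight]
  have hφr : restrictFun hdi (φ.1 i) =
      (M.berPow hW 1).1 * M.trans i j W hW (restrictFun hdj (φ.1 j)) :=
    M.density_restrict (densityCast (show w + (1 - w - l) + l = 1 by ring) φ).2 hW
  have hmul : ∀ k (hdk : chartImage (M.chart k) W ≤ M.domain k),
      restrictFun hdk ((D k).op ε l w (ψ.1 k)) * restrictFun hdk (χ.1 k) =
      (1 / 2 : ℝ) • (∑ a, koszul (coordParity a) (ε + 1) •
        pdFun a (restrictFun hdk ((D k).flux w a (ψ.1 k) * χ.1 k)) - restrictFun hdk (φ.1 k)) := by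
    intro k hdk
    rw [← map_mul, (hD k).op_mul l w (hψ k), ← hφc, map_smul, map_sub, map_sum]
    simp only [map_smul, pdFun_restrictFun]
  set ρ := (M.berPow hW 1).1 with hρ
  have hR : (M.berPow hW (w + l)).1 * M.trans i j W hW (restrictFun hdj ((D j).op ε l w (ψ.1 j))) * g
      = ρ * M.trans i j W hW (restrictFun hdj ((D j).op ε l w (ψ.1 j)) *
        restrictFun hdj (χ.1 j)) := by
    have h1 : ρ = (M.berPow hW (w + l)).1 * (M.berPow hW (1 - w - l)).1 := by
      rw [hρ, show (1 : ℝ) = (w + l) + (1 - w - l) by ring, M.berPow_add]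
      simp only [show w + l + (1 - w - l) - w - l = 1 - w - l by ring]
      rfl
    rw [← hχi, hχ, h1, map_mul, mul_assoc, mul_assoc, ← mul_assoc (M.trans i j W hW _),
      ← even_mul_comm (M.berPow_parity hW (1 - w - l)), mul_assoc]
  have key : (restrictFun hdi ((D i).op ε l w (ψ.1 i)) - (M.berPow hW (w + l)).1 *
      M.trans i j W hW (restrictFun hdj ((D j).op ε l w (ψ.1 j)))) * g =
      ∑ a, (1 / 2 * koszul (coordParity a) (ε + 1)) •
        pdFun a (restrictFun hdi ((D i).flux w a (ψ.1 i) * χ.1 i)) +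
      ∑ a, (-(1 / 2) * koszul (coordParity a) (ε + 1)) • (ρ * M.trans i j W hW
        (pdFun a (restrictFun hdj ((D j).flux w a (ψ.1 j) * χ.1 j)))) := by
    rw [sub_mul, hR, hmul j hdj, map_smul, map_sub, map_sum]
    have h2 := hmul i hdi
    rw [hχi, hφr] at h2
    rw [h2, mul_smul_comm, mul_sub, ← smul_sub, sub_sub_sub_cancel_right, smul_sub, sub_eq_add_neg,
      Finset.smul_sum, Finset.mul_sum, Finset.smul_sum, ← Finset.sum_neg_distrib]
    refine congrArg₂ _ (Finset.sum_congr rfl fun a _ => smul_smul _ _ _)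
      (Finset.sum_congr rfl fun a _ => ?_)
    rw [map_smul, mul_smul_comm, smul_smul, neg_mul, neg_smul]
  have hci : ∀ a, HasCompactSupp (restrictFun hdi ((D i).flux w a (ψ.1 i) * χ.1 i)) := fun a => by
    rw [map_mul, hχi]
    exact hg.mul_left _
  have hcj : ∀ a, HasCompactSupp (restrictFun hdj ((D j).flux w a (ψ.1 j) * χ.1 j)) := fun a => by
    rw [map_mul]
    exact hχj.mul_left _
  have hct : ∀ a, HasCompactSupp (ρ * M.trans i j W hW
      (pdFun a (restrictFun hdj ((D j).flux w a (ψ.1 j) * χ.1 j)))) := fun a =>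
    (M.hasCompactSupp_trans hW ((hcj a).pdFun a)).mul_left _
  rw [key, berezinIntegral_add (HasCompactSupp.sum _ fun a _ => ((hci a).pdFun a).smul _)
    (HasCompactSupp.sum _ fun a _ => (hct a).smul _),
    berezinIntegral_sum _ fun a _ => ((hci a).pdFun a).smul _,
    berezinIntegral_sum _ fun a _ => (hct a).smul _, Finset.sum_eq_zero, Finset.sum_eq_zero, add_zero]
  · intro a _
    rw [berezinIntegral_smul, M.berezinIntegral_berPow_mul_trans_pdFun hW a (hcj a), mul_zero]
  · intro a _
    rw [berezinIntegral_smul, berezinIntegral_pdFun (hci a), mul_zero]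

/-- The canonical operator on densities of weight `w`. -/
noncomputable def opDensity (hl : BracketHasWeight l B)
    (hD : ∀ i, (D i).IsSymmetric ε) (hrep : ∀ i, (D i).Represents B) (w : ℝ) :
    M.densities w →ₗ[ℝ] M.densities (w + l) where
  toFun ψ := ⟨fun i => (D i).op ε l w (ψ.1 i), by
    obtain ⟨ψ₀, ψ₁, h0, h1, rfl⟩ := exists_parts w ψ
    have h := add_mem (op_mem_densities hl hD hrep h0) (op_mem_densities hl hD hrep h1)
    have h' : (fun i => (D i).op ε l w ((ψ₀ + ψ₁).1 i) : M.Family) =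
        (fun i => (D i).op ε l w (ψ₀.1 i) : M.Family) +
          (fun i => (D i).op ε l w (ψ₁.1 i) : M.Family) :=
      funext fun i => map_add ((D i).op ε l w) (ψ₀.1 i) (ψ₁.1 i)
    exact h' ▸ h⟩
  map_add' ψ χ := Subtype.ext (funext fun i => map_add ((D i).op ε l w) (ψ.1 i) (χ.1 i))
  map_smul' r ψ := Subtype.ext (funext fun i => map_smul ((D i).op ε l w) r (ψ.1 i))

/-- The canonical operator. -/
noncomputable def canonicalOperator (hl : BracketHasWeight l B)
    (hD : ∀ i, (D i).IsSymmetric ε) (hrep : ∀ i, (D i).Represents B) : Operator M :=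
  DirectSum.toModule ℝ ℝ M.DensityAlgebra
    fun w => (ofWeight (w + l)).comp (opDensity hl hD hrep w)

section

variable (hl : BracketHasWeight l B)
  (hD : ∀ i, (D i).IsSymmetric ε) (hrep : ∀ i, (D i).Represents B)

theorem canonicalOperator_ofWeight (w : ℝ) (ψ : M.densities w) :
    canonicalOperator hl hD hrep (ofWeight w ψ) = ofWeight (w + l) (opDensity hl hD hrep w ψ) :=
  DirectSum.toModule_lof ℝ (M := fun w => M.densities w) w ψ

theorem opDensity_coord (w : ℝ) (ψ : M.densities w) (i : M.ι) :
    (opDensity hl hD hrep w ψ).1 i = (D i).op ε l w (ψ.1 i) := rfl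

theorem canonicalOperator_hasWeight : OperatorHasWeight l (canonicalOperator hl hD hrep) := by
  refine ⟨fun w ψ => ⟨_, canonicalOperator_ofWeight hl hD hrep w ψ⟩, fun i f ψ hψ x => ?_⟩
  refine ((D i).continuous_op ε l f x).congr fun w => ?_
  rw [canonicalOperator_ofWeight, coord_eq, coordHom_ofWeight, opDensity_coord, hψ]

theorem canonicalOperator_parity {p : ZMod 2} {Ψ : M.DensityAlgebra} (hΨ : HasParity p Ψ) :
    HasParity (ε + p) (canonicalOperator hl hD hrep Ψ) := by
  refine hasParity_induction (C := fun Ψ => HasParity (ε + p) (canonicalOperator hl hD hrep Ψ))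
    ?_ ?_ ?_ hΨ
  · rw [map_zero]; exact hasParity_zero _
  · intro Ψ Φ h h'
    rw [map_add]; exact h.add h'
  · intro w ψ hψ
    rw [canonicalOperator_ofWeight]
    exact hasParity_ofWeight fun i => (hD i).op_parity l w (hψ i)

theorem canonicalOperator_one : canonicalOperator hl hD hrep 1 = 0 := by
  have h : opDensity hl hD hrep 0 (oneDensity M) = 0 :=
    Subtype.ext (funext fun i => (D i).op_one ε l)
  rw [← ofWeight_one, canonicalOperator_ofWeight, h, map_zero]

end

end Supermanifold

open Grassmann Filter Topology

/-! ### Integration on a supermanifold -/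

section CompactSupports

variable {n m : ℕ} {V : Opens (Fin n → ℝ)}

theorem exists_cutoff_of_hasCompactSupp {g : superFun m V} (hg : HasCompactSupp g) :
    ∃ h : superFun m V, superFunParity 0 h ∧ HasCompactSupp h ∧ h * g = g := by
  obtain ⟨K, hK, hKV, hgK⟩ := hg
  obtain ⟨L, hL, hKL, hLV⟩ := exists_compact_between hK V.isOpen hKV
  obtain ⟨F, h1, h2, -⟩ := exists_contMDiffMap_one_nhds_of_subset_interior (n := ⊤)
    (modelWithCornersSelf ℝ (Fin n → ℝ)) hK.isClosed hKL
  have hF : ContDiff ℝ ∞ (F : (Fin n → ℝ) → ℝ) := F.contMDiff.contDiff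
  refine ⟨ofReal F hF.contDiffOn, ofReal_parity _ _, ⟨L, hL, hLV, fun x hx => ?_⟩,
    superFun_ext fun x => ?_⟩
  · rw [ofReal_apply, h2 x.1 hx, zero_smul]
  · change (ofReal F hF.contDiffOn : superFun m V).1 x * g.1 x = g.1 x
    by_cases hx : x.1 ∈ K
    · rw [ofReal_apply, (h1.self_of_nhdsSet) x.1 hx, one_smul, one_mul]
    · rw [hgK x hx, mul_zero]

/-- The superfunctions with compact support. -/
def compactFun (m : ℕ) (V : Opens (Fin n → ℝ)) : Submodule ℝ (superFun m V) where
  carrier := {f | HasCompactSupp f}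
  add_mem' := HasCompactSupp.add
  zero_mem' := HasCompactSupp.zero
  smul_mem' r _ hf := hf.smul r

theorem exists_linear_berezinIntegral (m : ℕ) (V : Opens (Fin n → ℝ)) :
    ∃ Λ : superFun m V →ₗ[ℝ] ℝ, ∀ f, HasCompactSupp f → Λ f = berezinIntegral f.1 := by
  let Λ₀ : compactFun m V →ₗ[ℝ] ℝ :=
    { toFun := fun f => berezinIntegral f.1.1
      map_add' := fun f g => berezinIntegral_add f.2 g.2
      map_smul' := fun r f => berezinIntegral_smul r f.1 }
  obtain ⟨Λ, hΛ⟩ := LinearMap.exists_extend Λ₀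
  exact ⟨Λ, fun f hf => LinearMap.congr_fun hΛ ⟨f, hf⟩⟩

/-- A linear functional on superfunctions that equals the Berezin integral on those with compact
support. (The values on other superfunctions play no role.) -/
noncomputable def berezinFunctional (m : ℕ) (V : Opens (Fin n → ℝ)) : superFun m V →ₗ[ℝ] ℝ :=
  (exists_linear_berezinIntegral m V).choose

theorem berezinFunctional_eq {f : superFun m V} (hf : HasCompactSupp f) :
    berezinFunctional m V f = berezinIntegral f.1 :=
  (exists_linear_berezinIntegral m V).choose_spec f hf

theorem hasCompactSupp_of_add {f g : superFun m V} (hf : superFunParity 0 f)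
    (hg : superFunParity 1 g) (h : HasCompactSupp (f + g)) :
    HasCompactSupp f ∧ HasCompactSupp g := by
  obtain ⟨K, hK, hKV, hfg⟩ := h
  have key : ∀ x : V, x.1 ∉ K → f.1 x = 0 ∧ g.1 x = 0 := by
    intro x hx
    have hs : f.1 x + g.1 x = 0 := hfg x hx
    have hf0 : f.1 x = 0 := by
      refine Grassmann.ext fun I => ?_
      by_cases hI : (I.card : ZMod 2) = 0
      · have h1 : g.1 x I = 0 := hg x I (by rw [hI]; decide)
        have h2 := congrArg (coeff I) hs
        rw [map_add, map_zero, coeff_apply, coeff_apply, h1, add_zero] at h2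
        exact h2
      · exact hf x I hI
    rw [hf0, zero_add] at hs
    exact ⟨hf0, hs⟩
  exact ⟨⟨K, hK, hKV, fun x hx => (key x hx).1⟩, ⟨K, hK, hKV, fun x hx => (key x hx).2⟩⟩

end CompactSupports

namespace Supermanifold

variable {n m : ℕ} {M : Supermanifold.{u, v} n m}

section Integration

/-- The integral over the chart `i` of the component of weight `1`. -/
noncomputable def integralIn (i : M.ι) : M.DensityAlgebra →ₗ[ℝ] ℝ where
  toFun Ψ := berezinFunctional m (M.domain i) ((component 1 Ψ).1 i)
  map_add' Ψ Φ := by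
    rw [map_add]
    exact map_add (berezinFunctional m (M.domain i)) ((component 1 Ψ).1 i) ((component 1 Φ).1 i)
  map_smul' r Ψ := by
    rw [map_smul]
    exact map_smul (berezinFunctional m (M.domain i)) r ((component 1 Ψ).1 i)

theorem integralIn_apply (i : M.ι) (Ψ : M.DensityAlgebra) :
    integralIn i Ψ = berezinFunctional m (M.domain i) ((component 1 Ψ).1 i) := rfl

theorem integralIn_ofWeight_of_ne (i : M.ι) {w : ℝ} (hw : w ≠ 1) (ψ : M.densities w) :
    integralIn i (ofWeight w ψ) = 0 := by
  rw [integralIn_apply, component_ofWeight_of_ne hw]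
  exact map_zero _

theorem integralIn_ofWeight (i : M.ι) {w : ℝ} (hw : w = 1) (ψ : M.densities w) :
    integralIn i (ofWeight w ψ) = berezinFunctional m (M.domain i) (ψ.1 i) := by
  subst hw
  rw [integralIn_apply, component_ofWeight]

/-- All components of `Ψ` have compact support in the coordinates of the chart `i`. -/
def CompactIn (i : M.ι) (Ψ : M.DensityAlgebra) : Prop :=
  ∀ w, HasCompactSupp ((component w Ψ).1 i)

variable {i : M.ι}

theorem CompactlySupportedIn.compactIn {Ψ : M.DensityAlgebra} (h : CompactlySupportedIn i Ψ) :
    CompactIn i Ψ := by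
  obtain ⟨K, hK, hKs, hΨ⟩ := h
  refine fun w => ⟨M.chart i '' K, hK.image_of_continuousOn ((M.chart i).continuousOn.mono hKs), ?_,
    fun x hx => hΨ w i x fun h => hx ⟨_, h, (M.chart i).right_inv x.2⟩⟩
  rintro _ ⟨p, hp, rfl⟩
  exact (M.chart i).map_source (hKs hp)

theorem compactIn_zero : CompactIn i (0 : M.DensityAlgebra) := fun w => by
  rw [map_zero]; exact HasCompactSupp.zero

theorem CompactIn.add {Ψ Φ : M.DensityAlgebra} (hΨ : CompactIn i Ψ) (hΦ : CompactIn i Φ) :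
    CompactIn i (Ψ + Φ) := fun w => by
  rw [map_add]; exact (hΨ w).add (hΦ w)

theorem CompactIn.smul {Ψ : M.DensityAlgebra} (hΨ : CompactIn i Ψ) (r : ℝ) :
    CompactIn i (r • Ψ) := fun w => by
  rw [map_smul]; exact (hΨ w).smul r

theorem compactIn_ofWeight {w : ℝ} {ψ : M.densities w} (h : HasCompactSupp (ψ.1 i)) :
    CompactIn i (ofWeight w ψ) := by
  intro w'
  by_cases hw : w = w'
  · subst hw
    rwa [component_ofWeight]
  · rw [component_ofWeight_of_ne hw]
    exact HasCompactSupp.zero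

theorem compactIn_induction {C : M.DensityAlgebra → Prop} (h0 : C 0)
    (hadd : ∀ Ψ Φ, C Ψ → C Φ → C (Ψ + Φ))
    (hof : ∀ p w (ψ : M.densities w), (∀ j, superFunParity p (ψ.1 j)) → HasCompactSupp (ψ.1 i) →
      C (ofWeight w ψ)) {Ψ : M.DensityAlgebra} (hΨ : CompactIn i Ψ) : C Ψ := by
  obtain ⟨s, hs⟩ := sum_ofWeight_component Ψ
  rw [← hs]
  refine Finset.sum_induction _ C hadd h0 fun w _ => ?_
  have h := hΨ w
  obtain ⟨ψ₀, ψ₁, h1, h2, h3⟩ := exists_parts w (component w Ψ)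
  rw [h3] at h ⊢
  rw [map_add]
  have h4 := hasCompactSupp_of_add (h1 i) (h2 i) h
  exact hadd _ _ (hof 0 w ψ₀ h1 h4.1) (hof 1 w ψ₁ h2 h4.2)

theorem CompactIn.mul_right {Ψ : M.DensityAlgebra} (hΨ : CompactIn i Ψ) (Φ : M.DensityAlgebra) :
    CompactIn i (Ψ * Φ) := by
  refine compactIn_induction (C := fun Ψ => CompactIn i (Ψ * Φ)) ?_ ?_ ?_ hΨ
  · rw [zero_mul]; exact compactIn_zero
  · intro Ψ Ψ' h h'
    rw [add_mul]; exact h.add h'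
  · intro p w ψ _ hψ
    refine density_induction (C := fun Φ => CompactIn i (ofWeight w ψ * Φ)) ?_ ?_ ?_ Φ
    · rw [mul_zero]; exact compactIn_zero
    · intro Φ Φ' h h'
      rw [mul_add]; exact h.add h'
    · intro w' χ
      rw [ofWeight_mul]
      exact compactIn_ofWeight (HasCompactSupp.mul_right hψ (χ.1 i))

theorem CompactIn.mul_left {Ψ : M.DensityAlgebra} (hΨ : CompactIn i Ψ) (Φ : M.DensityAlgebra) :
    CompactIn i (Φ * Ψ) := by
  refine compactIn_induction (C := fun Ψ => CompactIn i (Φ * Ψ)) ?_ ?_ ?_ hΨ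
  · rw [mul_zero]; exact compactIn_zero
  · intro Ψ Ψ' h h'
    rw [mul_add]; exact h.add h'
  · intro p w ψ _ hψ
    refine density_induction (C := fun Φ => CompactIn i (Φ * ofWeight w ψ)) ?_ ?_ ?_ Φ
    · rw [zero_mul]; exact compactIn_zero
    · intro Φ Φ' h h'
      rw [add_mul]; exact h.add h'
    · intro w' χ
      rw [ofWeight_mul]
      exact compactIn_ofWeight (HasCompactSupp.mul_left hψ (χ.1 i))

theorem scalarProduct_eq {Ψ Φ : M.DensityAlgebra} (h : CompactIn i (Ψ * Φ)) :
    scalarProduct i Ψ Φ = integralIn i (Ψ * Φ) :=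
  (berezinFunctional_eq (h 1)).symm

theorem component_mul_ofWeight (Ξ : M.DensityAlgebra) (w w' : ℝ) (χ : M.densities w') :
    (component (w + w') (Ξ * ofWeight w' χ)).1 = (component w Ξ).1 * χ.1 := by
  refine density_induction (C := fun Ξ => (component (w + w') (Ξ * ofWeight w' χ)).1 =
    (component w Ξ).1 * χ.1) ?_ ?_ ?_ Ξ
  · rw [zero_mul, map_zero, map_zero]
    exact (zero_mul χ.1).symm
  · intro Ξ Ξ' h h'
    rw [add_mul, map_add, map_add]
    change (component (w + w') (Ξ * ofWeight w' χ)).1 + (component (w + w') (Ξ' * ofWeight w' χ)).1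
      = ((component w Ξ).1 + (component w Ξ').1) * χ.1
    rw [h, h', add_mul]
  · intro u ξ
    rw [ofWeight_mul]
    by_cases hu : u = w
    · subst hu
      rw [component_ofWeight, component_ofWeight]
      rfl
    · rw [component_ofWeight_of_ne hu, component_ofWeight_of_ne fun h => hu (add_right_cancel h)]
      exact (zero_mul χ.1).symm

/-- The canonical scalar product is nondegenerate. -/
theorem eq_zero_of_integralIn {Ξ : M.DensityAlgebra}
    (h : ∀ (i : M.ι) (q : ZMod 2) (w : ℝ) (g : superFun m (M.domain i)) (hg : HasCompactSupp g),
      superFunParity q g → integralIn i (Ξ * ofWeight w (extDensity w g hg)) = 0) : Ξ = 0 := by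
  have hz : ∀ w, component w Ξ = 0 := by
    intro w
    refine Subtype.ext (funext fun i => eq_zero_of_berezinIntegral fun q g hq hg => ?_)
    have h1 := h i q (1 - w) g hg hq
    have h2 : (component 1 (Ξ * ofWeight (1 - w) (extDensity (1 - w) g hg))).1 =
        (component w Ξ).1 * (extDensity (1 - w) g hg).1 := by
      rw [← component_mul_ofWeight, add_sub_cancel]
    rw [integralIn_apply, h2] at h1
    change berezinFunctional m _ ((component w Ξ).1 i * (extDensity (1 - w) g hg).1 i) = 0 at h1
    rw [extDensity_coord, berezinFunctional_eq (hg.mul_left _)] at h1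
    exact h1
  obtain ⟨s, hs⟩ := sum_ofWeight_component Ξ
  rw [← hs]
  exact Finset.sum_eq_zero fun w _ => by rw [hz, map_zero]

end Integration

end Supermanifold

namespace Supermanifold

open Grassmann Filter Topology

variable {n m : ℕ} {M : Supermanifold.{u, v} n m} {ε : ZMod 2} {B : BilinearOperation M} {l : ℝ}

/-! ### Duality of the canonical operator and the bracket -/

/-- The operator `Δ` is dual to minus one half of the bracket `B`: `⟨Δ Ψ, Φ⟩ = -½ ∫ {Ψ, Φ}`. -/
def IsDual (Δ : Operator M) (B : BilinearOperation M) : Prop :=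
  ∀ (i : M.ι) (Ψ Φ : M.DensityAlgebra), CompactIn i Ψ ∨ CompactIn i Φ →
    integralIn i (Δ Ψ * Φ) = -(1 / 2) * integralIn i (B Ψ Φ)

theorem isDual_of_homogeneous {Δ : Operator M}
    (h : ∀ (i : M.ι) (p q : ZMod 2) (w w' : ℝ) (ψ : M.densities w) (χ : M.densities w'),
      (∀ j, superFunParity p (ψ.1 j)) → (∀ j, superFunParity q (χ.1 j)) →
      HasCompactSupp (ψ.1 i) ∨ HasCompactSupp (χ.1 i) →
      integralIn i (Δ (ofWeight w ψ) * ofWeight w' χ) =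
        -(1 / 2) * integralIn i (B (ofWeight w ψ) (ofWeight w' χ))) : IsDual Δ B := by
  have add_left : ∀ i Ψ Ψ' Φ, integralIn i (Δ Ψ * Φ) = -(1 / 2) * integralIn i (B Ψ Φ) →
      integralIn i (Δ Ψ' * Φ) = -(1 / 2) * integralIn i (B Ψ' Φ) →
      integralIn i (Δ (Ψ + Ψ') * Φ) = -(1 / 2) * integralIn i (B (Ψ + Ψ') Φ) := by
    intro i Ψ Ψ' Φ h1 h2
    rw [map_add, map_add, add_mul, map_add, LinearMap.add_apply, map_add, h1, h2, mul_add]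
  have add_right : ∀ i Ψ Φ Φ', integralIn i (Δ Ψ * Φ) = -(1 / 2) * integralIn i (B Ψ Φ) →
      integralIn i (Δ Ψ * Φ') = -(1 / 2) * integralIn i (B Ψ Φ') →
      integralIn i (Δ Ψ * (Φ + Φ')) = -(1 / 2) * integralIn i (B Ψ (Φ + Φ')) := by
    intro i Ψ Φ Φ' h1 h2
    rw [map_add, mul_add, map_add, map_add, h1, h2, mul_add]
  rintro i Ψ Φ (hc | hc)
  · refine compactIn_induction (C := fun Ψ => integralIn i (Δ Ψ * Φ) =
      -(1 / 2) * integralIn i (B Ψ Φ)) (by simp) (fun Ψ Ψ' => add_left i Ψ Ψ' Φ) ?_ hc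
    intro p w ψ hψ hψc
    exact homogeneous_induction (C := fun Φ => integralIn i (Δ (ofWeight w ψ) * Φ) =
      -(1 / 2) * integralIn i (B (ofWeight w ψ) Φ)) (by simp) (fun Φ Φ' => add_right i _ Φ Φ')
      (fun q w' χ hχ => h i p q w w' ψ χ hψ hχ (Or.inl hψc)) Φ
  · refine compactIn_induction (C := fun Φ => integralIn i (Δ Ψ * Φ) =
      -(1 / 2) * integralIn i (B Ψ Φ)) (by simp) (fun Φ Φ' => add_right i Ψ Φ Φ') ?_ hc
    intro q w' χ hχ hχc
    exact homogeneous_induction (C := fun Ψ => integralIn i (Δ Ψ * ofWeight w' χ) =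
      -(1 / 2) * integralIn i (B Ψ (ofWeight w' χ))) (by simp) (fun Ψ Ψ' => add_left i Ψ Ψ' _)
      (fun p w ψ hψ => h i p q w w' ψ χ hψ hχ (Or.inr hχc)) Ψ

section

variable {D : ∀ i, BracketData m (M.domain i)} (hl : BracketHasWeight l B)
  (hD : ∀ i, (D i).IsSymmetric ε) (hrep : ∀ i, (D i).Represents B)

theorem isDual_canonicalOperator : IsDual (canonicalOperator hl hD hrep) B := by
  refine isDual_of_homogeneous fun i p q w w' ψ χ hψ _ hc => ?_
  obtain ⟨φ, hφ⟩ := hl.1 w w' ψ χ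
  rw [hφ, canonicalOperator_ofWeight, ofWeight_mul]
  by_cases hw : w' = 1 - w - l
  · subst hw
    have hφi : φ.1 i = (D i).bracketFun w p (1 - w - l) (ψ.1 i) (χ.1 i) := by
      rw [← (hrep i).coordHom_eq χ (hψ i), hφ, coordHom_ofWeight]
    rw [integralIn_ofWeight i (by ring), integralIn_ofWeight i (by ring), hφi]
    change berezinFunctional m _ ((D i).op ε l w (ψ.1 i) * χ.1 i) = _
    rw [(hD i).op_mul l w (hψ i), map_smul, map_sub, map_sum, Finset.sum_eq_zero, zero_sub,
      smul_neg, neg_mul, smul_eq_mul]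
    intro a _
    have hv := (D i).hasCompactSupp_flux_mul w hc a
    rw [map_smul, berezinFunctional_eq (hv.pdFun a), berezinIntegral_pdFun hv, smul_zero]
  · rw [integralIn_ofWeight_of_ne i (fun h => hw (by linarith)),
      integralIn_ofWeight_of_ne i (fun h => hw (by linarith)), mul_zero]

theorem compactIn_canonicalOperator {i : M.ι} {Ψ : M.DensityAlgebra} (hΨ : CompactIn i Ψ) :
    CompactIn i (canonicalOperator hl hD hrep Ψ) := by
  refine compactIn_induction (C := fun Ψ => CompactIn i (canonicalOperator hl hD hrep Ψ)) ?_ ?_ ?_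
    hΨ
  · rw [map_zero]; exact compactIn_zero
  · intro Ψ Ψ' h h'
    rw [map_add]; exact h.add h'
  · intro p w ψ _ hψ
    rw [canonicalOperator_ofWeight]
    exact compactIn_ofWeight ((D i).hasCompactSupp_op ε l w hψ)

end

theorem compactIn_bracket (hl : BracketHasWeight l B) {i : M.ι} {D : BracketData m (M.domain i)}
    (hrep : D.Represents B) {Ψ : M.DensityAlgebra} (hΨ : CompactIn i Ψ) (Φ : M.DensityAlgebra) :
    CompactIn i (B Ψ Φ) := by
  refine compactIn_induction (C := fun Ψ => CompactIn i (B Ψ Φ)) ?_ ?_ ?_ hΨ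
  · rw [map_zero]; exact compactIn_zero
  · intro Ψ Ψ' h h'
    rw [map_add]; exact h.add h'
  intro p w ψ hψ hψc
  refine density_induction (C := fun Φ => CompactIn i (B (ofWeight w ψ) Φ)) ?_ ?_ ?_ Φ
  · rw [map_zero]; exact compactIn_zero
  · intro Ψ Ψ' h h'
    rw [map_add]; exact h.add h'
  intro w' χ
  obtain ⟨φ, hφ⟩ := hl.1 w w' ψ χ
  have hφi : φ.1 i = D.bracketFun w p w' (ψ.1 i) (χ.1 i) := by
    rw [← hrep.coordHom_eq χ (hψ i), hφ, coordHom_ofWeight]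
  rw [hφ]
  refine compactIn_ofWeight ?_
  rw [hφi]
  exact D.hasCompactSupp_bracketFun w hψc

/-- An operator that is dual to the bracket generates it: pairing the defect with a test density `X`
leaves an identity between brackets of `f`, `g` and `X`, which follows from the Leibniz rule. -/
theorem IsDual.generates {Δ : Operator M} (hΔ : IsDual Δ B) (hB : IsBracket ε B)
    (hp : ∀ p f, HasParity p f → HasParity (ε + p) (Δ f)) (h1 : Δ 1 = 0) : Generates ε Δ B := by
  intro p f g hf
  rw [h1, zero_mul, zero_mul, add_zero]
  refine parity_induction (C := fun g => B f g = Δ (f * g) - Δ f * g - koszul ε p • (f * Δ g))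
    (fun g g' h h' => ?_) (fun q g hg => ?_) g
  · rw [map_add, h, h', mul_add, map_add, mul_add, map_add, mul_add, smul_add]
    abel
  rw [eq_comm, ← sub_eq_zero]
  refine eq_zero_of_integralIn fun i r w k hk hr => ?_
  set X := ofWeight w (extDensity w k hk)
  have hX : HasParity r X := hasParity_ofWeight (extDensity_parity w hk hr)
  have hXc : CompactIn i X := compactIn_ofWeight (by rw [extDensity_coord]; exact hk)
  have e1 := hΔ i (f * g) X (Or.inr hXc)
  have e2 := hΔ i f (g * X) (Or.inr (hXc.mul_left g))
  have e3 := hΔ i g (f * X) (Or.inr (hXc.mul_left f))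
  have b1 : B (f * g) X = (koszul (p + q) r * (koszul r p * koszul (ε + p + r) q)) • (g * B f X) +
      (koszul (p + q) r * koszul (ε + r) p * koszul r q) • (f * B g X) := by
    rw [hB.2.1 _ _ _ _ (hf.mul hg) hX, hB.2.2 r p X f g hX hf, hB.2.1 r p X f hX hf,
      hB.2.1 r q X g hX hg, smul_mul_assoc, (hB.1 p r f X hf hX).mul_comm hg, mul_smul_comm,
      smul_add, smul_smul, smul_smul, smul_smul, smul_smul, mul_assoc]
  rw [b1, map_add, map_smul, map_smul] at e1
  rw [hB.2.2 p q f g X hf hg, map_add, map_smul] at e2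
  rw [hB.2.2 q p g f X hg hf, hB.2.1 q p g f hg hf, smul_mul_assoc, map_add, map_smul,
    map_smul] at e3
  rw [sub_mul, sub_mul, sub_mul, hf.mul_comm (hp q g hg), smul_smul, smul_mul_assoc, mul_assoc,
    mul_assoc, map_sub, map_sub, map_sub, map_smul, e1, e2, e3]
  simp only [smul_eq_mul]
  rcases zmod_two_cases p with rfl | rfl <;> rcases zmod_two_cases q with rfl | rfl <;>
    rcases zmod_two_cases r with rfl | rfl <;> rcases zmod_two_cases ε with rfl | rfl <;>
    simp only [koszul_add_left, koszul_add_right, koszul_zero_left, koszul_zero_right,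
      koszul_one_one] <;> ring

theorem IsDual.isSelfAdjoint {Δ : Operator M} (hΔ : IsDual Δ B) (hB : IsBracket ε B)
    (hp : ∀ p f, HasParity p f → HasParity (ε + p) (Δ f))
    (hc : ∀ i Ψ, CompactIn i Ψ → CompactIn i (Δ Ψ)) : IsSelfAdjoint ε Δ := by
  intro i p Ψ Φ hΨ hΨc
  have hcΨ := hΨc.compactIn
  rw [scalarProduct_eq ((hc i Ψ hcΨ).mul_right Φ), scalarProduct_eq (hcΨ.mul_right (Δ Φ))]
  refine parity_induction (C := fun Φ => integralIn i (Δ Ψ * Φ) =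
    koszul ε p * integralIn i (Ψ * Δ Φ)) (fun Φ Φ' h h' => ?_) (fun q Φ hΦ => ?_) Φ
  · rw [mul_add, map_add, h, h', map_add, mul_add, map_add, mul_add]
  · rw [hΔ i Ψ Φ (Or.inl hcΨ), hΨ.mul_comm (hp q Φ hΦ), map_smul, hΔ i Φ Ψ (Or.inr hcΨ),
      hB.2.1 q p Φ Ψ hΦ hΨ, map_smul, smul_eq_mul, smul_eq_mul]
    rcases zmod_two_cases p with rfl | rfl <;> rcases zmod_two_cases q with rfl | rfl <;>
      rcases zmod_two_cases ε with rfl | rfl <;>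
      simp only [koszul_add_right, koszul_zero_left, koszul_zero_right, koszul_one_one] <;> ring

theorem compactlySupportedIn_extDensity {i : M.ι} (w : ℝ) {f : superFun m (M.domain i)}
    (hf : HasCompactSupp f) : CompactlySupportedIn i (ofWeight w (extDensity w f hf)) := by
  obtain ⟨K, hK, hKs, h⟩ := extDensity_support w hf
  refine ⟨K, hK, hKs, fun w' j x hx => ?_⟩
  by_cases hw : w = w'
  · subst hw
    rw [component_ofWeight]
    exact h j x hx
  · rw [component_ofWeight_of_ne hw]
    rfl

/-- A normalized operator that generates a bracket preserves compact supports: with a cut-off function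
`E` such that `E Y = Y`, the generating identity for `E` and `Y` expresses `Δ Y` by terms supported in
the chart. -/
theorem compactIn_of_generates (hl : BracketHasWeight l B) {i : M.ι}
    {D : BracketData m (M.domain i)} (hrep : D.Represents B) {Δ : Operator M}
    (hΔ : Generates ε Δ B) (h1 : Δ 1 = 0) (w : ℝ) {f : superFun m (M.domain i)}
    (hf : HasCompactSupp f) : CompactIn i (Δ (ofWeight w (extDensity w f hf))) := by
  obtain ⟨h, h0, hc, hhf⟩ := exists_cutoff_of_hasCompactSupp hf
  set E := ofWeight 0 (extDensity 0 h hc) with hE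
  set Y := ofWeight w (extDensity w f hf) with hY
  have hEc : CompactIn i E := compactIn_ofWeight (by rw [extDensity_coord]; exact hc)
  have hYc : CompactIn i Y := compactIn_ofWeight (by rw [extDensity_coord]; exact hf)
  have hEY : E * Y = Y := by
    rw [hE, hY, ofWeight_mul, extDensity_mul 0 w hc _ (hc.mul_right _)]
    refine ofWeight_congr (zero_add w) ?_
    have : densityCast (zero_add w) (extDensity (0 + w) (h * (extDensity w f hf).1 i)
        (hc.mul_right _)) = extDensity w f hf := by
      refine density_ext_chart i ?_ fun j y hy => ?_
      · refine (extDensity_coord (0 + w) (hc.mul_right _)).trans ?_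
        rw [extDensity_coord, hhf]
      · exact (extDensity_eq_zero (0 + w) (hc.mul_right _) j y hy).trans
          (extDensity_eq_zero w hf j y hy).symm
    exact congrArg Subtype.val this
  have h2 := hΔ 0 E Y (hasParity_ofWeight (extDensity_parity 0 hc h0))
  rw [h1, zero_mul, zero_mul, add_zero, hEY] at h2
  have h3 : Δ Y = B E Y + Δ E * Y + koszul ε 0 • (E * Δ Y) := by
    rw [h2]; abel
  rw [h3]
  exact ((compactIn_bracket hl hrep hEc Y).add (hYc.mul_left _)).add ((hEc.mul_right _).smul _)

/-- Every normalized self-adjoint operator that generates the bracket is dual to it, as far as test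
densities are concerned. -/
theorem IsCanonicalFor.integralIn_mul (hB : IsBracket ε B) (hl : BracketHasWeight l B) {i : M.ι}
    {D : BracketData m (M.domain i)} (hrep : D.Represents B) {Δ : Operator M}
    (hΔ : IsCanonicalFor ε Δ B) {p q : ZMod 2} {w w' : ℝ} {ψ : M.densities w}
    (hψ : ∀ j, superFunParity p (ψ.1 j)) {g : superFun m (M.domain i)} (hg : HasCompactSupp g)
    (hq : superFunParity q g) :
    integralIn i (Δ (ofWeight w ψ) * ofWeight w' (extDensity w' g hg)) =
      -(1 / 2) * integralIn i (B (ofWeight w ψ) (ofWeight w' (extDensity w' g hg))) := by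
  obtain ⟨hS, hG, h1, hA⟩ := hΔ
  set Ψ := ofWeight w ψ with hΨd
  set X := ofWeight w' (extDensity w' g hg) with hXd
  have hΨ : HasParity p Ψ := hasParity_ofWeight hψ
  have hX : HasParity q X := hasParity_ofWeight (extDensity_parity w' hg hq)
  have hXc : CompactIn i X := (compactlySupportedIn_extDensity w' hg).compactIn
  have hgψ := hg.mul_right (ψ.1 i)
  have hXΨ : X * Ψ = ofWeight (w' + w) (extDensity (w' + w) (g * ψ.1 i) hgψ) := by
    rw [hΨd, hXd, ofWeight_mul, extDensity_mul w' w hg ψ hgψ]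
  have s1 := hA i q X Ψ hX (compactlySupportedIn_extDensity w' hg)
  rw [scalarProduct_eq ((compactIn_of_generates hl hrep hG h1 w' hg).mul_right Ψ),
    scalarProduct_eq (hXc.mul_right _)] at s1
  have s2 := hA i (q + p) (X * Ψ) 1 (hX.mul hΨ)
    (by rw [hXΨ]; exact compactlySupportedIn_extDensity _ hgψ)
  have hXΨc : CompactIn i (Δ (X * Ψ)) := by
    rw [hXΨ]
    exact compactIn_of_generates hl hrep hG h1 _ hgψ
  rw [scalarProduct_eq (hXΨc.mul_right 1), scalarProduct_eq ((hXc.mul_right Ψ).mul_right _), h1,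
    mul_one, mul_zero, map_zero, mul_zero] at s2
  have s3 := congrArg (integralIn i) (hG q X Ψ hX)
  rw [h1, zero_mul, zero_mul, add_zero, map_sub, map_sub, map_smul, s1, s2] at s3
  rw [(hS.1 p Ψ hΨ).mul_comm hX, hB.2.1 p q Ψ X hΨ hX, map_smul, map_smul, s3, smul_eq_mul,
    smul_eq_mul, smul_eq_mul]
  rcases zmod_two_cases p with rfl | rfl <;> rcases zmod_two_cases q with rfl | rfl <;>
    rcases zmod_two_cases ε with rfl | rfl <;>
    simp only [koszul_add_left, koszul_zero_left, koszul_zero_right, koszul_one_one] <;> ring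

/-! ### Canonical operators and canonical pencils -/

section

variable {D : ∀ i, BracketData m (M.domain i)} (hl : BracketHasWeight l B)
  (hD : ∀ i, (D i).IsSymmetric ε) (hrep : ∀ i, (D i).Represents B)

theorem isCanonicalFor_canonicalOperator (hB : IsBracket ε B) :
    IsCanonicalFor ε (canonicalOperator hl hD hrep) B := by
  have hp : ∀ p f, HasParity p f → HasParity (ε + p) (canonicalOperator hl hD hrep f) :=
    fun p f hf => canonicalOperator_parity hl hD hrep hf
  have h1 := canonicalOperator_one hl hD hrep
  have hd := isDual_canonicalOperator hl hD hrep
  have hG := hd.generates hB hp h1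
  exact ⟨isSecondOrder_of_generates hB hp hG h1, hG, h1,
    hd.isSelfAdjoint hB hp fun i Ψ hΨ => compactIn_canonicalOperator hl hD hrep hΨ⟩

theorem IsCanonicalFor.eq_canonicalOperator (hB : IsBracket ε B) {Δ : Operator M}
    (hΔ : IsCanonicalFor ε Δ B) : Δ = canonicalOperator hl hD hrep := by
  refine LinearMap.ext fun Ψ => homogeneous_induction
    (C := fun Ψ => Δ Ψ = canonicalOperator hl hD hrep Ψ) (by rw [map_zero, map_zero])
    (fun Ψ Φ h h' => by rw [map_add, map_add, h, h']) (fun p w ψ hψ => ?_) Ψ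
  rw [← sub_eq_zero]
  refine eq_zero_of_integralIn fun i q w' g hg hq => ?_
  rw [sub_mul, map_sub, hΔ.integralIn_mul hB hl (hrep i) hψ hg hq,
    isDual_canonicalOperator hl hD hrep i _ _
      (Or.inr (compactlySupportedIn_extDensity w' hg).compactIn), sub_self]

end

end Supermanifold

theorem theorem1 {n m : ℕ} (M : Supermanifold n m) (ε : ZMod 2) :
    -- every second-order operator generates a bracket
    (∀ Δ : M.Operator, Supermanifold.IsSecondOrder ε Δ →
      ∃ B : M.BilinearOperation,
        Supermanifold.IsBracket ε B ∧ Supermanifold.Generates ε Δ B ∧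
        (∀ B' : M.BilinearOperation, Supermanifold.Generates ε Δ B' → B' = B) ∧
        ∀ l : ℝ, Supermanifold.OperatorHasWeight l Δ → Supermanifold.BracketHasWeight l B) ∧
    -- every bracket has one and only one normalized self-adjoint generating operator
    (∀ (l : ℝ) (B : M.BilinearOperation),
      Supermanifold.IsBracket ε B → Supermanifold.BracketHasWeight l B →
      ∃ Δ : M.Operator,
        Supermanifold.IsCanonicalFor ε Δ B ∧ Supermanifold.OperatorHasWeight l Δ ∧
        ∀ Δ' : M.Operator, Supermanifold.IsCanonicalFor ε Δ' B → Δ' = Δ) ∧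
    -- a bracket of weight zero is given by the data `(S, γ, θ)`, and its canonical operator is the
    -- canonical pencil
    (∀ B : M.BilinearOperation,
      Supermanifold.IsBracket ε B → Supermanifold.BracketHasWeight 0 B →
      ∀ i : M.ι, ∃ D : Supermanifold.BracketData m (M.domain i),
        D.IsSymmetric ε ∧ D.Represents B ∧
        (∀ D' : Supermanifold.BracketData m (M.domain i),
          D'.IsSymmetric ε → D'.Represents B → D' = D) ∧
        ∀ Δ : M.Operator, Supermanifold.IsCanonicalFor ε Δ B →
          ∀ (w : ℝ) (ψ : M.densities w) (x : M.domain i),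
            Supermanifold.coord i (Δ (Supermanifold.ofWeight w ψ)) x =
              D.pencil ε w (ψ.1 i).1 x) := by
  refine ⟨fun Δ hΔ => ⟨Supermanifold.generatedBracket ε Δ,
    Supermanifold.isBracket_generatedBracket hΔ, Supermanifold.generates_generatedBracket Δ,
    fun B' hB' => (Supermanifold.generates_generatedBracket Δ).unique hB',
    fun l hl => Supermanifold.bracketHasWeight_generatedBracket hl⟩, fun l B hB hl => ?_,
    fun B hB hl i => ?_⟩
  · choose D hD hrep using fun i => Supermanifold.exists_bracketData hB hl i
    exact ⟨Supermanifold.canonicalOperator hl hD hrep,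
      Supermanifold.isCanonicalFor_canonicalOperator hl hD hrep hB,
      Supermanifold.canonicalOperator_hasWeight hl hD hrep,
      fun Δ' hΔ' => hΔ'.eq_canonicalOperator hl hD hrep hB⟩
  · choose D hD hrep using fun i => Supermanifold.exists_bracketData hB hl i
    refine ⟨D i, hD i, hrep i, fun D' hD' hrep' => (hrep i).unique (hD i) hD' hrep',
      fun Δ hΔ w ψ x => ?_⟩
    rw [hΔ.eq_canonicalOperator hl hD hrep hB, Supermanifold.coord_eq,
      Supermanifold.canonicalOperator_ofWeight, Supermanifold.coordHom_ofWeight]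
    exact (D i).op_eq_pencil ε w (hD i) (ψ.1 i) x
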